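/- Let $(A,[\cdot,\cdot],\rho)$ be a Lie algebroid over a smooth manifold $M$, with differential $d$ on $\Gamma(\bigwedge^\bullet A^*)$. Let $\pi\in\Gamma(\bigwedge^2A)$, $N\in\Gamma(A\otimes A^*)$, $\sigma\in\Gamma(\bigwedge^2A^*)$, $H\in\Gamma(\bigwedge^3A^*)$; write $\pi^\sharp\alpha=\pi(\alpha,\cdot)$, $\sigma^\flat X=\sigma(X,\cdot)$, and $$[X,Y]_N=[NX,Y]+[X,NY]-N[X,Y],\qquad [\alpha,\beta]_\pi=\mathcal L_{\pi^\sharp\alpha}\beta-\mathcal L_{\pi^\sharp\beta}\alpha-d(\pi(\alpha,\beta)),$$ $$T_N(X,Y)=[NX,NY]-N[X,Y]_N,\qquad C_{\pi,N}=([\cdot,\cdot]_N)_\pi-([\cdot,\cdot]_\pi)_{{}^tN},$$ $$\mathcal H(X,Y,Z)=H(NX,NY,Z)+H(NY,NZ,X)+H(NZ,NX,Y),$$ and let $d_N$ be the differential defined by $[\cdot,\cdot]_N$ and the anchor $\rho\circ N$. For $\psi\in\Gamma(\bigwedge^3A^*)$, the quadruple $(\pi,N,\psi,H)$ is a *Poisson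 quasi-Nijenhuis structure with background* if $N\pi^\sharp=\pi^\sharp\,{}^tN$, $d\psi=0$, $dH=0$, $[\pi,\pi]_{SN}=0$, $d_N\psi=d\mathcal H$ and, for all $X,Y\in\Gamma(A)$, $\alpha,\beta\in\Gamma(A^*)$, $$C_{\pi,N}(\alpha,\beta)=2H(\pi^\sharp\alpha,\pi^\sharp\beta,\cdot),\qquad T_N(X,Y)=-\pi^\sharp\big(H(NX,Y,\cdot)-H(NY,X,\cdot)+\psi(X,Y,\cdot)\big).$$ Let $\mu+H$ denote the Courant structure on $A\oplus A^*$ with pairing $\langle X+\alpha,Y+\beta\rangle=\beta(X)+\alpha(Y)$, anchor $X+\alpha\mapsto\rho(X)$ and Dorfman bracket $$[X+\alpha,Y+\beta]=[X,Y]+\mathcal L_X\beta-i_Yd\alpha-H(X,Y,\cdot),$$ let $J=\pi+N+\sigma$ denote the endomorphism $J(X+\alpha)=(NX+\pi^\sharp\alpha)+(\sigma^\flat X-{}^tN\alpha)$, and let $S_J=\{\pi+N+\sigma,\mu+H\}$ be the deformed structure, with anchor the composite of $J$ and the anchor above, and bracket $[x,y]_J=[Jx,y]+[x,Jy]-J[x,y]$.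 **Theorem.** If $(\pi,N,-d\sigma,H)$ is a Poisson quasi-Nijenhuis structure with background on $A$, then: 1. $S_J=\{\pi+N+\sigma,\mu+H\}$ defines a Lie quasi-bialgebroid structure on $(A^*,A)$, that is: the bracket and anchor of $S_J$ restrict to a Lie algebroid structure on $A^*$; and there are a degree one derivation $\delta$ of the Gerstenhaber algebra $(\Gamma(\bigwedge^\bullet A^*),\wedge,[\cdot,\cdot])$ of this Lie algebroid, and a $\varphi\in\Gamma(\bigwedge^3A^*)$, with $\delta^2=[\varphi,\cdot]$ and $\delta\varphi=0$, which are given by $S_J$: if $\rho_J$ is the anchor of $S_J$ and $[X,Y]_J=[X,Y]'+\varphi'(X,Y)$ with $[X,Y]'\in\Gamma(A)$, $\varphi'(X,Y)\in\Gamma(A^*)$ for $X,Y\in\Gamma(A)$, then $\delta f(X)=\rho_J(X)f$, $\delta\alpha(X,Y)=\rho_J(X)\alpha(Y)-\rho_J(Y)\alpha(X)-\alpha([X,Y]')$ and $\varphi(X,Y,Z)=\langle\varphi'(X,Y),Z\rangle$. 2. Equivalently, $S_J$ is a Courant algebroid structure on $A\oplus A^*$ with its canonical pairing. No integrability of $J$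 (vanishing of its Nijenhuis torsion) is assumed. -/

import Mathlib

open scoped Manifold ContDiff

noncomputable section

/-! ## Smooth sections as a module over smooth functions -/

section SmoothSections

variable {E : Type*} [NormedAddCommGroup E] [NormedSpace ℝ E]
  {H : Type*} [TopologicalSpace H] {I : ModelWithCorners ℝ E H}
  {M : Type*} [TopologicalSpace M] [ChartedSpace H M]
  {F : Type*} [NormedAddCommGroup F] [NormedSpace ℝ F]
  {V : M → Type*} [TopologicalSpace (Bundle.TotalSpace F V)]
  [∀ x, AddCommGroup (V x)] [∀ x, Module ℝ (V x)] [∀ x, TopologicalSpace (V x)]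
  [FiberBundle F V] [VectorBundle ℝ F V]

/-- Pointwise multiplication of a smooth section by a smooth function. -/
instance smoothSectionSMul : SMul C^∞⟮I, M; ℝ⟯ Cₛ^∞⟮I; F, V⟯ where
  smul f s := ⟨fun x => f x • s x, f.contMDiff.smul_section s.contMDiff⟩

theorem smoothSection_smul_apply (f : C^∞⟮I, M; ℝ⟯) (s : Cₛ^∞⟮I; F, V⟯) (x : M) :
    (f • s) x = f x • s x := rfl

/-- `Γ(V)` is a module over `C^∞(M)`. -/
instance smoothSectionModule : Module C^∞⟮I, M; ℝ⟯ Cₛ^∞⟮I; F, V⟯ where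
  one_smul s := by
    ext x; exact one_smul ℝ (s x)
  mul_smul f g s := by
    ext x; exact mul_smul (f x) (g x) (s x)
  smul_zero f := by
    ext x; exact smul_zero (f x)
  smul_add f s t := by
    ext x; exact smul_add (f x) (s x) (t x)
  add_smul f g s := by
    ext x; exact add_smul (f x) (g x) (s x)
  zero_smul s := by
    ext x; exact zero_smul ℝ (s x)

end SmoothSections

/-! ## Tensors on a vector bundle

Throughout, `R` plays the role of `C^∞(M)`, `Derivation ℝ R R` that of the vector fields on `M`,
`L` that of the sections `Γ(A)`, `Module.Dual R L` that of `Γ(A*)`, `R`-linear endomorphisms of `L`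
that of `Γ(A ⊗ A*)`, and `R`-multilinear alternating maps `L [⋀^Fin p]→ₗ[R] R` that of
`Γ(⋀^p A*)`. -/

section Tensors

variable {R : Type*} [CommRing R] {L : Type*} [AddCommGroup L] [Module R L]

/-- A bivector `π ∈ Γ(⋀² A)`, given by the skew-symmetric map `π♯ : Γ(A*) → Γ(A)`,
`π♯ α = π(α, ·)`. -/
structure Bivector (R : Type*) [CommRing R]
    (L : Type*) [AddCommGroup L] [Module R L] where
  /-- the map `π♯` -/
  sharp : Module.Dual R L →ₗ[R] L
  alt : ∀ α : Module.Dual R L, α (sharp α) = 0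

/-- `π(α, β) = ⟨β, π♯ α⟩`. -/
def Bivector.eval (π : Bivector R L) (α β : Module.Dual R L) : R := β (π.sharp α)

/-- The `1`-form `H(X, Y, ·)` of a `3`-form `H`, as a bilinear map in `X` and `Y`. -/
def contract₂ (H : L [⋀^Fin 3]→ₗ[R] R) : L →ₗ[R] L →ₗ[R] Module.Dual R L :=
  LinearMap.mk₂ R
    (fun X Y =>
      { toFun := fun Z => H ![X, Y, Z]
        map_add' := fun Z Z' => by
          have e : ∀ W, ![X, Y, W] = Function.update ![X, Y, 0] 2 W := fun W => by
            ext i; fin_cases i <;> rfl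
          rw [e (Z + Z'), e Z, e Z']; exact H.map_update_add _ _ _ _
        map_smul' := fun f Z => by
          have e : ∀ W, ![X, Y, W] = Function.update ![X, Y, 0] 2 W := fun W => by
            ext i; fin_cases i <;> rfl
          rw [e (f • Z), e Z]; exact H.map_update_smul _ _ _ _ })
    (fun X X' Y => by
      ext Z
      have e : ∀ W, ![W, Y, Z] = Function.update ![0, Y, Z] 0 W := fun W => by
        ext i; fin_cases i <;> rfl
      change H _ = H _ + H _
      rw [e, e X, e X']; exact H.map_update_add _ _ _ _)
    (fun f X Y => by
      ext Z
      have e : ∀ W, ![W, Y, Z] = Function.update ![0, Y, Z] 0 W := fun W => by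
        ext i; fin_cases i <;> rfl
      change H _ = f • H _
      rw [e, e X]; exact H.map_update_smul _ _ _ _)
    (fun X Y Y' => by
      ext Z
      have e : ∀ W, ![X, W, Z] = Function.update ![X, 0, Z] 1 W := fun W => by
        ext i; fin_cases i <;> rfl
      change H _ = H _ + H _
      rw [e, e Y, e Y']; exact H.map_update_add _ _ _ _)
    (fun f X Y => by
      ext Z
      have e : ∀ W, ![X, W, Z] = Function.update ![X, 0, Z] 1 W := fun W => by
        ext i; fin_cases i <;> rfl
      change H _ = f • H _
      rw [e, e Y]; exact H.map_update_smul _ _ _ _)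

theorem contract₂_apply (H : L [⋀^Fin 3]→ₗ[R] R) (X Y Z : L) :
    contract₂ H X Y Z = H ![X, Y, Z] := rfl

/-- The map `σ♭ : Γ(A) → Γ(A*)`, `σ♭ X = σ(X, ·)`, of a `2`-form `σ`. -/
def flat (σ : L [⋀^Fin 2]→ₗ[R] R) : L →ₗ[R] Module.Dual R L :=
  have e₀ : ∀ Y W : L, ![W, Y] = Function.update ![0, Y] 0 W := fun Y W => by
    ext i; fin_cases i <;> rfl
  have e₁ : ∀ X W : L, ![X, W] = Function.update ![X, 0] 1 W := fun X W => by
    ext i; fin_cases i <;> rfl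
  LinearMap.mk₂ R (fun X Y => σ ![X, Y])
    (fun X X' Y => by rw [e₀, e₀ Y X, e₀ Y X']; exact σ.map_update_add _ _ _ _)
    (fun f X Y => by rw [e₀, e₀ Y X]; exact σ.map_update_smul _ _ _ _)
    (fun X Y Y' => by rw [e₁, e₁ X Y, e₁ X Y']; exact σ.map_update_add _ _ _ _)
    (fun f X Y => by rw [e₁, e₁ X Y]; exact σ.map_update_smul _ _ _ _)

theorem flat_apply (σ : L [⋀^Fin 2]→ₗ[R] R) (X Y : L) : flat σ X Y = σ ![X, Y] := rfl

/-- The `3`-form `𝓗(X, Y, Z) = H(NX, NY, Z) + H(NY, NZ, X) + H(NZ, NX, Y)`, as a function of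
three sections. -/
def calH (N : Module.End R L) (H : L [⋀^Fin 3]→ₗ[R] R) (v : Fin 3 → L) : R :=
  H ![N (v 0), N (v 1), v 2] + H ![N (v 1), N (v 2), v 0] + H ![N (v 2), N (v 0), v 1]

end Tensors

/-! ## Anchored brackets and Lie algebroids -/

section Algebra

variable {R : Type*} [CommRing R] [Algebra ℝ R]

/-- A biadditive bracket on an `R`-module `P` (the sections of a vector bundle) satisfying the
Leibniz rule with respect to an anchor. -/
@[ext]
structure AnchoredBracket (R : Type*) [CommRing R] [Algebra ℝ R]
    (P : Type*) [AddCommGroup P] [Module R P] where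
  /-- the anchor -/
  anchor : P →ₗ[R] Derivation ℝ R R
  /-- the bracket -/
  bracket : P →+ P →+ P
  leibniz : ∀ (x y : P) (f : R), bracket x (f • y) = f • bracket x y + anchor x f • y

namespace AnchoredBracket

variable {P : Type*} [AddCommGroup P] [Module R P]

/-- Sum of two anchored brackets. -/
instance : Add (AnchoredBracket R P) where
  add S T :=
    { anchor := S.anchor + T.anchor
      bracket := S.bracket + T.bracket
      leibniz := fun x y f => by
        simp only [AddMonoidHom.add_apply, LinearMap.add_apply, Derivation.add_apply, S.leibniz,
          T.leibniz, smul_add, add_smul]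
        abel }

/-- The bracket deformed by an endomorphism `J`:
`[x, y]_J = [J x, y] + [x, J y] - J [x, y]`, with anchor `ρ ∘ J`. -/
def deform (S : AnchoredBracket R P) (J : Module.End R P) : AnchoredBracket R P where
  anchor := S.anchor ∘ₗ J
  bracket := AddMonoidHom.mk' (fun x => AddMonoidHom.mk'
      (fun y => S.bracket (J x) y + S.bracket x (J y) - J (S.bracket x y))
      (fun y z => by simp only [map_add]; abel))
    (fun x y => by
      ext z
      simp only [map_add, AddMonoidHom.add_apply, AddMonoidHom.mk'_apply]
      abel)
  leibniz x y f := by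
    simp only [AddMonoidHom.mk'_apply, map_smul, S.leibniz, map_add, LinearMap.comp_apply,
      smul_add, smul_sub]
    abel

/-- The Nijenhuis torsion `T_N(X, Y) = [NX, NY] - N([NX, Y] + [X, NY] - N[X, Y])`. -/
def torsion (S : AnchoredBracket R P) (N : Module.End R P) (X Y : P) : P :=
  S.bracket (N X) (N Y) - N ((S.deform N).bracket X Y)

/-- The differential of a `p`-form, as a function of `p + 1` sections:
`dw(X₀, …, X_p) = ∑ i, (-1)^i (ρ(X_i) w(…, X̂_i, …) - ∑ j > i, w(…, X̂_i, …, [X_i, X_j], …))`,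
where `[X_i, X_j]` stands in the place of `X_j`. -/
def d (S : AnchoredBracket R P) {p : ℕ} (w : (Fin p → P) → R) (v : Fin (p + 1) → P) : R :=
  ∑ i : Fin (p + 1), (-1) ^ (i : ℕ) *
    (S.anchor (v i) (w fun k => v (i.succAbove k)) -
      ∑ j ∈ Finset.Ioi i,
        w fun k => Function.update v j (S.bracket (v i) (v j)) (i.succAbove k))

/-- The differential `df ∈ Γ(A*)` of a function, `⟨df, X⟩ = ρ(X) f`. -/
def dFun (S : AnchoredBracket R P) (f : R) : Module.Dual R P where
  toFun X := S.anchor X f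
  map_add' X Y := by simp
  map_smul' g X := by simp

/-- The Lie derivative of a `1`-form, `(L_X α)(Y) = ρ(X)(α(Y)) - α([X, Y])`. -/
def lieDer (S : AnchoredBracket R P) (X : P) (α : Module.Dual R P) : Module.Dual R P where
  toFun Y := S.anchor X (α Y) - α (S.bracket X Y)
  map_add' Y Z := by simp only [map_add]; abel
  map_smul' f Y := by
    simp only [map_smul, smul_eq_mul, Derivation.leibniz, S.leibniz, map_add, RingHom.id_apply]
    ring

end AnchoredBracket

/-- A Lie algebroid: a Lie bracket on the sections and an anchor with values in vector fields,
satisfying the Leibniz rule; the anchor is a morphism of Lie algebras. -/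
structure LieAlgebroid (R : Type*) [CommRing R] [Algebra ℝ R]
    (L : Type*) [AddCommGroup L] [Module R L] extends AnchoredBracket R L where
  bracket_self : ∀ X, bracket X X = 0
  jacobi : ∀ X Y Z, bracket X (bracket Y Z) = bracket (bracket X Y) Z + bracket Y (bracket X Z)
  anchor_bracket : ∀ X Y, anchor (bracket X Y) = ⁅anchor X, anchor Y⁆

variable {L : Type*} [AddCommGroup L] [Module R L]

/-! ## Poisson quasi-Nijenhuis structures with background -/

namespace AnchoredBracket

/-- The bracket `[α, β]_π = L_{π♯α} β - L_{π♯β} α - d(π(α, β))` on `Γ(A*)`. -/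
def koszul (S : AnchoredBracket R L) (π : Bivector R L) (α β : Module.Dual R L) :
    Module.Dual R L :=
  S.lieDer (π.sharp α) β - S.lieDer (π.sharp β) α - S.dFun (π.eval α β)

/-- The Schouten-Nijenhuis square `[π, π]_SN ∈ Γ(⋀³ A)` of a bivector, as a function of three
`1`-forms:
`½ [π, π](α, β, γ) = ∑_{cyclic} (⟨α, [π♯β, π♯γ]⟩ - ρ(π♯α)(π(β, γ)))`. -/
def schoutenSq (S : AnchoredBracket R L) (π : Bivector R L) (α β γ : Module.Dual R L) : R :=
  2 * ((α (S.bracket (π.sharp β) (π.sharp γ)) - S.anchor (π.sharp α) (π.eval β γ)) +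
    (β (S.bracket (π.sharp γ) (π.sharp α)) - S.anchor (π.sharp β) (π.eval γ α)) +
    (γ (S.bracket (π.sharp α) (π.sharp β)) - S.anchor (π.sharp γ) (π.eval α β)))

/-- The concomitant `C_{π,N} = ([·,·]_N)_π - ([·,·]_π)_{ᵗN}` on `Γ(A*)`. -/
def concomitant (S : AnchoredBracket R L) (π : Bivector R L) (N : Module.End R L)
    (α β : Module.Dual R L) : Module.Dual R L :=
  (S.deform N).koszul π α β -
    (S.koszul π (N.dualMap α) β + S.koszul π α (N.dualMap β) - N.dualMap (S.koszul π α β))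

end AnchoredBracket

/-- `(π, N, ψ, H)` is a Poisson quasi-Nijenhuis structure with background on the Lie
algebroid `A`. -/
structure IsPoissonQuasiNijenhuis (A : LieAlgebroid R L) (π : Bivector R L) (N : Module.End R L)
    (ψ H : L [⋀^Fin 3]→ₗ[R] R) : Prop where
  comm : N ∘ₗ π.sharp = π.sharp ∘ₗ N.dualMap
  closed_psi : ∀ v, A.d ψ v = 0
  closed_H : ∀ v, A.d H v = 0
  poisson : ∀ α β γ, A.schoutenSq π α β γ = 0
  concomitant : ∀ α β, A.concomitant π N α β = 2 • contract₂ H (π.sharp α) (π.sharp β)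
  torsion : ∀ X Y, A.torsion N X Y =
    -π.sharp (contract₂ H (N X) Y - contract₂ H (N Y) X + contract₂ ψ X Y)
  d_psi : ∀ v, (A.deform N).d ψ v = A.d (calH N H) v

/-! ## Hamiltonians on `A ⊕ A*` and Courant algebroids

A function `S` of total shifted degree `1` on `T*ΠA` is represented by its anchor
`ρ(x) f = {{x, S}, f}` and its derived (Dorfman) bracket `[x, y] = {{x, S}, y}` on
`Γ(A ⊕ A*) = Γ(A) × Γ(A*)`; a function of degree `0` which is constant along `M`, such as
`π + N + σ`, by the skew-symmetric endomorphism `J x = {x, J}`. In these terms the big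
bracket `{J, S}` is the deformed bracket `S.deform J`. -/

/-- The canonical pairing `⟨X + α, Y + β⟩ = β(X) + α(Y)`. -/
def pairing (x y : L × Module.Dual R L) : R := y.2 x.1 + x.2 y.1

/-- `S` is a Courant algebroid structure on `A ⊕ A*` with its canonical pairing. The axioms
`pairing_invariant` and `bracket_symm` say that `S` is a function of total shifted degree `1` on
`T*ΠA`, and `jacobi` that `{S, S} = 0`. -/
structure IsCourant (S : AnchoredBracket R (L × Module.Dual R L)) : Prop where
  pairing_invariant : ∀ x y z,
    S.anchor x (pairing y z) = pairing (S.bracket x y) z + pairing y (S.bracket x z)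
  bracket_symm : ∀ x y z,
    pairing (S.bracket x y + S.bracket y x) z = S.anchor z (pairing x y)
  jacobi : ∀ x y z,
    S.bracket x (S.bracket y z) = S.bracket (S.bracket x y) z + S.bracket y (S.bracket x z)
  anchor_bracket : ∀ x y, S.anchor (S.bracket x y) = ⁅S.anchor x, S.anchor y⁆

namespace LieAlgebroid

theorem bracket_swap (A : LieAlgebroid R L) (X Y : L) : A.bracket Y X = -A.bracket X Y := by
  have h := A.bracket_self (X + Y)
  simp only [map_add, AddMonoidHom.add_apply, A.bracket_self, zero_add, add_zero] at h
  exact eq_neg_of_add_eq_zero_left h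

theorem lieDer_smul_left (A : LieAlgebroid R L) (f : R) (X : L) (α : Module.Dual R L) :
    A.lieDer (f • X) α = f • A.lieDer X α + α X • A.dFun f := by
  ext Z
  have h : A.bracket (f • X) Z = f • A.bracket X Z - A.anchor Z f • X := by
    rw [A.bracket_swap Z, A.leibniz, A.bracket_swap X Z, smul_neg, neg_add, neg_neg, sub_eq_add_neg]
  simp only [AnchoredBracket.lieDer, AnchoredBracket.dFun, LinearMap.coe_mk, AddHom.coe_mk,
    LinearMap.add_apply, LinearMap.smul_apply, h, map_sub, map_smul, smul_eq_mul,
    Derivation.smul_apply]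
  ring

/-- The Hamiltonian `μ` of the Lie algebroid, i.e. the Dorfman bracket
`[X + α, Y + β] = [X, Y] + L_X β - L_Y α + d⟨α, Y⟩` on `A ⊕ A*`
(note `- L_Y α + d⟨α, Y⟩ = - i_Y dα`). -/
def hamiltonian (A : LieAlgebroid R L) : AnchoredBracket R (L × Module.Dual R L) where
  anchor := A.anchor ∘ₗ LinearMap.fst R L (Module.Dual R L)
  bracket := AddMonoidHom.mk' (fun x => AddMonoidHom.mk'
      (fun y => (A.bracket x.1 y.1,
        A.lieDer x.1 y.2 - A.lieDer y.1 x.2 + A.dFun (x.2 y.1)))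
      (fun y z => by
        ext Z
        · simp
        · simp [AnchoredBracket.lieDer, AnchoredBracket.dFun]
          abel))
    (fun x y => by
      ext z Z
      · simp
      · simp [AnchoredBracket.lieDer, AnchoredBracket.dFun]
        abel)
  leibniz x y f := by
    ext Z
    · simp [A.leibniz]
    · simp [lieDer_smul_left]
      simp [AnchoredBracket.lieDer, AnchoredBracket.dFun]
      ring

end LieAlgebroid

/-- The Hamiltonian of a `3`-form `H`: zero anchor and bracket
`{{X + α, H}, Y + β} = -H(X, Y, ·)`, where `{X, ·} = i_X` on forms. -/
def backgroundHamiltonian (H : L [⋀^Fin 3]→ₗ[R] R) :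
    AnchoredBracket R (L × Module.Dual R L) where
  anchor := 0
  bracket := AddMonoidHom.mk' (fun x => AddMonoidHom.mk' (fun y => (0, -contract₂ H x.1 y.1))
      (fun y z => by
        ext Z
        · simp
        · simp only [Prod.fst_add, map_add, Prod.snd_add, LinearMap.add_apply, LinearMap.neg_apply]
          ring))
    (fun x y => by
      ext z Z
      · simp
      · simp only [Prod.fst_add, map_add, Prod.snd_add, LinearMap.add_apply, LinearMap.neg_apply,
          AddMonoidHom.mk'_apply, AddMonoidHom.add_apply]
        ring)
  leibniz x y f := by
    ext Z <;> simp

/-- The endomorphism `π : X + α ↦ π♯ α` of `A ⊕ A*`. -/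
def Bivector.toEnd (π : Bivector R L) : Module.End R (L × Module.Dual R L) :=
  (π.sharp ∘ₗ LinearMap.snd R L (Module.Dual R L)).prod 0

/-- The endomorphism `N : X + α ↦ N X - ᵗN α` of `A ⊕ A*`. -/
def tensorToEnd (N : Module.End R L) : Module.End R (L × Module.Dual R L) :=
  (N ∘ₗ LinearMap.fst R L (Module.Dual R L)).prod
    (-(N.dualMap ∘ₗ LinearMap.snd R L (Module.Dual R L)))

/-- The endomorphism `σ : X + α ↦ σ♭ X` of `A ⊕ A*`. -/
def twoFormToEnd (σ : L [⋀^Fin 2]→ₗ[R] R) : Module.End R (L × Module.Dual R L) :=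
  LinearMap.prod 0 (flat σ ∘ₗ LinearMap.fst R L (Module.Dual R L))

/-- The Hamiltonian `{J, S}`. -/
def bigBracket (J : Module.End R (L × Module.Dual R L))
    (S : AnchoredBracket R (L × Module.Dual R L)) : AnchoredBracket R (L × Module.Dual R L) :=
  S.deform J

/-! ## Lie quasi-bialgebroids on `(A*, A)` -/

/-- The graded module `Γ(⋀^• A*)`. -/
abbrev Forms (R : Type*) [CommRing R] (L : Type*) [AddCommGroup L] [Module R L] : Type _ :=
  DirectSum ℕ fun p => L [⋀^Fin p]→ₗ[R] R

namespace Forms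

/-- A `p`-form as an element of `Γ(⋀^• A*)`. -/
abbrev of {p : ℕ} (P : L [⋀^Fin p]→ₗ[R] R) : Forms R L :=
  DirectSum.of (fun p => L [⋀^Fin p]→ₗ[R] R) p P

/-- A function as a `0`-form. -/
abbrev zeroForm (f : R) : L [⋀^Fin 0]→ₗ[R] R := AlternatingMap.constOfIsEmpty R L (Fin 0) f

/-- A section of `A*` as a `1`-form. -/
abbrev oneForm (α : Module.Dual R L) : L [⋀^Fin 1]→ₗ[R] R :=
  AlternatingMap.ofSubsingleton R L R (0 : Fin 1) α

/-- The wedge product of a `p`-form and a `q`-form (sum over shuffles, so that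
`(α ∧ β)(X, Y) = α(X) β(Y) - α(Y) β(X)` for `1`-forms), as a bilinear map. -/
def wedgeHom (p q : ℕ) :
    (L [⋀^Fin p]→ₗ[R] R) →ₗ[R] (L [⋀^Fin q]→ₗ[R] R) →ₗ[R] (L [⋀^Fin (p + q)]→ₗ[R] R) :=
  TensorProduct.curry
    ((AlternatingMap.domDomCongrₗ R finSumFinEquiv).toLinearMap ∘ₗ
      LinearMap.compAlternatingMapₗ R (LinearMap.mul' R R) ∘ₗ
        AlternatingMap.domCoprod')

/-- The wedge product on `Γ(⋀^• A*)`. -/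
def wedge : Forms R L →ₗ[R] Forms R L →ₗ[R] Forms R L :=
  DirectSum.toModule R ℕ _ fun p =>
    LinearMap.flip <| DirectSum.toModule R ℕ _ fun q => LinearMap.flip <|
      (wedgeHom p q).compr₂ (DirectSum.lof R ℕ (fun p => L [⋀^Fin p]→ₗ[R] R) (p + q))

end Forms

open Forms in
/-- A Gerstenhaber bracket on `(Γ(⋀^• A*), ∧)`. -/
structure IsGerstenhaber (B : Forms R L →ₗ[ℝ] Forms R L →ₗ[ℝ] Forms R L) : Prop where
  degree_zero : ∀ P Q : L [⋀^Fin 0]→ₗ[R] R, B (of P) (of Q) = 0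
  degree : ∀ (p q n : ℕ) (P : L [⋀^Fin p]→ₗ[R] R) (Q : L [⋀^Fin q]→ₗ[R] R), p + q = n + 1 →
    ∃ T : L [⋀^Fin n]→ₗ[R] R, B (of P) (of Q) = of T
  skew : ∀ (p q : ℕ) (P : L [⋀^Fin p]→ₗ[R] R) (Q : L [⋀^Fin q]→ₗ[R] R),
    B (of P) (of Q) = -((-1 : ℝ) ^ ((p + 1) * (q + 1)) • B (of Q) (of P))
  leibniz : ∀ (p q : ℕ) (P : L [⋀^Fin p]→ₗ[R] R) (Q : L [⋀^Fin q]→ₗ[R] R) (T : Forms R L),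
    B (of P) (wedge (of Q) T) =
      wedge (B (of P) (of Q)) T + (-1 : ℝ) ^ ((p + 1) * q) • wedge (of Q) (B (of P) T)
  jacobi : ∀ (p q : ℕ) (P : L [⋀^Fin p]→ₗ[R] R) (Q : L [⋀^Fin q]→ₗ[R] R) (T : Forms R L),
    B (of P) (B (of Q) T) =
      B (B (of P) (of Q)) T + (-1 : ℝ) ^ ((p + 1) * (q + 1)) • B (of Q) (B (of P) T)

open Forms in
/-- A Lie quasi-bialgebroid structure on `(A*, A)`: a Lie algebroid structure on `A*`, a degree one
derivation `δ` of the Gerstenhaber algebra `(Γ(⋀^• A*), ∧, [·,·])` whose bracket extends the Lie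
algebroid bracket and anchor, and `φ ∈ Γ(⋀³ A*)` with `δ² = [φ, ·]` and `δ φ = 0`. -/
structure LieQuasiBialgebroid (R : Type*) [CommRing R] [Algebra ℝ R]
    (L : Type*) [AddCommGroup L] [Module R L] where
  /-- the Lie algebroid structure on `A*` -/
  lie : LieAlgebroid R (Module.Dual R L)
  /-- the Gerstenhaber bracket -/
  gerst : Forms R L →ₗ[ℝ] Forms R L →ₗ[ℝ] Forms R L
  /-- the derivation -/
  δ : Forms R L →ₗ[ℝ] Forms R L
  /-- the `3`-form -/
  φ : L [⋀^Fin 3]→ₗ[R] R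
  isGerstenhaber : IsGerstenhaber gerst
  gerst_fun : ∀ (α : Module.Dual R L) (f : R),
    gerst (of (oneForm α)) (of (zeroForm f)) = of (zeroForm (lie.anchor α f))
  gerst_one : ∀ α β : Module.Dual R L,
    gerst (of (oneForm α)) (of (oneForm β)) = of (oneForm (lie.bracket α β))
  δ_degree : ∀ (p : ℕ) (P : L [⋀^Fin p]→ₗ[R] R), ∃ T : L [⋀^Fin (p + 1)]→ₗ[R] R, δ (of P) = of T
  δ_wedge : ∀ (p : ℕ) (P : L [⋀^Fin p]→ₗ[R] R) (T : Forms R L),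
    δ (wedge (of P) T) = wedge (δ (of P)) T + (-1 : ℝ) ^ p • wedge (of P) (δ T)
  δ_gerst : ∀ (p : ℕ) (P : L [⋀^Fin p]→ₗ[R] R) (T : Forms R L),
    δ (gerst (of P) T) = gerst (δ (of P)) T + (-1 : ℝ) ^ (p + 1) • gerst (of P) (δ T)
  δ_sq : ∀ T : Forms R L, δ (δ T) = gerst (of φ) T
  δ_φ : δ (of φ) = 0

open Forms in
/-- The Hamiltonian `S` defines a Lie quasi-bialgebroid structure on `(A*, A)`: there is such a
structure of which `S` encodes the bracket and the anchor on `A*`, the derivation `δ` (on functions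
and `1`-forms, by the Cartan formulas for the anchor and the `A`-component of the bracket on `A`),
and the `3`-form `φ` (the `A*`-component of the bracket on `A`). -/
def DefinesLieQuasiBialgebroid (S : AnchoredBracket R (L × Module.Dual R L)) : Prop :=
  ∃ Q : LieQuasiBialgebroid R L,
    (∀ α, Q.lie.anchor α = S.anchor (0, α)) ∧
    (∀ α β, S.bracket (0, α) (0, β) = (0, Q.lie.bracket α β)) ∧
    (∀ f, ∃ w : L [⋀^Fin 1]→ₗ[R] R, Q.δ (of (zeroForm f)) = of w ∧
      ∀ X, w ![X] = S.anchor (X, 0) f) ∧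
    (∀ α : Module.Dual R L, ∃ w : L [⋀^Fin 2]→ₗ[R] R, Q.δ (of (oneForm α)) = of w ∧
      ∀ X Y, w ![X, Y] = S.anchor (X, 0) (α Y) - S.anchor (Y, 0) (α X) -
        α (S.bracket (X, 0) (Y, 0)).1) ∧
    (∀ X Y Z, Q.φ ![X, Y, Z] = (S.bracket (X, 0) (Y, 0)).2 Z)

end Algebra

end

/-! Write S = μ + H and S_J = {J, S}. Since {S, S} = 0, the Jacobi identity of the big bracket gives
{S_J, S} = 0, and bracketing this once more with J gives {S_J, S_J} = -{S_JJ, S} with S_JJ = {J,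
S_J}. Hence S_J is a Courant structure as soon as S_JJ commutes with S (`Commutes.deform_deform`).

The hypotheses enter through the identity S_JJ = {K, S} + T (`deform_deformedTwisted`). Here K is
the skew endomorphism with block N² + π♯σ♭ on A and 2-form part -(σ(NX, Y) + σ(X, NY)), and T is the
3-form 2(𝓗 + i_N ψ). The first term commutes with S for the same reason as S_J does; the second does
because dT = 2(d𝓗 - d_N ψ) = 0. Both sides are compatible with the pairing, so it is enough to
compare anchors and the brackets on A and on A*. The anchors agree by Nπ♯ = π♯ ᵗN. The A-component
on A is the torsion condition, the two components on A* are [π, π] = 0 and the concomitant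
condition, and the A*-component on A only uses ψ = -dσ.

The Lie quasi-bialgebroid is read off from the blocks of S_J: the Koszul bracket of π on A*, the
skew bracket [X, Y]_N + π♯H(X, Y, ·) on A, whose differential is δ, and φ = dσ - i_N H. To extend
this to all forms, the Gerstenhaber bracket is given in closed form, [P, Q] = d⟨P, Q⟩ + ⟨dP, Q⟩ -
(-1)^p ⟨P, dQ⟩ with ⟨·, ·⟩ the contraction by π; it is a derivation in Q by construction. The
defects of the Jacobi identity, of the compatibility of δ with the bracket and of δ² = [φ, ·] are
then derivations, so they vanish once they vanish on functions and 1-forms (`IsDer.eq_zero`). There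
they are components of the Courant axioms of S_J. The reduction to generators relies on local frames
multiplied by cutoff functions (`locallyFramed_smoothSection`).

The exterior calculus itself rests on one principle: a form of positive degree is determined by its
contractions, so identities are proved by induction on the degree. -/

set_option linter.unusedSectionVars false

open scoped Manifold ContDiff

noncomputable section

/-! ### Sums over permutations and their expansion along one argument. -/

section AlternatingSums

variable {L : Type*}
  {N : Type*} [AddCommGroup N]

/-- The signed sum of `F (v ∘ σ)` over all permutations `σ`. -/
def permSum {n : ℕ} (F : (Fin n → L) → N) (v : Fin n → L) : N :=
  ∑ σ : Equiv.Perm (Fin n), Equiv.Perm.sign σ • F fun i => v (σ i)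

theorem permSum_smul {n : ℕ} (c : ℤ) (F : (Fin n → L) → N) (v : Fin n → L) :
    permSum (fun u => c • F u) v = c • permSum F v := by
  simp only [permSum, Finset.smul_sum, Units.smul_def, smul_comm c]

/-- Permutations of `n + 1` elements, by the preimage of `0`. -/
theorem bijective_decomposeFin_cycleRange (n : ℕ) : Function.Bijective
    (fun x : Fin (n + 1) × Equiv.Perm (Fin n) =>
      Equiv.Perm.decomposeFin.symm (0, x.2) * x.1.cycleRange) := by
  rw [Fintype.bijective_iff_injective_and_card]
  constructor
  · rintro ⟨k, τ⟩ ⟨k', τ'⟩ h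
    -- The product sends `k` to `0`, so `k` is recovered as the preimage of `0`.
    have hk : k = k' := by
      have h0 := congrArg (fun σ : Equiv.Perm (Fin (n + 1)) => σ k) h
      simp only [Equiv.Perm.mul_apply, Fin.cycleRange_self,
        Equiv.Perm.decomposeFin_symm_apply_zero] at h0
      rcases Fin.eq_zero_or_eq_succ (k'.cycleRange k) with h1 | ⟨j, h1⟩
      · rw [← Fin.cycleRange_self k'] at h1
        exact k'.cycleRange.injective h1
      · rw [h1, Equiv.Perm.decomposeFin_symm_apply_succ] at h0
        simp at h0
        exact absurd h0 (Fin.succ_ne_zero _).symm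
    subst hk
    have := mul_right_cancel h
    simpa using this
  · simp only [Fintype.card_prod, Fintype.card_fin, Fintype.card_perm, Nat.factorial_succ]

/-- Laplace expansion: permutations are grouped by the slot `k` that receives `X`, and moving the
front argument to slot `k` is a cycle of sign `(-1)^k`. -/
theorem permSum_cons {n : ℕ} (F : (Fin (n + 1) → L) → N) (X : L) (w : Fin n → L) :
    permSum F (Fin.cons X w : Fin (n + 1) → L) =
      ∑ k : Fin (n + 1), (-1 : ℤ) ^ (k : ℕ) •
        permSum (fun u => F (k.insertNth (α := fun _ => L) X u)) w := by
  rw [permSum, ← (bijective_decomposeFin_cycleRange n).sum_comp, Fintype.sum_prod_type]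
  refine Finset.sum_congr rfl fun k _ => ?_
  rw [permSum, Finset.smul_sum]
  refine Finset.sum_congr rfl fun τ _ => ?_
  have h1 : (fun i => (Fin.cons X w : Fin (n + 1) → L)
      ((Equiv.Perm.decomposeFin.symm (0, τ) * k.cycleRange) i)) =
      k.insertNth (α := fun _ => L) X fun i => w (τ i) := by
    rw [← Fin.cons_comp_cycleRange]
    funext i
    simp only [Equiv.Perm.mul_apply, Function.comp]
    generalize k.cycleRange i = j
    refine Fin.cases ?_ (fun j => ?_) j
    · simp
    · simp [Equiv.Perm.decomposeFin_symm_apply_succ]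
  rw [h1, map_mul, Equiv.Perm.decomposeFin.symm_sign, Fin.sign_cycleRange]
  rcases Nat.even_or_odd (k : ℕ) with hk | hk <;> simp [Units.smul_def, hk.neg_one_pow]

end AlternatingSums

/-! ### Wedge products of vector-valued forms as sums over permutations. -/

section Wedge

variable {R : Type*} [CommRing R] {L : Type*} [AddCommGroup L] [Module R L]
  {N₁ N₂ N₃ : Type*} [AddCommGroup N₁] [AddCommGroup N₂] [AddCommGroup N₃]
  [Module R N₁] [Module R N₂] [Module R N₃]

/-- The product of the values of two forms on consecutive blocks of arguments. -/
def blockProd (Φ : N₁ →ₗ[R] N₂ →ₗ[R] N₃) {p q n : ℕ} (h : p + q = n)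
    (a : L [⋀^Fin p]→ₗ[R] N₁) (b : L [⋀^Fin q]→ₗ[R] N₂) (v : Fin n → L) : N₃ :=
  Φ (a fun i => v (Fin.cast h (Fin.castAdd q i))) (b fun j => v (Fin.cast h (Fin.natAdd p j)))

/-- An argument inserted in the first block has only to be moved to the front of that block; the
second block is merely relabelled. -/
theorem blockProd_insertNth_left (Φ : N₁ →ₗ[R] N₂ →ₗ[R] N₃) {p q n : ℕ} (h : p + 1 + q = n + 1)
    (h' : p + q = n) (a : L [⋀^Fin (p + 1)]→ₗ[R] N₁) (b : L [⋀^Fin q]→ₗ[R] N₂) (X : L)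
    (i : Fin (p + 1)) (u : Fin n → L) :
    blockProd Φ h a b ((Fin.cast h (Fin.castAdd q i)).insertNth (α := fun _ => L) X u) =
      (-1 : ℤ) ^ (i : ℕ) • blockProd Φ h' (a.curryLeft X) b u := by
  have ha : (fun i' => (Fin.cast h (Fin.castAdd q i)).insertNth (α := fun _ => L) X u
      (Fin.cast h (Fin.castAdd q i'))) =
      i.insertNth (α := fun _ => L) X fun i' => u (Fin.cast h' (Fin.castAdd q i')) := by
    funext i'
    rcases eq_or_ne i' i with rfl | hi
    · simp
    · obtain ⟨j, rfl⟩ := Fin.exists_succAbove_eq hi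
      have : Fin.cast h (Fin.castAdd q (i.succAbove j)) =
          (Fin.cast h (Fin.castAdd q i)).succAbove (Fin.cast h' (Fin.castAdd q j)) := by
        ext
        simp only [Fin.succAbove, Fin.lt_def, Fin.val_cast, Fin.val_castAdd, Fin.val_castSucc]
        split_ifs <;> simp
      rw [this, Fin.insertNth_apply_succAbove, Fin.insertNth_apply_succAbove]
  have hb : (fun j => (Fin.cast h (Fin.castAdd q i)).insertNth (α := fun _ => L) X u
      (Fin.cast h (Fin.natAdd (p + 1) j))) = fun j => u (Fin.cast h' (Fin.natAdd p j)) := by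
    funext j
    have : Fin.cast h (Fin.natAdd (p + 1) j) =
        (Fin.cast h (Fin.castAdd q i)).succAbove (Fin.cast h' (Fin.natAdd p j)) := by
      ext
      simp only [Fin.succAbove, Fin.lt_def, Fin.val_cast, Fin.val_castAdd, Fin.val_castSucc,
        Fin.val_natAdd]
      have := i.2
      rw [if_neg (by omega)]
      simp
      omega
    rw [this, Fin.insertNth_apply_succAbove]
  rw [blockProd, ha, hb, AlternatingMap.map_insertNth]
  simp only [map_zsmul, LinearMap.smul_apply]
  rfl

theorem blockProd_insertNth_right (Φ : N₁ →ₗ[R] N₂ →ₗ[R] N₃) {p q n : ℕ}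
    (h : p + (q + 1) = n + 1) (h' : p + q = n) (a : L [⋀^Fin p]→ₗ[R] N₁)
    (b : L [⋀^Fin (q + 1)]→ₗ[R] N₂) (X : L) (j : Fin (q + 1)) (u : Fin n → L) :
    blockProd Φ h a b ((Fin.cast h (Fin.natAdd p j)).insertNth (α := fun _ => L) X u) =
      (-1 : ℤ) ^ (j : ℕ) • blockProd Φ h' a (b.curryLeft X) u := by
  have ha : (fun i => (Fin.cast h (Fin.natAdd p j)).insertNth (α := fun _ => L) X u
      (Fin.cast h (Fin.castAdd (q + 1) i))) = fun i => u (Fin.cast h' (Fin.castAdd q i)) := by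
    funext i
    have : Fin.cast h (Fin.castAdd (q + 1) i) =
        (Fin.cast h (Fin.natAdd p j)).succAbove (Fin.cast h' (Fin.castAdd q i)) := by
      ext
      simp only [Fin.succAbove, Fin.lt_def, Fin.val_cast, Fin.val_castAdd, Fin.val_castSucc,
        Fin.val_natAdd]
      have := i.2
      rw [if_pos (by omega)]
      simp
    rw [this, Fin.insertNth_apply_succAbove]
  have hb : (fun j' => (Fin.cast h (Fin.natAdd p j)).insertNth (α := fun _ => L) X u
      (Fin.cast h (Fin.natAdd p j'))) =
      j.insertNth (α := fun _ => L) X fun j' => u (Fin.cast h' (Fin.natAdd p j')) := by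
    funext j'
    rcases eq_or_ne j' j with rfl | hj
    · simp
    · obtain ⟨i, rfl⟩ := Fin.exists_succAbove_eq hj
      have : Fin.cast h (Fin.natAdd p (j.succAbove i)) =
          (Fin.cast h (Fin.natAdd p j)).succAbove (Fin.cast h' (Fin.natAdd p i)) := by
        ext
        simp only [Fin.succAbove, Fin.lt_def, Fin.val_cast, Fin.val_natAdd, Fin.val_castSucc]
        split_ifs <;> simp <;> omega
      rw [this, Fin.insertNth_apply_succAbove, Fin.insertNth_apply_succAbove]
  rw [blockProd, ha, hb, AlternatingMap.map_insertNth]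
  simp only [map_zsmul]
  rfl

theorem sum_fin_add {N : Type*} [AddCommMonoid N] {p q n : ℕ} (h : p + q = n) (g : Fin n → N) :
    ∑ k, g k = ∑ i, g (Fin.cast h (Fin.castAdd q i)) + ∑ j, g (Fin.cast h (Fin.natAdd p j)) := by
  subst h
  exact Fin.sum_univ_add g

/-- The sign of the Laplace expansion cancels the sign of moving `X` within its block, so all `p +
1` positions contribute equally. -/
theorem sum_permSum_left (Φ : N₁ →ₗ[R] N₂ →ₗ[R] N₃) {p q n : ℕ} (h : p + 1 + q = n + 1)
    (h' : p + q = n) (a : L [⋀^Fin (p + 1)]→ₗ[R] N₁) (b : L [⋀^Fin q]→ₗ[R] N₂) (X : L)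
    (w : Fin n → L) :
    ∑ i : Fin (p + 1), (-1 : ℤ) ^ ((Fin.cast h (Fin.castAdd q i) : Fin (n + 1)) : ℕ) •
      permSum (fun u => blockProd Φ h a b
        ((Fin.cast h (Fin.castAdd q i)).insertNth (α := fun _ => L) X u)) w =
      (p + 1) • permSum (blockProd Φ h' (a.curryLeft X) b) w := by
  simp_rw [blockProd_insertNth_left Φ h h', permSum_smul, smul_smul]
  simp [← pow_add, ← two_mul, add_smul]

/-- Here the two signs differ by `(-1)^p`, because the first block is crossed; this is the sign in
the Leibniz rule for contractions. -/
theorem sum_permSum_right (Φ : N₁ →ₗ[R] N₂ →ₗ[R] N₃) {p q n : ℕ} (h : p + (q + 1) = n + 1)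
    (h' : p + q = n) (a : L [⋀^Fin p]→ₗ[R] N₁) (b : L [⋀^Fin (q + 1)]→ₗ[R] N₂) (X : L)
    (w : Fin n → L) :
    ∑ j : Fin (q + 1), (-1 : ℤ) ^ ((Fin.cast h (Fin.natAdd p j) : Fin (n + 1)) : ℕ) •
      permSum (fun u => blockProd Φ h a b
        ((Fin.cast h (Fin.natAdd p j)).insertNth (α := fun _ => L) X u)) w =
      (-1 : ℤ) ^ p • (q + 1) • permSum (blockProd Φ h' a (b.curryLeft X)) w := by
  simp_rw [blockProd_insertNth_right Φ h h', permSum_smul, smul_smul]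
  rcases Nat.even_or_odd p with hp | hp <;>
    simp [pow_add, ← mul_pow, hp.neg_one_pow, ← Nat.cast_smul_eq_nsmul ℤ]

/-- The wedge product of vector valued forms along a bilinear map of the values. -/
def wedgeAlong (Φ : N₁ →ₗ[R] N₂ →ₗ[R] N₃) (p q : ℕ) :
    (L [⋀^Fin p]→ₗ[R] N₁) →ₗ[R] (L [⋀^Fin q]→ₗ[R] N₂) →ₗ[R] (L [⋀^Fin (p + q)]→ₗ[R] N₃) :=
  TensorProduct.curry
    ((AlternatingMap.domDomCongrₗ R finSumFinEquiv).toLinearMap ∘ₗ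
      LinearMap.compAlternatingMapₗ R (TensorProduct.lift Φ) ∘ₗ
        AlternatingMap.domCoprod')

/-- The product is a sum over shuffles, that is, over cosets of `S_p × S_q`; multiplying by the
order of this subgroup gives the sum over all permutations, which is easier to expand. -/
theorem factorial_smul_wedgeAlong (Φ : N₁ →ₗ[R] N₂ →ₗ[R] N₃) {p q n : ℕ} (h : p + q = n)
    (a : L [⋀^Fin p]→ₗ[R] N₁) (b : L [⋀^Fin q]→ₗ[R] N₂) (v : Fin n → L) :
    (p.factorial * q.factorial) • wedgeAlong Φ p q a b (fun i => v (Fin.cast h i)) =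
      permSum (blockProd Φ h a b) v := by
  subst h
  have h1 := congrArg (fun m => (TensorProduct.lift Φ) (m fun i => v (finSumFinEquiv i)))
    (MultilinearMap.domCoprod_alternization_eq a b)
  simp only [Fintype.card_fin, AlternatingMap.smul_apply, map_nsmul] at h1
  refine Eq.trans ?_ (h1.symm.trans ?_)
  · rfl
  · rw [MultilinearMap.alternatization_apply, map_sum, permSum,
      ← Equiv.sum_comp (finSumFinEquiv.permCongr)]
    refine Finset.sum_congr rfl fun σ _ => ?_
    simp only [MultilinearMap.domDomCongr_apply, MultilinearMap.domCoprod_apply,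
      Equiv.Perm.sign_permCongr, Units.smul_def, map_zsmul, TensorProduct.lift.tmul, blockProd,
      AlternatingMap.coe_multilinearMap]
    simp [Equiv.permCongr_apply]
end Wedge

/-! ### The graded module of forms, contractions, and induction on degree. -/

/-- The graded module of forms with values in a module. -/
abbrev VForms (R : Type*) [CommRing R] (L : Type*) [AddCommGroup L] [Module R L]
    (N : Type*) [AddCommGroup N] [Module R N] : Type _ :=
  DirectSum ℕ fun p => L [⋀^Fin p]→ₗ[R] N

namespace VForms

section Basic

variable {R : Type*} [CommRing R] {L : Type*} [AddCommGroup L] [Module R L]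
  {N N₁ N₂ N₃ : Type*} [AddCommGroup N] [AddCommGroup N₁] [AddCommGroup N₂] [AddCommGroup N₃]
  [Module R N] [Module R N₁] [Module R N₂] [Module R N₃]

/-- A `p`-form as an element of the graded module. -/
abbrev of {p : ℕ} (P : L [⋀^Fin p]→ₗ[R] N) : VForms R L N :=
  DirectSum.of (fun p => L [⋀^Fin p]→ₗ[R] N) p P

theorem of_eq_lof {p : ℕ} (P : L [⋀^Fin p]→ₗ[R] N) :
    of P = DirectSum.lof R ℕ (fun p => L [⋀^Fin p]→ₗ[R] N) p P := rfl

@[simp]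
theorem of_add {p : ℕ} (P Q : L [⋀^Fin p]→ₗ[R] N) : of (P + Q) = of P + of Q := map_add _ P Q

@[simp]
theorem of_neg {p : ℕ} (P : L [⋀^Fin p]→ₗ[R] N) : of (-P) = -of P := map_neg _ P

@[simp]
theorem of_zero {p : ℕ} : of (0 : L [⋀^Fin p]→ₗ[R] N) = 0 := map_zero _

@[simp]
theorem of_smul {p : ℕ} (f : R) (P : L [⋀^Fin p]→ₗ[R] N) : of (f • P) = f • of P :=
  map_smul (DirectSum.lof R ℕ (fun p => L [⋀^Fin p]→ₗ[R] N) p) f P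

@[simp]
theorem neg_smul_form (f : R) (ξ : VForms R L N) : (-f) • ξ = -(f • ξ) := neg_smul f ξ

@[elab_as_elim]
theorem induction {motive : VForms R L N → Prop} (ξ : VForms R L N) (zero : motive 0)
    (of : ∀ (p : ℕ) (P : L [⋀^Fin p]→ₗ[R] N), motive (of P))
    (add : ∀ a b, motive a → motive b → motive (a + b)) : motive ξ :=
  DirectSum.induction_on ξ zero of add

@[simp]
theorem of_apply_same {p : ℕ} (P : L [⋀^Fin p]→ₗ[R] N) : of P p = P :=
  DirectSum.of_eq_same (β := fun p => L [⋀^Fin p]→ₗ[R] N) p P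

theorem of_apply_ne {p q : ℕ} (h : q ≠ p) (P : L [⋀^Fin p]→ₗ[R] N) : of P q = 0 :=
  DirectSum.of_eq_of_ne (β := fun p => L [⋀^Fin p]→ₗ[R] N) p q P h

/-- Degrees such as `p + 1 + q` and `p + q + 1` are only propositionally equal; in the direct sum
the cast between them disappears. -/
theorem of_congr {p q : ℕ} (h : p = q) (P : L [⋀^Fin p]→ₗ[R] N) (Q : L [⋀^Fin q]→ₗ[R] N)
    (hPQ : ∀ v : Fin q → L, P (fun i => v (Fin.cast h i)) = Q v) : of P = of Q := by
  subst h
  exact congrArg of (AlternatingMap.ext hPQ)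

theorem of_injective {p : ℕ} {P Q : L [⋀^Fin p]→ₗ[R] N} (h : of P = of Q) : P = Q :=
  DirectSum.of_injective p h

/-- The interior product of a homogeneous form. -/
def interiorHom (X : L) : ∀ p : ℕ, (L [⋀^Fin p]→ₗ[R] N) →ₗ[R] VForms R L N
  | 0 => 0
  | p + 1 => DirectSum.lof R ℕ (fun p => L [⋀^Fin p]→ₗ[R] N) p ∘ₗ
      AlternatingMap.curryLeftLinearMap.flip X

/-- The interior product. -/
def interior (X : L) : VForms R L N →ₗ[R] VForms R L N :=
  DirectSum.toModule R ℕ _ (interiorHom X)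

@[simp]
theorem interior_of_zero (X : L) (P : L [⋀^Fin 0]→ₗ[R] N) : interior X (of P) = 0 := by
  rw [interior, of_eq_lof, DirectSum.toModule_lof]
  rfl

@[simp]
theorem interior_of_succ (X : L) {p : ℕ} (P : L [⋀^Fin (p + 1)]→ₗ[R] N) :
    interior X (of P) = of (P.curryLeft X) := by
  rw [interior, of_eq_lof, DirectSum.toModule_lof]
  rfl

theorem interior_add_left (X Y : L) (ξ : VForms R L N) :
    interior (X + Y) ξ = interior X ξ + interior Y ξ := by
  induction ξ using VForms.induction with
  | zero => simp
  | of p P => cases p <;> simp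
  | add a b ha hb => simp only [map_add, ha, hb]; abel

theorem interior_smul_left (f : R) (X : L) (ξ : VForms R L N) :
    interior (f • X) ξ = f • interior X ξ := by
  induction ξ using VForms.induction with
  | zero => simp
  | of p P =>
    cases p
    · simp
    · simp only [interior_of_succ, map_smul, of_smul]
  | add a b ha hb => simp only [map_add, ha, hb, smul_add]

theorem interior_apply (X : L) (ξ : VForms R L N) (p : ℕ) :
    interior X ξ p = (ξ (p + 1)).curryLeft X := by
  induction ξ using VForms.induction with
  | zero => simp
  | of q P =>
    cases q with
    | zero => rw [interior_of_zero, of_apply_ne (by omega)]; simp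
    | succ q =>
      rw [interior_of_succ]
      rcases eq_or_ne p q with rfl | h
      · rw [of_apply_same, of_apply_same]
      · rw [of_apply_ne h, of_apply_ne (by omega)]; simp
  | add a b ha hb =>
    rw [map_add, DirectSum.add_apply, DirectSum.add_apply, ha, hb]; rfl

/-- The first argument of a form of positive degree can be peeled off by a contraction, so only
degree zero needs a separate check. The inductions on degree below all rest on this. -/
theorem ext_interior {ξ η : VForms R L N} (h0 : ξ 0 = η 0)
    (h : ∀ X, interior X ξ = interior X η) : ξ = η := by
  refine DFinsupp.ext fun p => ?_
  cases p with
  | zero => exact h0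
  | succ p =>
    ext v
    have := congrArg (fun ζ : VForms R L N => ζ p (Fin.tail v)) (h (v 0))
    simp only [interior_apply, AlternatingMap.curryLeft_apply_apply] at this
    rw [← Fin.cons_self_tail v]
    exact this

theorem interior_interior_self (X : L) (ξ : VForms R L N) : interior X (interior X ξ) = 0 := by
  refine DFinsupp.ext fun p => ?_
  rw [interior_apply, interior_apply, AlternatingMap.curryLeft_same]
  rfl

theorem interior_interior (X Y : L) (ξ : VForms R L N) :
    interior X (interior Y ξ) = -interior Y (interior X ξ) := by
  have h := interior_interior_self (X + Y) ξ
  simp only [interior_add_left, map_add, interior_interior_self, zero_add, add_zero] at h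
  rw [eq_neg_iff_add_eq_zero, ← h, add_comm]

/-- The grading involution, multiplication by `(-1)^p` on `p`-forms. -/
def invol : VForms R L N →ₗ[R] VForms R L N :=
  DirectSum.toModule R ℕ _ fun p => (-1 : R) ^ p • DirectSum.lof R ℕ (fun p => L [⋀^Fin p]→ₗ[R] N) p

theorem invol_of {p : ℕ} (P : L [⋀^Fin p]→ₗ[R] N) : invol (of P) = (-1 : R) ^ p • of P := by
  rw [invol, of_eq_lof, DirectSum.toModule_lof]
  rfl

@[simp]
theorem invol_invol (ξ : VForms R L N) : invol (invol ξ) = ξ := by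
  induction ξ using VForms.induction with
  | zero => simp
  | of p P => rw [invol_of, map_smul, invol_of, smul_smul, ← mul_pow]; simp
  | add a b ha hb => simp only [map_add, ha, hb]

theorem interior_invol (X : L) (ξ : VForms R L N) :
    interior X (invol ξ) = -invol (interior X ξ) := by
  induction ξ using VForms.induction with
  | zero => simp
  | of p P =>
    cases p with
    | zero => simp [invol_of]
    | succ p =>
      rw [invol_of, map_smul, interior_of_succ, invol_of, pow_succ, mul_neg_one]
      exact neg_smul ((-1 : R) ^ p) (of (P.curryLeft X))
  | add a b ha hb => simp only [map_add, ha, hb]; abel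

/-- Homogeneous elements of degree `p`. -/
def IsHom (p : ℕ) (ξ : VForms R L N) : Prop := ∃ P : L [⋀^Fin p]→ₗ[R] N, ξ = of P

theorem isHom_of {p : ℕ} (P : L [⋀^Fin p]→ₗ[R] N) : IsHom p (of P) := ⟨P, rfl⟩

theorem isHom_zero (p : ℕ) : IsHom p (0 : VForms R L N) := ⟨0, by simp⟩

namespace IsHom

variable {p : ℕ} {ξ η : VForms R L N}

theorem add (h : IsHom p ξ) (h' : IsHom p η) : IsHom p (ξ + η) := by
  obtain ⟨P, rfl⟩ := h
  obtain ⟨Q, rfl⟩ := h'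
  exact ⟨P + Q, by simp⟩

theorem smul (f : R) (h : IsHom p ξ) : IsHom p (f • ξ) := by
  obtain ⟨P, rfl⟩ := h
  exact ⟨f • P, by simp⟩

theorem neg (h : IsHom p ξ) : IsHom p (-ξ) := by
  obtain ⟨P, rfl⟩ := h
  exact ⟨-P, by simp⟩

theorem sub (h : IsHom p ξ) (h' : IsHom p η) : IsHom p (ξ - η) := by
  rw [sub_eq_add_neg]; exact h.add h'.neg

theorem interior (h : IsHom p ξ) (X : L) : IsHom (p - 1) (interior X ξ) := by
  obtain ⟨P, rfl⟩ := h
  cases p with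
  | zero => simpa using isHom_zero 0
  | succ p => exact ⟨_, interior_of_succ X P⟩

theorem invol_eq (h : IsHom p ξ) : invol ξ = (-1 : R) ^ p • ξ := by
  obtain ⟨P, rfl⟩ := h
  exact invol_of P

theorem invol (h : IsHom p ξ) : IsHom p (invol ξ) := by
  rw [h.invol_eq]
  exact h.smul _

theorem apply_ne (h : IsHom p ξ) {q : ℕ} (hq : q ≠ p) : ξ q = 0 := by
  obtain ⟨P, rfl⟩ := h
  exact DirectSum.of_eq_of_ne _ _ _ hq

theorem interior_eq_zero (h : IsHom 0 ξ) (X : L) : VForms.interior X ξ = 0 := by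
  obtain ⟨P, rfl⟩ := h
  simp

end IsHom

/-- A family of biadditive operations vanishes if it is compatible with interior products and
its component of degree zero vanishes. -/
theorem bilinear_eq_zero (E : ℕ → ℕ → VForms R L N₁ → VForms R L N₂ → VForms R L N₃)
    (hz : ∀ p q P, E p q P 0 = 0) (hz' : ∀ p q Q, E p q 0 Q = 0)
    (h0 : ∀ p q P Q, IsHom p P → IsHom q Q → E p q P Q 0 = 0)
    (hι : ∀ p q P Q X, IsHom p P → IsHom q Q →
      (∀ P', IsHom p P' → E p (q - 1) P' (interior X Q) = 0) →
      (∀ Q', IsHom q Q' → E (p - 1) q (interior X P) Q' = 0) → interior X (E p q P Q) = 0)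
    {p q : ℕ} {P : VForms R L N₁} {Q : VForms R L N₂} (hP : IsHom p P) (hQ : IsHom q Q) :
    E p q P Q = 0 := by
  induction hn : p + q using Nat.strong_induction_on generalizing p q P Q with
  | _ n ih =>
    refine ext_interior (h0 p q P Q hP hQ) fun X => ?_
    rw [map_zero]
    refine hι p q P Q X hP hQ (fun P' hP' => ?_) (fun Q' hQ' => ?_)
    -- For `q = 0` the truncated `q - 1` does not lower the total degree, but then the contraction
    -- is zero.
    · rcases Nat.eq_zero_or_pos q with rfl | hq
      · rw [hQ.interior_eq_zero, hz]
      · exact ih (p + (q - 1)) (by omega) hP' (hQ.interior X) rfl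
    · rcases Nat.eq_zero_or_pos p with rfl | hp
      · rw [hP.interior_eq_zero, hz']
      · exact ih (p - 1 + q) (by omega) (hP.interior X) hQ' rfl

/-- The wedge product along a bilinear map of the values, on the graded modules. -/
def wedge (Φ : N₁ →ₗ[R] N₂ →ₗ[R] N₃) : VForms R L N₁ →ₗ[R] VForms R L N₂ →ₗ[R] VForms R L N₃ :=
  DirectSum.toModule R ℕ _ fun p =>
    LinearMap.flip <| DirectSum.toModule R ℕ _ fun q => LinearMap.flip <|
      (wedgeAlong Φ p q).compr₂ (DirectSum.lof R ℕ (fun p => L [⋀^Fin p]→ₗ[R] N₃) (p + q))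

theorem wedge_of (Φ : N₁ →ₗ[R] N₂ →ₗ[R] N₃) {p q : ℕ} (P : L [⋀^Fin p]→ₗ[R] N₁)
    (Q : L [⋀^Fin q]→ₗ[R] N₂) : wedge Φ (of P) (of Q) = of (wedgeAlong Φ p q P Q) := by
  simp only [wedge, of_eq_lof, DirectSum.toModule_lof, LinearMap.flip_apply,
    LinearMap.compr₂_apply]

theorem IsHom.wedge (Φ : N₁ →ₗ[R] N₂ →ₗ[R] N₃) {p q : ℕ} {P : VForms R L N₁}
    {Q : VForms R L N₂} (hP : IsHom p P) (hQ : IsHom q Q) : IsHom (p + q) (wedge Φ P Q) := by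
  obtain ⟨P, rfl⟩ := hP
  obtain ⟨Q, rfl⟩ := hQ
  exact ⟨_, wedge_of Φ P Q⟩

theorem invol_wedge (Φ : N₁ →ₗ[R] N₂ →ₗ[R] N₃) (P : VForms R L N₁) (Q : VForms R L N₂) :
    invol (wedge Φ P Q) = wedge Φ (invol P) (invol Q) := by
  induction P using VForms.induction with
  | zero => simp
  | add a b ha hb => simp only [map_add, LinearMap.add_apply, ha, hb]
  | of p P =>
    induction Q using VForms.induction with
    | zero => simp
    | add a b ha hb => simp only [map_add, ha, hb]
    | of q Q =>
      rw [((isHom_of P).wedge Φ (isHom_of Q)).invol_eq, invol_of, invol_of]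
      simp only [map_smul, LinearMap.smul_apply, smul_smul, pow_add, mul_comm]

/-- The wedge product with values in forms of a degree equal to the sum of the degrees. -/
def wedgeCast {p q n : ℕ} (Φ : N₁ →ₗ[R] N₂ →ₗ[R] N₃) (h : p + q = n) (a : L [⋀^Fin p]→ₗ[R] N₁)
    (b : L [⋀^Fin q]→ₗ[R] N₂) : L [⋀^Fin n]→ₗ[R] N₃ :=
  (wedgeAlong Φ p q a b).domDomCongr (finCongr h)

theorem wedge_of_cast {p q n : ℕ} (Φ : N₁ →ₗ[R] N₂ →ₗ[R] N₃) (h : p + q = n)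
    (a : L [⋀^Fin p]→ₗ[R] N₁) (b : L [⋀^Fin q]→ₗ[R] N₂) :
    wedge Φ (of a) (of b) = of (wedgeCast Φ h a b) := by
  rw [wedge_of]
  exact of_congr h _ _ fun v => rfl

theorem factorial_smul_wedgeCast {p q n : ℕ} (Φ : N₁ →ₗ[R] N₂ →ₗ[R] N₃) (h : p + q = n)
    (a : L [⋀^Fin p]→ₗ[R] N₁) (b : L [⋀^Fin q]→ₗ[R] N₂) (v : Fin n → L) :
    (p.factorial * q.factorial) • wedgeCast Φ h a b v = permSum (blockProd Φ h a b) v :=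
  factorial_smul_wedgeAlong Φ h a b v

end Basic

/-! ### Contractions are antiderivations of the wedge product. -/

section WedgeInterior

variable {R : Type*} [CommRing R] [Algebra ℝ R] {L : Type*} [AddCommGroup L] [Module R L]
  {N₁ N₂ : Type*} [AddCommGroup N₁] [AddCommGroup N₂] [Module R N₁] [Module R N₂]

theorem nat_smul_injective {n : ℕ} (hn : n ≠ 0) {a b : R} (h : n • a = n • b) : a = b := by
  have h2 : ((n : ℝ)⁻¹ * n : ℝ) • a = ((n : ℝ)⁻¹ * n : ℝ) • b := by
    rw [mul_smul, mul_smul, Nat.cast_smul_eq_nsmul, Nat.cast_smul_eq_nsmul, h]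
  simpa [hn] using h2

/-- Multiplied by the factorials, both sides are permutation sums in which `X` lies either in the
block of `P` or, past it, in the block of `Q`. The four cases on the degrees arise because the
contraction of a 0-form is zero. -/
theorem interior_wedge (Φ : N₁ →ₗ[R] N₂ →ₗ[R] R) (X : L) (P : VForms R L N₁)
    (Q : VForms R L N₂) :
    interior X (wedge Φ P Q) = wedge Φ (interior X P) Q + wedge Φ (invol P) (interior X Q) := by
  induction P using VForms.induction with
  | zero => simp
  | add a b ha hb => simp only [map_add, LinearMap.add_apply, ha, hb]; abel
  | of p a =>
    induction Q using VForms.induction with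
    | zero => simp
    | add a b ha hb => simp only [map_add, ha, hb]; abel
    | of q b =>
      rw [invol_of]
      cases p with
      | zero =>
        cases q with
        | zero => rw [wedge_of_cast Φ (Nat.add_zero 0)]; simp
        | succ q =>
          have h : 0 + (q + 1) = q + 1 := by omega
          have h' : 0 + q = q := by omega
          rw [wedge_of_cast Φ h, interior_of_zero, interior_of_succ, interior_of_succ, pow_zero,
            one_smul, map_zero, LinearMap.zero_apply, zero_add, wedge_of_cast Φ h']
          congr 1
          ext w
          refine nat_smul_injective (Nat.mul_ne_zero (Nat.factorial_ne_zero 0)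
            (Nat.factorial_ne_zero (q + 1))) ?_
          rw [AlternatingMap.curryLeft_apply_apply, factorial_smul_wedgeCast]
          refine (permSum_cons _ X w).trans ?_
          rw [sum_fin_add h, sum_permSum_right Φ h h', ← factorial_smul_wedgeCast Φ h']
          simp [Nat.factorial_succ, mul_assoc]
      | succ p =>
        cases q with
        | zero =>
          have h : p + 1 + 0 = p + 1 := by omega
          have h' : p + 0 = p := by omega
          rw [wedge_of_cast Φ h, interior_of_zero, interior_of_succ, interior_of_succ, map_zero,
            add_zero, wedge_of_cast Φ h']
          congr 1
          ext w
          refine nat_smul_injective (Nat.mul_ne_zero (Nat.factorial_ne_zero (p + 1))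
            (Nat.factorial_ne_zero 0)) ?_
          rw [AlternatingMap.curryLeft_apply_apply, factorial_smul_wedgeCast]
          refine (permSum_cons _ X w).trans ?_
          rw [sum_fin_add h, sum_permSum_left Φ h h', ← factorial_smul_wedgeCast Φ h']
          simp [Nat.factorial_succ, mul_assoc]
        | succ q =>
          have h : p + 1 + (q + 1) = p + 1 + q + 1 := by omega
          have hl : p + (q + 1) = p + 1 + q := by omega
          rw [wedge_of_cast Φ h, interior_of_succ, interior_of_succ, interior_of_succ,
            map_smul, LinearMap.smul_apply, wedge_of_cast Φ hl, wedge_of_cast Φ rfl, ← of_smul,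
            ← of_add]
          congr 1
          ext w
          refine nat_smul_injective (Nat.mul_ne_zero (Nat.factorial_ne_zero (p + 1))
            (Nat.factorial_ne_zero (q + 1))) ?_
          rw [AlternatingMap.curryLeft_apply_apply, factorial_smul_wedgeCast]
          refine (permSum_cons _ X w).trans ?_
          rw [sum_fin_add h, sum_permSum_left Φ h hl, sum_permSum_right Φ h rfl,
            ← factorial_smul_wedgeCast Φ hl, ← factorial_smul_wedgeCast Φ rfl]
          -- The counts `p + 1` and `q + 1` of positions are absorbed by the factorials.
          simp only [AlternatingMap.add_apply, AlternatingMap.smul_apply, smul_eq_mul,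
            nsmul_eq_mul, zsmul_eq_mul, Nat.factorial_succ]
          push_cast
          ring

theorem wedgeCast_zero_left (Φ : N₁ →ₗ[R] N₂ →ₗ[R] R) {q : ℕ} (a : L [⋀^Fin 0]→ₗ[R] N₁)
    (b : L [⋀^Fin q]→ₗ[R] N₂) (v : Fin q → L) :
    wedgeCast Φ (Nat.zero_add q) a b v = Φ (a 0) (b v) := by
  refine nat_smul_injective (Nat.factorial_ne_zero q) ?_
  have h := factorial_smul_wedgeCast Φ (Nat.zero_add q) a b v
  rw [Nat.factorial_zero, one_mul] at h
  rw [h, permSum]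
  have h1 : ∀ σ : Equiv.Perm (Fin q), Equiv.Perm.sign σ •
      blockProd Φ (Nat.zero_add q) a b (fun i => v (σ i)) = Φ (a 0) (b v) := fun σ => by
    have h2 : (fun j : Fin q => v (σ (Fin.cast (Nat.zero_add q) (Fin.natAdd 0 j)))) = v ∘ σ := by
      funext j
      exact congrArg (fun k => v (σ k)) (Fin.ext (by simp))
    have h3 : ∀ u : Fin 0 → L, a u = a 0 := fun u => congrArg a (Subsingleton.elim u 0)
    rw [blockProd, h2, h3, AlternatingMap.map_perm]
    rcases Int.units_eq_one_or (Equiv.Perm.sign σ) with h | h <;> rw [h] <;> simp [Units.smul_def]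
  rw [Finset.sum_congr rfl fun σ _ => h1 σ]
  simp [Fintype.card_perm]

end WedgeInterior

end VForms

/-! ### Forms built from their contractions, and products with a covector. -/

section Uncurry

variable {R : Type*} [CommRing R] {L : Type*} [AddCommGroup L] [Module R L]
  {N : Type*} [AddCommGroup N] [Module R N]

/-- The form of degree `p + 1` obtained from a linear family of `p`-forms, if it alternates. -/
def AlternatingMap.ofCurryLeft {p : ℕ} (T : L →ₗ[R] L [⋀^Fin p]→ₗ[R] N)
    (h : ∀ X w, (∃ i, w i = X) → T X w = 0) : L [⋀^Fin (p + 1)]→ₗ[R] N :=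
  { LinearMap.uncurryLeft (M := fun _ => L) (AlternatingMap.toMultilinearMapLM ∘ₗ T) with
    map_eq_zero_of_eq' := fun v i j hv hij => by
      change T (v 0) (Fin.tail v) = 0
      rcases Fin.eq_zero_or_eq_succ i with rfl | ⟨i, rfl⟩
      · rcases Fin.eq_zero_or_eq_succ j with rfl | ⟨j, rfl⟩
        · exact absurd rfl hij
        · exact h _ _ ⟨j, hv.symm⟩
      · rcases Fin.eq_zero_or_eq_succ j with rfl | ⟨j, rfl⟩
        · exact h _ _ ⟨i, hv⟩
        · exact (T (v 0)).map_eq_zero_of_eq _ (i := i) (j := j) hv fun e => hij (by rw [e]) }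

theorem AlternatingMap.ofCurryLeft_curryLeft {p : ℕ} (T : L →ₗ[R] L [⋀^Fin p]→ₗ[R] N)
    (h : ∀ X w, (∃ i, w i = X) → T X w = 0) (X : L) :
    (AlternatingMap.ofCurryLeft T h).curryLeft X = T X := by
  ext w
  rfl

/-- Moving an argument to the front only changes the sign. The hypothesis is quantified over `q`
with `p = q + 1` so as to cover `p = 0`, where nothing is required. -/
theorem AlternatingMap.eq_zero_of_mem_range {p : ℕ} (P : L [⋀^Fin p]→ₗ[R] N) (X : L)
    (h : ∀ q (hq : p = q + 1) (w : Fin q → L),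
      P (fun i => (Fin.cons X w : Fin (q + 1) → L) (Fin.cast hq i)) = 0)
    (v : Fin p → L) (hv : ∃ i, v i = X) : P v = 0 := by
  obtain ⟨i, hi⟩ := hv
  cases p with
  | zero => exact i.elim0
  | succ p =>
    have h1 := P.map_insertNth i X (i.removeNth v)
    rw [← hi, Fin.insertNth_self_removeNth, hi] at h1
    rw [h1]
    exact (congrArg _ (h p rfl _)).trans (smul_zero _)

theorem AlternatingMap.map_update_eq {p : ℕ} (P : L [⋀^Fin (p + 1)]→ₗ[R] N)
    (v : Fin (p + 1) → L) (i : Fin (p + 1)) (X : L) :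
    P (Function.update v i X) = (-1 : ℤ) ^ (i : ℕ) • P.curryLeft X (i.removeNth v) := by
  rw [← Fin.insertNth_removeNth, P.map_insertNth]
  rfl

theorem AlternatingMap.ext_curryLeft {p : ℕ} {P Q : L [⋀^Fin (p + 1)]→ₗ[R] N}
    (h : ∀ X, P.curryLeft X = Q.curryLeft X) : P = Q := by
  ext v
  have := congrArg (fun T => T (Fin.tail v)) (h (v 0))
  rw [← Fin.cons_self_tail v]
  exact this

/-- The exterior product of a section of `A*` with a form. -/
def covectorWedge {p : ℕ} (α : Module.Dual R L) (P : L [⋀^Fin p]→ₗ[R] N) :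
    L [⋀^Fin (p + 1)]→ₗ[R] N :=
  AlternatingMap.alternatizeUncurryFin (α.smulRight P)

theorem covectorWedge_apply {p : ℕ} (α : Module.Dual R L) (P : L [⋀^Fin p]→ₗ[R] N)
    (v : Fin (p + 1) → L) :
    covectorWedge α P v = ∑ i : Fin (p + 1), (-1 : ℤ) ^ (i : ℕ) • α (v i) • P (i.removeNth v) := by
  rw [covectorWedge, AlternatingMap.alternatizeUncurryFin_apply]
  rfl

theorem covectorWedge_curryLeft {p : ℕ} (α : Module.Dual R L) (P : L [⋀^Fin (p + 1)]→ₗ[R] N)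
    (X : L) : (covectorWedge α P).curryLeft X = α X • P - covectorWedge α (P.curryLeft X) := by
  ext w
  rw [AlternatingMap.curryLeft_apply_apply, covectorWedge_apply, Fin.sum_univ_succ,
    AlternatingMap.sub_apply, covectorWedge_apply, sub_eq_add_neg, ← Finset.sum_neg_distrib]
  congr 1
  · simp
  · refine Finset.sum_congr rfl fun i _ => ?_
    rw [Fin.val_succ, pow_succ, mul_neg_one, neg_smul]
    congr 3
    rw [AlternatingMap.curryLeft_apply_apply]
    congr 1
    funext j
    refine Fin.cases ?_ (fun j => ?_) j
    · simp [Fin.removeNth]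
    · simp [Fin.removeNth]

/-- Separates slot `j` from the other slots. Linearity of the Lie derivative in slot `j` then
follows, since the Leibniz terms of the bracket in that slot and of the anchor cancel. -/
theorem sum_update_update {p : ℕ} (P : L [⋀^Fin p]→ₗ[R] N) (g : L → L) (v : Fin p → L)
    (j : Fin p) (z : L) :
    ∑ i, P (Function.update (Function.update v j z) i (g (Function.update v j z i))) =
      P (Function.update v j (g z)) + ∑ i ∈ Finset.univ.erase j,
        P (Function.update (Function.update v i (g (v i))) j z) := by
  rw [← Finset.add_sum_erase _ _ (Finset.mem_univ j)]
  congr 1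
  · simp
  · refine Finset.sum_congr rfl fun i hi => ?_
    have hij := Finset.ne_of_mem_erase hi
    rw [Function.update_of_ne hij, Function.update_comm hij]

end Uncurry

/-! ### The Lie derivative and the recursive construction of the differential. -/

section LieDerivative

variable {R : Type*} [CommRing R] [Algebra ℝ R] {L : Type*} [AddCommGroup L] [Module R L]

/-- The Lie derivative of a form along a section. -/
def lieForm (S : AnchoredBracket R L) (X : L) {p : ℕ} (P : L [⋀^Fin p]→ₗ[R] R) :
    L [⋀^Fin p]→ₗ[R] R where
  toFun v := S.anchor X (P v) - ∑ i, P (Function.update v i (S.bracket X (v i)))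
  map_update_add' {inst} v j x y := by
    rw [Subsingleton.elim inst (instDecidableEqFin p)]
    simp only [sum_update_update, map_add, P.map_update_add, Finset.sum_add_distrib]
    abel
  map_update_smul' {inst} v j f x := by
    rw [Subsingleton.elim inst (instDecidableEqFin p)]
    simp only [sum_update_update, P.map_update_add, P.map_update_smul, S.leibniz, Derivation.leibniz,
      smul_eq_mul, ← Finset.mul_sum]
    ring
  map_eq_zero_of_eq' v i j hv hij := by
    -- Only the terms of slots `i` and `j` survive; the transposition exchanges them with opposite
    -- signs.
    rw [P.map_eq_zero_of_eq v hv hij, map_zero, zero_sub, neg_eq_zero,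
      Fintype.sum_eq_add i j hij]
    · have h := P.map_swap (Function.update v i (S.bracket X (v i))) hij
      have e : Function.update v i (S.bracket X (v i)) ∘ Equiv.swap i j =
          Function.update v j (S.bracket X (v j)) := by
        funext k
        rcases eq_or_ne k i with rfl | hk
        · simp [hij, hij.symm, hv]
        · rcases eq_or_ne k j with rfl | hk'
          · simp [hv]
          · simp [Equiv.swap_apply_of_ne_of_ne hk hk', hk, hk']
      rw [e] at h
      rw [h, add_neg_cancel]
    · rintro k ⟨hki, hkj⟩
      exact P.map_eq_zero_of_eq _ (i := i) (j := j) (by simp [hki.symm, hkj.symm, hv]) hij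

theorem lieForm_apply (S : AnchoredBracket R L) (X : L) {p : ℕ} (P : L [⋀^Fin p]→ₗ[R] R)
    (v : Fin p → L) :
    lieForm S X P v = S.anchor X (P v) - ∑ i, P (Function.update v i (S.bracket X (v i))) := rfl

variable {S : AnchoredBracket R L}

theorem lieForm_curryLeft (X Y : L) {p : ℕ} (P : L [⋀^Fin (p + 1)]→ₗ[R] R) :
    (lieForm S X P).curryLeft Y = lieForm S X (P.curryLeft Y) - P.curryLeft (S.bracket X Y) := by
  ext w
  simp only [AlternatingMap.curryLeft_apply_apply, lieForm_apply, Fin.sum_univ_succ,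
    AlternatingMap.sub_apply]
  simp only [Matrix.vecCons, Fin.cons_zero,
    Fin.cons_succ, Fin.update_cons_zero, ← Fin.cons_update]
  ring

theorem lieForm_add (X : L) {p : ℕ} (P Q : L [⋀^Fin p]→ₗ[R] R) :
    lieForm S X (P + Q) = lieForm S X P + lieForm S X Q := by
  ext v
  simp only [lieForm_apply, AlternatingMap.add_apply, map_add, Finset.sum_add_distrib]
  ring

theorem lieForm_smul (X : L) (f : R) {p : ℕ} (P : L [⋀^Fin p]→ₗ[R] R) :
    lieForm S X (f • P) = f • lieForm S X P + S.anchor X f • P := by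
  ext v
  simp only [lieForm_apply, AlternatingMap.smul_apply, AlternatingMap.add_apply, smul_eq_mul,
    Derivation.leibniz, ← Finset.mul_sum]
  ring

theorem lieForm_add_left (X Y : L) {p : ℕ} (P : L [⋀^Fin p]→ₗ[R] R) :
    lieForm S (X + Y) P = lieForm S X P + lieForm S Y P := by
  ext v
  simp only [lieForm_apply, AlternatingMap.add_apply, map_add, Derivation.add_apply,
    AddMonoidHom.add_apply, P.map_update_add, Finset.sum_add_distrib]
  ring

namespace AnchoredBracket

theorem bracket_skew (hS : ∀ X, S.bracket X X = 0) (X Y : L) : S.bracket Y X = -S.bracket X Y := by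
  have h := hS (X + Y)
  simp only [map_add, AddMonoidHom.add_apply, hS, zero_add, add_zero] at h
  exact eq_neg_of_add_eq_zero_left h

theorem bracket_smul_left (hS : ∀ X, S.bracket X X = 0) (f : R) (X Y : L) :
    S.bracket (f • X) Y = f • S.bracket X Y - S.anchor Y f • X := by
  rw [bracket_skew hS Y, S.leibniz, bracket_skew hS X Y]
  simp only [smul_neg, neg_add, neg_neg, sub_eq_add_neg]

end AnchoredBracket

/-- Skew-symmetry supplies the Leibniz rule in the first argument of the bracket. Nothing more is
used to build the differential: `quasiBracket` need not satisfy the Jacobi identity, and `d² = 0` is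
not claimed. -/
theorem lieForm_smul_left (hS : ∀ X, S.bracket X X = 0) (f : R) (X : L) {p : ℕ}
    (P : L [⋀^Fin (p + 1)]→ₗ[R] R) :
    lieForm S (f • X) P = f • lieForm S X P + covectorWedge (S.dFun f) (P.curryLeft X) := by
  ext v
  simp only [lieForm_apply, AlternatingMap.add_apply, AlternatingMap.smul_apply, map_smul,
    Derivation.smul_apply, smul_eq_mul, AnchoredBracket.bracket_smul_left hS, sub_eq_add_neg,
    P.map_update_add, P.map_update_smul, ← neg_smul, Finset.sum_add_distrib, ← Finset.mul_sum,
    covectorWedge_apply, P.map_update_eq v _ X]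
  rw [mul_add, neg_add, add_assoc, mul_neg]
  congr 2
  rw [← Finset.sum_neg_distrib]
  refine Finset.sum_congr rfl fun i _ => ?_
  simp only [AnchoredBracket.dFun, LinearMap.coe_mk, AddHom.coe_mk, zsmul_eq_mul, Int.cast_pow,
    Int.cast_neg, Int.cast_one, AlternatingMap.curryLeft_apply_apply]
  ring

/-- The differential on `p`-forms, characterized by `i_X d = L_X - d i_X`. -/
structure DifferentialOn (S : AnchoredBracket R L) (p : ℕ) where
  toFun : (L [⋀^Fin p]→ₗ[R] R) → (L [⋀^Fin (p + 1)]→ₗ[R] R)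
  add : ∀ P Q, toFun (P + Q) = toFun P + toFun Q
  smul : ∀ (f : R) P, toFun (f • P) = f • toFun P + covectorWedge (S.dFun f) P
  -- The Cartan formula restricted to forms killed by `i_X`; this is what alternation in the next
  -- degree requires.
  contract : ∀ X P, (∀ w, (∃ i, w i = X) → P w = 0) →
    (toFun P).curryLeft X = lieForm S X P

/-- The differential on functions. -/
def DifferentialOn.zero (S : AnchoredBracket R L) : DifferentialOn S 0 where
  toFun P := Forms.oneForm (S.dFun (P 0))
  add P Q := by
    ext v
    simp [AnchoredBracket.dFun]
  smul f P := by
    ext v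
    have h : P (Fin.tail v) = P 0 := congrArg P (Subsingleton.elim _ _)
    have h' : P ![] = P 0 := congrArg P (Subsingleton.elim _ _)
    simp [AnchoredBracket.dFun, covectorWedge_apply, h, h', mul_comm]
  contract X P _ := by
    ext v
    rw [lieForm_apply, Subsingleton.elim v 0]
    simp [AnchoredBracket.dFun]

/-- The differential on forms of the next degree. -/
def DifferentialOn.succ (hS : ∀ X, S.bracket X X = 0) {p : ℕ} (D : DifferentialOn S p) :
    DifferentialOn S (p + 1) where
  toFun P := AlternatingMap.ofCurryLeft
    { toFun := fun X => lieForm S X P - D.toFun (P.curryLeft X)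
      map_add' := fun X Y => by
        rw [map_add, D.add, lieForm_add_left]
        abel
      map_smul' := fun f X => by
        rw [map_smul, D.smul, lieForm_smul_left hS, RingHom.id_apply, smul_sub]
        abel }
    -- Alternation of `X ↦ L_X P - d i_X P`: contracted with `X`, the first term is `L_X i_X P`
    -- because `[X, X] = 0`, and the second is `L_X i_X P` by `contract`, because `i_X i_X P = 0`.
    (fun X w hw => by
      refine AlternatingMap.eq_zero_of_mem_range _ X (fun q hq u => ?_) w hw
      obtain rfl : p = q := by omega
      have h1 := lieForm_curryLeft (S := S) X X P
      have h2 := D.contract X (P.curryLeft X) (fun u hu => by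
        obtain ⟨i, hi⟩ := hu
        exact P.map_eq_zero_of_eq _ (i := i.succ) (j := 0) (by simpa using hi)
          (Fin.succ_ne_zero i))
      rw [hS, map_zero, sub_zero] at h1
      have h3 := congrArg (fun T => T u) (h1.trans h2.symm)
      exact sub_eq_zero_of_eq h3)
  add P Q := by
    refine AlternatingMap.ext_curryLeft fun X => ?_
    change lieForm S X (P + Q) - D.toFun (P.curryLeft X + Q.curryLeft X) =
      (lieForm S X P - D.toFun (P.curryLeft X)) + (lieForm S X Q - D.toFun (Q.curryLeft X))
    rw [D.add, lieForm_add]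
    abel
  smul f P := by
    refine AlternatingMap.ext_curryLeft fun X => ?_
    change lieForm S X (f • P) - D.toFun (f • P.curryLeft X) =
      f • (lieForm S X P - D.toFun (P.curryLeft X)) + (covectorWedge (S.dFun f) P).curryLeft X
    rw [D.smul, lieForm_smul, covectorWedge_curryLeft, smul_sub]
    change _ = _ + (S.anchor X f • P - _)
    abel
  contract X P hP := by
    rw [AlternatingMap.ofCurryLeft_curryLeft]
    have h0 : P.curryLeft X = 0 := by
      ext w
      exact hP _ ⟨0, rfl⟩
    have h1 : D.toFun 0 = 0 := by simpa using D.add 0 0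
    change lieForm S X P - D.toFun (P.curryLeft X) = _
    rw [h0, h1, sub_zero]

end LieDerivative

namespace VForms

/-! ### Functions and 1-forms as generators; Leibniz rules of the Lie derivative and of the
differential. -/

section Generators

variable {R : Type*} [CommRing R] {L : Type*} [AddCommGroup L] [Module R L]

/-- A function as a form of degree zero. -/
abbrev fn (f : R) : VForms R L R := of (Forms.zeroForm f)

/-- A section of `A*` as a form of degree one. -/
abbrev cov (α : Module.Dual R L) : VForms R L R := of (Forms.oneForm α)

theorem exists_fn {ξ : VForms R L R} (h : IsHom 0 ξ) : ∃ f : R, ξ = fn f := by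
  obtain ⟨P, rfl⟩ := h
  refine ⟨P 0, ?_⟩
  congr 1
  ext v
  exact congrArg P (Subsingleton.elim _ _)

theorem exists_cov {ξ : VForms R L R} (h : IsHom 1 ξ) : ∃ α : Module.Dual R L, ξ = cov α := by
  obtain ⟨P, rfl⟩ := h
  exact ⟨(AlternatingMap.ofSubsingleton R L R (0 : Fin 1)).symm P,
    congrArg of ((AlternatingMap.ofSubsingleton R L R (0 : Fin 1)).apply_symm_apply P).symm⟩

theorem interior_cov (X : L) (α : Module.Dual R L) : interior X (cov α) = fn (α X) := by
  rw [interior_of_succ]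
  congr 1

/-- The wedge product of scalar forms. -/
abbrev mul : VForms R L R →ₗ[R] VForms R L R →ₗ[R] VForms R L R := wedge (LinearMap.mul R R)

end Generators

section Differential

variable {R : Type*} [CommRing R] [Algebra ℝ R] {L : Type*} [AddCommGroup L] [Module R L]

theorem fn_mul (f : R) (ξ : VForms R L R) : mul (fn f) ξ = f • ξ := by
  induction ξ using VForms.induction with
  | zero => simp
  | add a b ha hb => simp only [map_add, smul_add, ha, hb]
  | of p P =>
    rw [mul, wedge_of_cast _ (Nat.zero_add p), ← of_smul]
    congr 1
    ext v
    rw [wedgeCast_zero_left]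
    rfl

theorem real_smul_eq (c : ℝ) (ξ : VForms R L R) : c • ξ = algebraMap ℝ R c • ξ := by
  induction ξ using VForms.induction with
  | zero => simp
  | add a b ha hb => simp only [smul_add, ha, hb]
  | of p P =>
    rw [← of_smul]
    refine (map_smul (DirectSum.lof ℝ ℕ (fun p => L [⋀^Fin p]→ₗ[R] R) p) c P).symm.trans ?_
    change of (c • P) = _
    congr 1
    ext v
    simp [Algebra.smul_def]

theorem real_neg_one_pow_smul (k : ℕ) (ξ : VForms R L R) :
    (-1 : ℝ) ^ k • ξ = (-1 : R) ^ k • ξ := by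
  rw [real_smul_eq, map_pow, map_neg, map_one]

/-- The Lie derivative of forms. -/
def lie (S : AnchoredBracket R L) (X : L) : VForms R L R →ₗ[ℝ] VForms R L R :=
  DirectSum.toModule ℝ ℕ _ fun p =>
    { toFun := fun P => of (lieForm S X P)
      map_add' := fun P Q => by rw [lieForm_add, of_add]
      map_smul' := fun c P => by
        rw [RingHom.id_apply, real_smul_eq, ← of_smul]
        have h : c • P = algebraMap ℝ R c • P := by ext v; simp [Algebra.smul_def]
        rw [h, lieForm_smul, Derivation.map_algebraMap, zero_smul, add_zero] }

variable {S : AnchoredBracket R L}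

theorem lie_of (X : L) {p : ℕ} (P : L [⋀^Fin p]→ₗ[R] R) : lie S X (of P) = of (lieForm S X P) := by
  rw [lie, of_eq_lof]
  exact DirectSum.toModule_lof (M := fun p => L [⋀^Fin p]→ₗ[R] R) ℝ p P

theorem interior_lie (X Y : L) (ξ : VForms R L R) :
    interior Y (lie S X ξ) = lie S X (interior Y ξ) - interior (S.bracket X Y) ξ := by
  induction ξ using VForms.induction with
  | zero => simp
  | add a b ha hb => simp only [map_add, ha, hb]; abel
  | of p P =>
    rw [lie_of]
    cases p with
    | zero => simp
    | succ p =>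
      rw [interior_of_succ, interior_of_succ, interior_of_succ, lie_of, lieForm_curryLeft,
        sub_eq_add_neg, of_add, of_neg, sub_eq_add_neg]

theorem lie_fn (X : L) (f : R) : lie S X (fn f) = fn (S.anchor X f) := by
  rw [lie_of]
  congr 1
  ext v
  simp [lieForm_apply]

theorem IsHom.lie {p : ℕ} {ξ : VForms R L R} (h : IsHom p ξ) (X : L) : IsHom p (lie S X ξ) := by
  obtain ⟨P, rfl⟩ := h
  exact ⟨_, lie_of X P⟩

theorem invol_lie (X : L) (ξ : VForms R L R) : lie S X (invol ξ) = invol (lie S X ξ) := by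
  induction ξ using VForms.induction with
  | zero => simp
  | add a b ha hb => simp only [map_add, ha, hb]
  | of p P =>
    rw [((isHom_of P).lie X).invol_eq, invol_of, ← real_neg_one_pow_smul, map_smul,
      real_neg_one_pow_smul]

/-- Contraction with `Y` turns the defect of the Leibniz rule into defects in which `P` or `Q` is
contracted, the terms in `[X, Y]` cancelling. Induction on the total degree leaves the case of two
functions, where the anchor is a derivation. -/
theorem lie_mul (X : L) (P Q : VForms R L R) :
    lie S X (mul P Q) = mul (lie S X P) Q + mul P (lie S X Q) := by
  have key : ∀ p q (P Q : VForms R L R), IsHom p P → IsHom q Q →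
      lie S X (mul P Q) - mul (lie S X P) Q - mul P (lie S X Q) = 0 := by
    intro p q P Q hP hQ
    refine bilinear_eq_zero (N₁ := R) (N₂ := R) (N₃ := R) (fun _ _ P Q =>
      lie S X (mul P Q) - mul (lie S X P) Q - mul P (lie S X Q)) ?_ ?_ ?_ ?_ hP hQ
    · intro _ _ P; simp
    · intro _ _ Q; simp
    · intro p q P Q hP hQ
      rcases Nat.eq_zero_or_pos (p + q) with h | h
      · obtain ⟨rfl, rfl⟩ : p = 0 ∧ q = 0 := by omega
        obtain ⟨f, rfl⟩ := exists_fn hP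
        obtain ⟨g, rfl⟩ := exists_fn hQ
        suffices h : lie S X (mul (fn f) (fn g)) - mul (lie S X (fn f)) (fn g) -
            mul (fn f) (lie S X (fn g)) = (0 : VForms R L R) by rw [h]; rfl
        rw [lie_fn, lie_fn, fn_mul, fn_mul, fn_mul, ← of_smul, ← of_smul, ← of_smul, lie_of,
          sub_sub, ← of_add, sub_eq_zero]
        congr 1
        ext v
        simp [lieForm_apply, mul_comm]
        try ring
      · have h1 := (hP.wedge (LinearMap.mul R R) hQ).lie (S := S) X
        have h2 := (hP.lie (S := S) X).wedge (LinearMap.mul R R) hQ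
        have h3 := hP.wedge (LinearMap.mul R R) (hQ.lie (S := S) X)
        exact ((h1.sub h2).sub h3).apply_ne (by omega)
    · intro p q P Q Y hP hQ h1 h2
      have h3 := h1 (invol P) hP.invol
      have h4 := h2 Q hQ
      have h5 : lie S X (mul (interior Y P) Q) = mul (lie S X (interior Y P)) Q +
          mul (interior Y P) (lie S X Q) := by rw [← sub_eq_zero, ← h4]; abel
      have h6 : lie S X (mul (invol P) (interior Y Q)) =
          mul (lie S X (invol P)) (interior Y Q) + mul (invol P) (lie S X (interior Y Q)) := by
        rw [← sub_eq_zero, ← h3]; abel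
      simp only [map_sub, interior_lie, interior_wedge, map_add, LinearMap.sub_apply, h5, h6,
        invol_lie]
      abel
  induction P using VForms.induction with
  | zero => simp
  | add a b ha hb => simp only [map_add, LinearMap.add_apply, ha, hb]; abel
  | of p P =>
    induction Q using VForms.induction with
    | zero => simp
    | add a b ha hb => simp only [map_add, ha, hb]; abel
    | of q Q =>
      have := key p q _ _ (isHom_of P) (isHom_of Q)
      rwa [sub_sub, sub_eq_zero] at this

/-- The differential on forms of degree `p` of an anchored bracket. -/
def differentialOn (hS : ∀ X, S.bracket X X = 0) : ∀ p, DifferentialOn S p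
  | 0 => DifferentialOn.zero S
  | p + 1 => DifferentialOn.succ hS (differentialOn hS p)

/-- The differential of an anchored bracket. -/
def diff (hS : ∀ X, S.bracket X X = 0) : VForms R L R →ₗ[ℝ] VForms R L R :=
  DirectSum.toModule ℝ ℕ _ fun p =>
    { toFun := fun P => of ((differentialOn hS p).toFun P)
      map_add' := fun P Q => by rw [(differentialOn hS p).add, of_add]
      map_smul' := fun c P => by
        rw [RingHom.id_apply, real_smul_eq, ← of_smul]
        have h : c • P = algebraMap ℝ R c • P := by ext v; simp [Algebra.smul_def]
        have h' : S.dFun (algebraMap ℝ R c) = 0 := by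
          ext X
          exact (S.anchor X).map_algebraMap c
        rw [h, (differentialOn hS p).smul, h']
        congr 1
        ext v
        simp [covectorWedge_apply] }

variable (hS : ∀ X, S.bracket X X = 0)

theorem diff_of {p : ℕ} (P : L [⋀^Fin p]→ₗ[R] R) :
    diff hS (of P) = of ((differentialOn hS p).toFun P) := by
  rw [diff, of_eq_lof]
  exact DirectSum.toModule_lof (M := fun p => L [⋀^Fin p]→ₗ[R] R) ℝ p P

theorem interior_diff (X : L) (ξ : VForms R L R) :
    interior X (diff hS ξ) = lie S X ξ - diff hS (interior X ξ) := by
  induction ξ using VForms.induction with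
  | zero => simp
  | add a b ha hb => simp only [map_add, ha, hb]; abel
  | of p P =>
    rw [diff_of, interior_of_succ, lie_of]
    cases p with
    | zero =>
      rw [interior_of_zero, map_zero, sub_zero]
      congr 1
      exact (differentialOn hS 0).contract X P fun w ⟨i, _⟩ => i.elim0
    | succ p =>
      rw [interior_of_succ, diff_of, sub_eq_add_neg, ← of_neg, ← of_add, ← sub_eq_add_neg]
      congr 1

theorem diff_fn (f : R) : diff hS (fn f) = cov (S.dFun f) := by
  rw [diff_of]
  congr 1

theorem IsHom.diff {p : ℕ} {ξ : VForms R L R} (h : IsHom p ξ) :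
    IsHom (p + 1) (diff hS ξ) := by
  obtain ⟨P, rfl⟩ := h
  exact ⟨_, diff_of hS P⟩

theorem invol_diff (ξ : VForms R L R) : diff hS (invol ξ) = -invol (diff hS ξ) := by
  induction ξ using VForms.induction with
  | zero => simp
  | add a b ha hb => simp only [map_add, ha, hb]; abel
  | of p P =>
    rw [((isHom_of P).diff hS).invol_eq, invol_of, ← real_neg_one_pow_smul, map_smul,
      real_neg_one_pow_smul, pow_succ, mul_neg_one]
    exact (neg_eq_iff_eq_neg.mp (neg_smul ((-1 : R) ^ p) (diff hS (of P))).symm)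

/-- The induction of `lie_mul` applies; the defect has degree `p + q + 1 > 0`, so its component of
degree zero is trivially zero. -/
theorem diff_mul (P Q : VForms R L R) :
    diff hS (mul P Q) = mul (diff hS P) Q + mul (invol P) (diff hS Q) := by
  have key : ∀ p q (P Q : VForms R L R), IsHom p P → IsHom q Q →
      diff hS (mul P Q) - mul (diff hS P) Q - mul (invol P) (diff hS Q) = 0 := by
    intro p q P Q hP hQ
    refine bilinear_eq_zero (N₁ := R) (N₂ := R) (N₃ := R) (fun _ _ P Q =>
      diff hS (mul P Q) - mul (diff hS P) Q - mul (invol P) (diff hS Q)) ?_ ?_ ?_ ?_ hP hQ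
    · intro _ _ P; simp
    · intro _ _ Q; simp
    · intro p q P Q hP hQ
      have h1 := (hP.wedge (LinearMap.mul R R) hQ).diff hS
      have h2 := (hP.diff hS).wedge (LinearMap.mul R R) hQ
      have h3 := hP.invol.wedge (LinearMap.mul R R) (hQ.diff hS)
      rw [DirectSum.sub_apply, DirectSum.sub_apply, h1.apply_ne (by omega),
        h2.apply_ne (by omega), h3.apply_ne (by omega)]
      simp
    · intro p q P Q Y hP hQ h1 h2
      have h3 := h1 (invol P) hP.invol
      have h4 := h2 Q hQ
      have h5 : diff hS (mul (interior Y P) Q) = mul (diff hS (interior Y P)) Q +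
          mul (invol (interior Y P)) (diff hS Q) := by rw [← sub_eq_zero, ← h4]; abel
      have h6 : diff hS (mul (invol P) (interior Y Q)) =
          mul (diff hS (invol P)) (interior Y Q) + mul P (diff hS (interior Y Q)) := by
        rw [← sub_eq_zero, ← h3, invol_invol]; abel
      simp only [map_sub, interior_diff, interior_wedge, map_add, LinearMap.sub_apply, h5, h6,
        lie_mul, invol_diff, interior_invol, invol_invol, map_neg, LinearMap.neg_apply]
      abel
  induction P using VForms.induction with
  | zero => simp
  | add a b ha hb => simp only [map_add, LinearMap.add_apply, ha, hb]; abel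
  | of p P =>
    induction Q using VForms.induction with
    | zero => simp
    | add a b ha hb => simp only [map_add, ha, hb]; abel
    | of q Q =>
      have := key p q _ _ (isHom_of P) (isHom_of Q)
      rwa [sub_sub, sub_eq_zero] at this

end Differential

end VForms

namespace VForms

/-! ### Contraction of two forms by a bivector. -/

section Pairing

variable {R : Type*} [CommRing R] {L : Type*} [AddCommGroup L] [Module R L]

/-- A scalar form of degree `p + 1` as a form of degree `p` with values in `Γ(A*)`. -/
def dualizeForm {p : ℕ} (P : L [⋀^Fin (p + 1)]→ₗ[R] R) : L [⋀^Fin p]→ₗ[R] Module.Dual R L where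
  toFun v :=
    { toFun := fun Y => P.curryLeft Y v
      map_add' := fun Y Z => by rw [map_add]; rfl
      map_smul' := fun f Y => by rw [map_smul]; rfl }
  map_update_add' v i x y := by
    ext Y
    exact (P.curryLeft Y).map_update_add v i x y
  map_update_smul' v i f x := by
    ext Y
    exact (P.curryLeft Y).map_update_smul v i f x
  map_eq_zero_of_eq' v i j hv hij := by
    ext Y
    exact (P.curryLeft Y).map_eq_zero_of_eq v hv hij

/-- The linear map underlying `dualizeForm`. -/
def dualizeHom : ∀ p : ℕ, (L [⋀^Fin p]→ₗ[R] R) →ₗ[R] VForms R L (Module.Dual R L)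
  | 0 => 0
  | p + 1 => DirectSum.lof R ℕ (fun p => L [⋀^Fin p]→ₗ[R] Module.Dual R L) p ∘ₗ
      { toFun := dualizeForm
        map_add' := fun _ _ => rfl
        map_smul' := fun _ _ => rfl }

/-- Scalar forms as forms with values in `Γ(A*)`. -/
def dualize : VForms R L R →ₗ[R] VForms R L (Module.Dual R L) :=
  DirectSum.toModule R ℕ _ dualizeHom

@[simp]
theorem dualize_of_zero (P : L [⋀^Fin 0]→ₗ[R] R) : dualize (of P) = 0 := by
  rw [dualize, of_eq_lof, DirectSum.toModule_lof]
  rfl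

@[simp]
theorem dualize_of_succ {p : ℕ} (P : L [⋀^Fin (p + 1)]→ₗ[R] R) :
    dualize (of P) = of (dualizeForm P) := by
  rw [dualize, of_eq_lof, DirectSum.toModule_lof]
  rfl

/-- The covector value occupies the first slot of the form, and the contraction has to pass it. -/
theorem interior_dualize (X : L) (ξ : VForms R L R) :
    interior X (dualize ξ) = -dualize (interior X ξ) := by
  induction ξ using VForms.induction with
  | zero => simp
  | add a b ha hb => simp only [map_add, ha, hb]; abel
  | of p P =>
    match p with
    | 0 => simp
    | 1 => simp
    | p + 2 =>
      rw [dualize_of_succ, interior_of_succ, interior_of_succ, dualize_of_succ, ← of_neg]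
      congr 1
      ext w Y
      have h := P.map_swap (Fin.cons X (Fin.cons Y w : Fin (p + 1) → L) : Fin (p + 2) → L)
        (Fin.zero_ne_one)
      refine Eq.trans (congrArg P ?_) h
      funext i
      refine Fin.cases ?_ (fun i => ?_) i
      · simp
      · refine Fin.cases ?_ (fun i => ?_) i
        · simp
        · have h2 : Equiv.swap (0 : Fin (p + 2)) 1 i.succ.succ = i.succ.succ :=
            Equiv.swap_apply_of_ne_of_ne (Fin.succ_ne_zero _)
              (fun h => Fin.succ_ne_zero i (Fin.succ_injective _ h))
          simp [h2]

theorem invol_dualize (ξ : VForms R L R) : invol (dualize ξ) = -dualize (invol ξ) := by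
  induction ξ using VForms.induction with
  | zero => simp
  | add a b ha hb => simp only [map_add, ha, hb]; abel
  | of p P =>
    cases p with
    | zero => simp [invol_of]
    | succ p =>
      rw [dualize_of_succ, invol_of, invol_of, map_smul, dualize_of_succ, pow_succ, mul_neg_one]
      exact (neg_eq_iff_eq_neg.mp (neg_smul ((-1 : R) ^ p) (of (dualizeForm P))).symm)

variable (π : Bivector R L)

/-- The pairing of sections of `A*` defined by a bivector. -/
def bivectorForm : Module.Dual R L →ₗ[R] Module.Dual R L →ₗ[R] R := LinearMap.applyₗ ∘ₗ π.sharp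

theorem _root_.Bivector.skew (α β : Module.Dual R L) : β (π.sharp α) = -α (π.sharp β) := by
  have h := π.alt (α + β)
  simp only [map_add, LinearMap.add_apply, π.alt, zero_add, add_zero] at h
  exact eq_neg_of_add_eq_zero_left h

/-- The contraction of two forms by a bivector. -/
def pair : VForms R L R →ₗ[R] VForms R L R →ₗ[R] VForms R L R :=
  (wedge (bivectorForm π)).compl₁₂ dualize dualize

theorem pair_apply (P Q : VForms R L R) :
    pair π P Q = wedge (bivectorForm π) (dualize P) (dualize Q) := rfl

theorem IsHom.dualize {p : ℕ} {ξ : VForms R L R} (h : IsHom p ξ) : IsHom (p - 1) (dualize ξ) := by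
  obtain ⟨P, rfl⟩ := h
  cases p with
  | zero => simpa using isHom_zero 0
  | succ p => exact ⟨_, dualize_of_succ P⟩

theorem IsHom.pair {p q : ℕ} {P Q : VForms R L R} (hP : IsHom p P) (hQ : IsHom q Q) :
    IsHom (p - 1 + (q - 1)) (pair π P Q) := by
  rw [pair_apply]
  exact hP.dualize.wedge (bivectorForm π) hQ.dualize

theorem pair_zero_left {P : VForms R L R} (hP : IsHom 0 P) (Q : VForms R L R) :
    pair π P Q = 0 := by
  obtain ⟨P, rfl⟩ := hP
  simp [pair_apply]

theorem pair_zero_right (P : VForms R L R) {Q : VForms R L R} (hQ : IsHom 0 Q) :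
    pair π P Q = 0 := by
  obtain ⟨Q, rfl⟩ := hQ
  simp [pair_apply]

theorem invol_pair (P Q : VForms R L R) : invol (pair π P Q) = pair π (invol P) (invol Q) := by
  rw [pair_apply, invol_wedge, invol_dualize, invol_dualize, pair_apply]
  simp only [map_neg, LinearMap.neg_apply, neg_neg]

/-- A family of triadditive operations vanishes if it is compatible with interior products and
its component of degree zero vanishes. -/
theorem trilinear_eq_zero
    (E : ℕ → VForms R L R → VForms R L R → VForms R L R → VForms R L R)
    (hz : ∀ p Q T, E p 0 Q T = 0) (hz' : ∀ p P T, E p P 0 T = 0) (hz'' : ∀ p P Q, E p P Q 0 = 0)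
    (h0 : ∀ p q t P Q T, IsHom p P → IsHom q Q → IsHom t T → E p P Q T 0 = 0)
    (hι : ∀ p q t P Q T X, IsHom p P → IsHom q Q → IsHom t T →
      (∀ Q' T', IsHom q Q' → IsHom t T' → E (p - 1) (interior X P) Q' T' = 0) →
      (∀ P' T', IsHom p P' → IsHom t T' → E p P' (interior X Q) T' = 0) →
      (∀ P' Q', IsHom p P' → IsHom q Q' → E p P' Q' (interior X T) = 0) →
      interior X (E p P Q T) = 0)
    {p q t : ℕ} {P Q T : VForms R L R} (hP : IsHom p P) (hQ : IsHom q Q) (hT : IsHom t T) :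
    E p P Q T = 0 := by
  induction hn : p + q + t using Nat.strong_induction_on generalizing p q t P Q T with
  | _ n ih =>
    refine ext_interior (h0 p q t P Q T hP hQ hT) fun X => ?_
    rw [map_zero]
    refine hι p q t P Q T X hP hQ hT (fun Q' T' hQ' hT' => ?_) (fun P' T' hP' hT' => ?_)
      (fun P' Q' hP' hQ' => ?_)
    · rcases Nat.eq_zero_or_pos p with rfl | h
      · rw [hP.interior_eq_zero, hz]
      · exact ih (p - 1 + q + t) (by omega) (hP.interior X) hQ' hT' rfl
    · rcases Nat.eq_zero_or_pos q with rfl | h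
      · rw [hQ.interior_eq_zero, hz']
      · exact ih (p + (q - 1) + t) (by omega) hP' (hQ.interior X) hT' rfl
    · rcases Nat.eq_zero_or_pos t with rfl | h
      · rw [hT.interior_eq_zero, hz'']
      · exact ih (p + q + (t - 1)) (by omega) hP' hQ' (hT.interior X) rfl

theorem IsHom.invol_pow {p : ℕ} {ξ : VForms R L R} (h : IsHom p ξ) (k : ℕ) :
    IsHom p ((VForms.invol ^ k : Module.End R (VForms R L R)) ξ) := by
  induction k with
  | zero => exact h
  | succ k ih => rw [pow_succ', Module.End.mul_apply]; exact ih.invol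

theorem interior_invol_pow (k : ℕ) (X : L) (ξ : VForms R L R) :
    interior X ((invol ^ k : Module.End R (VForms R L R)) ξ) =
      (-1 : R) ^ k • (invol ^ k : Module.End R (VForms R L R)) (interior X ξ) := by
  induction k generalizing ξ with
  | zero => simp
  | succ k ih =>
    simp only [pow_succ, Module.End.mul_apply, ih, interior_invol, map_neg, mul_neg_one,
      smul_neg, neg_smul_form]

theorem invol_pow_fn (k : ℕ) (f : R) :
    (invol ^ k : Module.End R (VForms R L R)) (fn f) = fn f := by
  induction k with
  | zero => rfl
  | succ k ih => rw [pow_succ, Module.End.mul_apply, invol_of, pow_zero, one_smul, ih]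

end Pairing

section Derivations

variable {R : Type*} [CommRing R] [Algebra ℝ R] {L : Type*} [AddCommGroup L] [Module R L]

theorem interior_pair (π : Bivector R L) (X : L) (P Q : VForms R L R) :
    interior X (pair π P Q) = pair π (invol P) (interior X Q) - pair π (interior X P) Q := by
  simp only [pair_apply, interior_wedge, interior_dualize, invol_dualize, map_neg,
    LinearMap.neg_apply, neg_neg]
  abel

theorem pair_cov_cov (π : Bivector R L) (α β : Module.Dual R L) :
    pair π (cov α) (cov β) = fn (β (π.sharp α)) := by
  rw [pair_apply, dualize_of_succ, dualize_of_succ, wedge_of_cast _ (Nat.zero_add 0)]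
  congr 1
  ext v
  rw [wedgeCast_zero_left]
  have h : ∀ (γ : Module.Dual R L) (u : Fin 0 → L), dualizeForm (Forms.oneForm γ) u = γ :=
    fun γ u => LinearMap.ext fun Y => rfl
  rw [h, h]
  rfl

/-- In the induction by contractions the component of degree zero is nontrivial only for two
1-forms, where the identity is the skew-symmetry of `π`. -/
theorem pair_skew (π : Bivector R L) {p q : ℕ} {P Q : VForms R L R} (hP : IsHom p P)
    (hQ : IsHom q Q) : pair π Q P = -((-1 : R) ^ ((p + 1) * (q + 1)) • pair π P Q) := by
  rw [← add_eq_zero_iff_eq_neg]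
  refine bilinear_eq_zero (N₁ := R) (N₂ := R) (N₃ := R) (fun p q P Q =>
    pair π Q P + (-1 : R) ^ ((p + 1) * (q + 1)) • pair π P Q) ?_ ?_ ?_ ?_ hP hQ
  · intro p q P; simp
  · intro p q Q; simp
  · intro p q P Q hP hQ
    by_cases h : p = 1 ∧ q = 1
    · obtain ⟨rfl, rfl⟩ := h
      obtain ⟨α, rfl⟩ := exists_cov hP
      obtain ⟨β, rfl⟩ := exists_cov hQ
      have h : pair π (cov β) (cov α) +
          (-1 : R) ^ ((1 + 1) * (1 + 1)) • pair π (cov α) (cov β) = 0 := by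
        rw [pair_cov_cov, pair_cov_cov, π.skew α β, ← of_smul, ← of_add, ← of_zero (p := 0)]
        congr 1
        ext v
        simp
        ring
      exact congrArg (fun ξ : VForms R L R => ξ 0) h
    · rcases Nat.eq_zero_or_pos p with rfl | hp
      · simp only [pair_zero_left π hP, pair_zero_right π _ hP, smul_zero, add_zero]; rfl
      · rcases Nat.eq_zero_or_pos q with rfl | hq
        · simp only [pair_zero_left π hQ, pair_zero_right π _ hQ, smul_zero, add_zero]; rfl
        · have h1 := hQ.pair π hP
          rw [add_comm] at h1
          exact (h1.add ((hP.pair π hQ).smul _)).apply_ne (by omega)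
  · intro p q P Q X hP hQ h1 h2
    have h3 := h1 P hP
    have h4 := h2 Q hQ
    rw [← eq_neg_iff_add_eq_zero] at h3 h4
    rw [map_add, map_smul, interior_pair, interior_pair, hP.invol_eq, hQ.invol_eq]
    simp only [map_smul, LinearMap.smul_apply, h3, h4]
    cases p with
    | zero =>
      rw [hP.interior_eq_zero]
      cases q with
      | zero => rw [hQ.interior_eq_zero]; simp
      | succ q => rcases Nat.even_or_odd q with hq | hq <;> simp [hq.neg_one_pow, pow_succ]
    | succ p =>
      cases q with
      | zero =>
        rw [hQ.interior_eq_zero]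
        rcases Nat.even_or_odd p with hp | hp <;> simp [hp.neg_one_pow, pow_succ]
      | succ q =>
        simp only [Nat.add_sub_cancel]
        rcases Nat.even_or_odd p with hp | hp <;> rcases Nat.even_or_odd q with hq | hq <;>
        simp [hp.neg_one_pow, hq.neg_one_pow, pow_succ, pow_mul, pow_add, mul_add, add_mul] <;>
        abel

theorem fn_mul_right (ξ : VForms R L R) (f : R) : mul ξ (fn f) = f • ξ := by
  induction ξ using VForms.induction with
  | zero => simp
  | add a b ha hb => simp only [map_add, LinearMap.add_apply, smul_add, ha, hb]
  | of p P =>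
    induction p with
    | zero =>
      obtain ⟨g, hg⟩ := exists_fn (isHom_of P)
      rw [hg, fn_mul, ← of_smul, ← of_smul]
      congr 1
      ext v
      simp [mul_comm]
    | succ p ih =>
      refine ext_interior ?_ fun X => ?_
      · have h1 := (isHom_of P).wedge (LinearMap.mul R R) (isHom_of (Forms.zeroForm f))
        rw [h1.apply_ne (by omega), ((isHom_of P).smul f).apply_ne (by omega)]
      · rw [interior_wedge, interior_of_zero, map_zero, add_zero, interior_of_succ, map_smul,
          interior_of_succ]
        exact ih _

/-- The contraction lowers each degree by one, so in the second argument it is a derivation with the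
parity of `P`. The sign is written as a power of `invol` so that `Q` need not be homogeneous. -/
theorem pair_mul (π : Bivector R L) {p : ℕ} {P : VForms R L R} (hP : IsHom p P)
    (Q T : VForms R L R) :
    pair π P (mul Q T) =
      mul (pair π P Q) T + mul ((invol ^ p : Module.End R (VForms R L R)) Q) (pair π P T) := by
  have key : ∀ q t (Q T : VForms R L R), IsHom q Q → IsHom t T → pair π P (mul Q T) -
      (mul (pair π P Q) T + mul ((invol ^ p : Module.End R (VForms R L R)) Q) (pair π P T)) = 0 := by
    intro q t Q T hQ hT
    refine trilinear_eq_zero (fun p P Q T => pair π P (mul Q T) -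
      (mul (pair π P Q) T + mul ((invol ^ p : Module.End R (VForms R L R)) Q) (pair π P T)))
      ?_ ?_ ?_ ?_ ?_ hP hQ hT
    · intros; simp
    · intros; simp
    · intros; simp
    · intro p q t P Q T hP hQ hT
      rcases Nat.eq_zero_or_pos p with rfl | hp
      · simp only [pair_zero_left π hP, map_zero, LinearMap.zero_apply, add_zero, sub_zero]
        rfl
      rcases Nat.eq_zero_or_pos q with rfl | hq
      · obtain ⟨f, rfl⟩ := exists_fn hQ
        simp only [fn_mul, invol_pow_fn, map_smul, pair_zero_right π _ hQ, map_zero,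
          LinearMap.zero_apply, zero_add, sub_self]
        rfl
      rcases Nat.eq_zero_or_pos t with rfl | ht
      · obtain ⟨f, rfl⟩ := exists_fn hT
        simp only [fn_mul_right, map_smul, pair_zero_right π _ hT, map_zero, add_zero, sub_self]
        rfl
      have h1 := hP.pair π (hQ.wedge (LinearMap.mul R R) hT)
      have h2 := (hP.pair π hQ).wedge (LinearMap.mul R R) hT
      have h3 := (hQ.invol_pow p).wedge (LinearMap.mul R R) (hP.pair π hT)
      rw [DirectSum.sub_apply, DirectSum.add_apply, h1.apply_ne (by omega),
        h2.apply_ne (by omega), h3.apply_ne (by omega)]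
      simp
    · intro p q t P Q T X hP hQ hT h1 h2 h3
      have h2' := sub_eq_zero.mp (h2 P T hP hT)
      have h3' := sub_eq_zero.mp (h3 P (invol Q) hP hQ.invol)
      simp only [map_sub, map_add, interior_pair, interior_wedge, interior_invol_pow, invol_pair,
        hP.invol_eq, map_smul, LinearMap.smul_apply, LinearMap.sub_apply, h2', h3']
      cases p with
      | zero =>
        rw [hP.interior_eq_zero]
        simp
        abel
      | succ p =>
        have h1' := sub_eq_zero.mp (h1 Q T hQ hT)
        rw [h1', Nat.add_sub_cancel]
        have e : invol ((invol ^ (p + 1) : Module.End R (VForms R L R)) Q) =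
            (invol ^ p : Module.End R (VForms R L R)) Q := by
          rw [pow_succ', Module.End.mul_apply, invol_invol]
        have e' : (invol ^ (p + 1) : Module.End R (VForms R L R)) (invol Q) =
            (invol ^ p : Module.End R (VForms R L R)) Q := by
          rw [pow_succ, Module.End.mul_apply, invol_invol]
        rw [e, e']
        simp only [smul_add]
        abel
  induction Q using VForms.induction with
  | zero => simp
  | add a b ha hb => simp only [map_add, LinearMap.add_apply, ha, hb]; abel
  | of p Q =>
    induction T using VForms.induction with
    | zero => simp
    | add a b ha hb => simp only [map_add, ha, hb]; abel
    | of q T => exact sub_eq_zero.mp (key _ _ _ _ (isHom_of Q) (isHom_of T))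

end Derivations

end VForms

/-! ### Local frames with cutoffs, derivations of forms, and their vanishing on generators. -/

section Framed

variable {R : Type*} [CommRing R] {L : Type*} [AddCommGroup L] [Module R L]

/-- A function `χ` such that `χ X` is a combination of finitely many sections, with coefficients
depending linearly on `X`. -/
def IsFraming (L : Type*) [AddCommGroup L] [Module R L] (χ : R) : Prop :=
  ∃ (n : ℕ) (e : Fin n → L) (ε : Fin n → Module.Dual R L), ∀ X : L, χ • X = ∑ i, ε i X • e i

/-- The module of sections of a bundle with local frames, seen through cutoff functions: an element
annihilated by all functions supported in the domain of a frame is zero. -/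
structure LocallyFramed (R : Type*) [CommRing R] (L : Type*) [AddCommGroup L] [Module R L] :
    Prop where
  eq_zero : ∀ a : R, (∀ χ : R, IsFraming L χ → χ * a = 0) → a = 0
  section_eq_zero : ∀ X : L, (∀ χ : R, IsFraming L χ → χ • X = 0) → X = 0

theorem LocallyFramed.separating (h : LocallyFramed R L) (X : L)
    (hX : ∀ α : Module.Dual R L, α X = 0) : X = 0 := by
  refine h.section_eq_zero X fun χ ⟨n, e, ε, hχ⟩ => ?_
  rw [hχ]
  simp [hX]

end Framed

namespace VForms

section IsDer

variable {R : Type*} [CommRing R] {L : Type*} [AddCommGroup L] [Module R L]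

theorem map_neg_one_pow_smul {D : VForms R L R → VForms R L R}
    (hD : ∀ P Q, D (P + Q) = D P + D Q) (k : ℕ) (ξ : VForms R L R) :
    D ((-1 : R) ^ k • ξ) = (-1 : R) ^ k • D ξ := by
  have hneg : D (-ξ) = -D ξ := (AddMonoidHom.mk' D hD).map_neg ξ
  rcases Nat.even_or_odd k with h | h
  · simp [h.neg_one_pow]
  · simpa [h.neg_one_pow] using hneg

/-- A derivation of the algebra of forms whose parity is that of `k`. -/
structure IsDer (k : ℕ) (D : VForms R L R → VForms R L R) : Prop where
  add : ∀ P Q, D (P + Q) = D P + D Q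
  mul : ∀ P Q, D (mul P Q) =
    VForms.mul (D P) Q + VForms.mul ((VForms.invol ^ k : Module.End R (VForms R L R)) P) (D Q)
  invol : ∀ P, D (invol P) = (-1 : R) ^ k • VForms.invol (D P)

theorem invol_pow_even {k : ℕ} (hk : Even k) :
    (invol ^ k : Module.End R (VForms R L R)) = 1 := by
  obtain ⟨c, rfl⟩ := hk
  have h : (invol : Module.End R (VForms R L R)) * invol = 1 := LinearMap.ext invol_invol
  rw [← two_mul, pow_mul, pow_two, h, one_pow]

theorem invol_pow_odd {k : ℕ} (hk : Odd k) :
    (invol ^ k : Module.End R (VForms R L R)) = invol := by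
  obtain ⟨c, rfl⟩ := hk
  rw [pow_succ, invol_pow_even (even_two_mul c), one_mul]

namespace IsDer

variable {k l : ℕ} {D D' : VForms R L R → VForms R L R}

theorem map_zero (h : IsDer k D) : D 0 = 0 := by simpa using h.add 0 0

theorem map_neg (h : IsDer k D) (P : VForms R L R) : D (-P) = -D P :=
  (AddMonoidHom.mk' D h.add).map_neg P

/-- Only the parity of `k` matters. This allows natural numbers as labels for derivations of
possibly negative degree such as `p - 2`. -/
theorem congr_parity (h : IsDer k D) (hkl : Even (k + l)) : IsDer l D where
  add := h.add
  mul P Q := by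
    rw [h.mul]
    rcases Nat.even_or_odd k with hk | hk
    · rw [invol_pow_even hk, invol_pow_even ((Nat.even_add.mp hkl).mp hk)]
    · have hl : Odd l := by
        rw [← Nat.not_even_iff_odd] at hk ⊢
        exact fun hl => hk ((Nat.even_add.mp hkl).mpr hl)
      rw [invol_pow_odd hk, invol_pow_odd hl]
  invol P := by
    rw [h.invol]
    rcases Nat.even_or_odd k with hk | hk
    · rw [hk.neg_one_pow, ((Nat.even_add.mp hkl).mp hk).neg_one_pow]
    · have hl : Odd l := by
        rw [← Nat.not_even_iff_odd] at hk ⊢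
        exact fun hl => hk ((Nat.even_add.mp hkl).mpr hl)
      rw [hk.neg_one_pow, hl.neg_one_pow]

theorem sum (h : IsDer k D) (h' : IsDer k D') : IsDer k fun P => D P + D' P where
  add P Q := by rw [h.add, h'.add]; abel
  mul P Q := by
    rw [h.mul, h'.mul]
    simp only [map_add, LinearMap.add_apply]
    abel
  invol P := by rw [h.invol, h'.invol, map_add, smul_add]

theorem neg (h : IsDer k D) : IsDer k fun P => -D P where
  add P Q := by rw [h.add]; abel
  mul P Q := by
    rw [h.mul]
    simp only [_root_.map_neg, LinearMap.neg_apply]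
    abel
  invol P := by rw [h.invol, _root_.map_neg, smul_neg]

theorem sub (h : IsDer k D) (h' : IsDer k D') : IsDer k fun P => D P - D' P := by
  simpa only [sub_eq_add_neg] using h.sum h'.neg

theorem commutator (h : IsDer k D) (h' : IsDer l D') :
    IsDer (k + l) fun P => D (D' P) - (-1 : R) ^ (k * l) • D' (D P) where
  add P Q := by
    rw [h.add, h'.add, h.add, h'.add, smul_add]
    abel
  mul P Q := by
    rcases Nat.even_or_odd k with hk | hk <;> rcases Nat.even_or_odd l with hl | hl <;>
    simp [h.mul, h'.mul, h.add, h'.add, invol_pow_even, invol_pow_odd, hk, hl, h.invol, h'.invol,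
      pow_add, pow_mul, hk.neg_one_pow, hl.neg_one_pow] <;> abel
  invol P := by
    rw [h'.invol, map_neg_one_pow_smul h.add, h.invol, h.invol, map_neg_one_pow_smul h'.add,
      h'.invol]
    simp only [map_sub, map_smul, smul_sub, smul_smul]
    congr 2 <;> ring

end IsDer

end IsDer

section Vanishing

variable {R : Type*} [CommRing R] [Algebra ℝ R] {L : Type*} [AddCommGroup L] [Module R L]

/-- Euler's formula: for a frame with dual coframe, the sum of `ε^i ∧ i_{e_i}` multiplies `p`-forms
by `p`; here it is cut off by `χ`. Contraction with `X` gives `χ i_X P` plus the same sum for `i_X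
P`, whence the induction. -/
theorem sum_cov_mul_interior {n : ℕ} {χ : R} {e : Fin n → L} {ε : Fin n → Module.Dual R L}
    (h : ∀ X : L, χ • X = ∑ i, ε i X • e i) {p : ℕ} {P : VForms R L R} (hP : IsHom p P) :
    ∑ i, mul (cov (ε i)) (interior (e i) P) = (p * χ) • P := by
  induction p generalizing P with
  | zero =>
    simp only [hP.interior_eq_zero, map_zero, Finset.sum_const_zero, Nat.cast_zero, zero_mul,
      zero_smul]
  | succ p ih =>
    refine ext_interior ?_ fun X => ?_
    · rw [(hP.smul _).apply_ne (by omega)]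
      have h1 : IsHom (1 + p) (∑ i, mul (cov (ε i)) (interior (e i) P)) :=
        Finset.sum_induction _ (IsHom (1 + p)) (fun _ _ => IsHom.add) (isHom_zero _)
          fun i _ => (isHom_of _).wedge _ (hP.interior (e i))
      exact h1.apply_ne (by omega)
    · have h2 : ∀ i, interior X (mul (cov (ε i)) (interior (e i) P)) =
          ε i X • interior (e i) P + mul (cov (ε i)) (interior (e i) (interior X P)) := fun i => by
        rw [interior_wedge, interior_cov, fn_mul, interior_interior X, invol_of, pow_one]
        simp
      have h3 : ∑ i, ε i X • interior (e i) P = χ • interior X P := by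
        let g : L →ₗ[R] VForms R L R :=
          { toFun := fun Y => interior Y P
            map_add' := fun Y Z => interior_add_left Y Z P
            map_smul' := fun f Y => interior_smul_left f Y P }
        change ∑ i, ε i X • g (e i) = χ • g X
        rw [← map_smul, h, map_sum]
        simp only [map_smul]
      rw [map_sum, Finset.sum_congr rfl fun i _ => h2 i, Finset.sum_add_distrib, h3,
        ih (hP.interior X), map_smul, ← add_smul]
      congr 1
      push_cast
      ring

/-- A derivation that kills functions is linear over functions. For a form of degree `p > 1`,
Euler's formula expresses `pχP` through products of 1-forms with forms of degree `p - 1`, so `pχ D P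
= 0` by induction; `p` is invertible and the cutoffs `χ` detect zero. -/
theorem IsDer.eq_zero (hL : LocallyFramed R L) {k : ℕ} {D : VForms R L R → VForms R L R}
    (h : IsDer k D) (h0 : ∀ f, D (fn f) = 0) (h1 : ∀ α, D (cov α) = 0) (ξ : VForms R L R) :
    D ξ = 0 := by
  have hsmul : ∀ (f : R) P, D (f • P) = f • D P := fun f P => by
    rw [← fn_mul, h.mul, h0, invol_pow_fn, fn_mul]
    simp
  have hhom : ∀ p (P : VForms R L R), IsHom p P → D P = 0 := by
    intro p
    induction p with
    | zero =>
      intro P hP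
      obtain ⟨f, rfl⟩ := exists_fn hP
      exact h0 f
    | succ p ih =>
      intro P hP
      cases p with
      | zero =>
        obtain ⟨α, rfl⟩ := exists_cov hP
        exact h1 α
      | succ p =>
        have hχ : ∀ χ : R, IsFraming L χ → χ • D P = 0 := by
          rintro χ ⟨n, e, ε, he⟩
          have h2 := congrArg D (sum_cov_mul_interior he hP)
          have h3 : D (∑ i, VForms.mul (cov (ε i)) (interior (e i) P)) = 0 := by
            refine (map_sum (AddMonoidHom.mk' D h.add) _ _).trans ?_
            refine Finset.sum_eq_zero fun i _ => ?_
            change D (VForms.mul _ _) = 0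
            rw [h.mul, h1, ih _ (hP.interior (e i))]
            simp
          rw [h3, hsmul] at h2
          refine DFinsupp.ext fun q => ?_
          ext v
          have h4 := congrArg (fun ξ : VForms R L R => ξ q v) h2
          have h5 : ((p + 1 + 1 : ℕ) : R) * χ * D P q v = 0 := h4.symm
          change χ * D P q v = 0
          refine nat_smul_injective (n := p + 1 + 1) (by omega) ?_
          rw [nsmul_eq_mul, ← mul_assoc, h5, smul_zero]
        refine DFinsupp.ext fun q => ?_
        ext v
        exact hL.eq_zero _ fun χ hχ' => congrArg (fun ξ : VForms R L R => ξ q v) (hχ χ hχ')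
  induction ξ using VForms.induction with
  | zero => exact h.map_zero
  | add a b ha hb => rw [h.add, ha, hb, add_zero]
  | of p P => exact hhom p _ (isHom_of P)

end Vanishing

end VForms

namespace AnchoredBracket

variable {R : Type*} [CommRing R] [Algebra ℝ R] {L : Type*} [AddCommGroup L] [Module R L]
  (S : AnchoredBracket R L)

theorem dFun_apply (f : R) (X : L) : S.dFun f X = S.anchor X f := rfl

theorem lieDer_apply (X Y : L) (α : Module.Dual R L) :
    S.lieDer X α Y = S.anchor X (α Y) - α (S.bracket X Y) := rfl

theorem koszul_apply (π : Bivector R L) (α β : Module.Dual R L) (X : L) :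
    S.koszul π α β X = S.anchor (π.sharp α) (β X) - β (S.bracket (π.sharp α) X) -
      (S.anchor (π.sharp β) (α X) - α (S.bracket (π.sharp β) X)) - S.anchor X (β (π.sharp α)) :=
  rfl

theorem deform_bracket (N : Module.End R L) (X Y : L) : (S.deform N).bracket X Y =
    S.bracket (N X) Y + S.bracket X (N Y) - N (S.bracket X Y) := rfl

theorem deform_anchor (N : Module.End R L) (X : L) : (S.deform N).anchor X = S.anchor (N X) := rfl

end AnchoredBracket

namespace VForms

/-! ### The Koszul bracket of forms. -/

section Koszul

variable {R : Type*} [CommRing R] [Algebra ℝ R] {L : Type*} [AddCommGroup L] [Module R L]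
  {S : AnchoredBracket R L} (hS : ∀ X, S.bracket X X = 0) (π : Bivector R L)

/-- The Koszul bracket of forms. -/
def koszulForms (P Q : VForms R L R) : VForms R L R :=
  diff hS (pair π P Q) + pair π (diff hS P) Q - pair π (invol P) (diff hS Q)

theorem koszulForms_add_left (P P' Q : VForms R L R) :
    koszulForms hS π (P + P') Q = koszulForms hS π P Q + koszulForms hS π P' Q := by
  simp only [koszulForms, map_add, LinearMap.add_apply]
  abel

theorem koszulForms_add_right (P Q Q' : VForms R L R) :
    koszulForms hS π P (Q + Q') = koszulForms hS π P Q + koszulForms hS π P Q' := by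
  simp only [koszulForms, map_add]
  abel

/-- The Koszul bracket as a real bilinear map. -/
def koszulBracket : VForms R L R →ₗ[ℝ] VForms R L R →ₗ[ℝ] VForms R L R :=
  LinearMap.mk₂ ℝ (koszulForms hS π) (koszulForms_add_left hS π)
    (fun c P Q => by
      simp only [koszulForms, map_smul]
      simp only [real_smul_eq, map_smul, LinearMap.smul_apply]
      simp only [← real_smul_eq, map_smul, smul_add, smul_sub])
    (koszulForms_add_right hS π)
    (fun c P Q => by
      simp only [koszulForms, map_smul]
      simp only [real_smul_eq, map_smul]
      simp only [← real_smul_eq, map_smul, smul_add, smul_sub])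

theorem koszulBracket_apply (P Q : VForms R L R) : koszulBracket hS π P Q =
    diff hS (pair π P Q) + pair π (diff hS P) Q - pair π (invol P) (diff hS Q) := rfl

theorem diff_neg_one_pow_smul (k : ℕ) (ξ : VForms R L R) :
    diff hS ((-1 : R) ^ k • ξ) = (-1 : R) ^ k • diff hS ξ :=
  map_neg_one_pow_smul (fun P Q => map_add _ P Q) k ξ

theorem isDer_diff : IsDer 1 (diff hS) where
  add P Q := map_add _ P Q
  mul P Q := by rw [diff_mul, pow_one]
  invol P := by rw [invol_diff, pow_one]; simp

theorem isDer_pair {p : ℕ} {P : VForms R L R} (hP : IsHom p P) : IsDer p (pair π P) where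
  add Q T := map_add _ Q T
  mul Q T := pair_mul π hP Q T
  invol Q := by
    rw [invol_pair, hP.invol_eq, map_smul, LinearMap.smul_apply, smul_smul, ← mul_pow]
    simp

/-- For homogeneous `P`, the operator `[P, ·]` is the graded commutator of `d` with `⟨P, ·⟩`, plus
`⟨dP, ·⟩`: a sum of two derivations of parity `p + 1`. -/
theorem isDer_koszulBracket {p : ℕ} {P : VForms R L R} (hP : IsHom p P) :
    IsDer (p + 1) (koszulBracket hS π P) := by
  have h1 := (isDer_diff hS).commutator (isDer_pair π hP)
  have h2 := isDer_pair π (hP.diff hS)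
  rw [add_comm 1 p] at h1
  have h3 := h1.sum h2
  refine (congrArg (IsDer (p + 1)) (funext fun Q => ?_)).mp h3
  rw [koszulBracket_apply, hP.invol_eq, map_smul, LinearMap.smul_apply, one_mul]
  abel

theorem koszulBracket_neg_one_pow_smul (P : VForms R L R) (k : ℕ) (ξ : VForms R L R) :
    koszulBracket hS π P ((-1 : R) ^ k • ξ) = (-1 : R) ^ k • koszulBracket hS π P ξ :=
  map_neg_one_pow_smul (fun _ _ => map_add _ _ _) k ξ

theorem koszulBracket_neg_one_pow_smul_left (P : VForms R L R) (k : ℕ) (ξ : VForms R L R) :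
    koszulBracket hS π ((-1 : R) ^ k • ξ) P = (-1 : R) ^ k • koszulBracket hS π ξ P :=
  map_neg_one_pow_smul (D := fun ξ => koszulBracket hS π ξ P)
    (fun _ _ => by simp only [map_add, LinearMap.add_apply]) k ξ

theorem koszulBracket_skew {p q : ℕ} {P Q : VForms R L R} (hP : IsHom p P) (hQ : IsHom q Q) :
    koszulBracket hS π P Q = -((-1 : R) ^ ((p + 1) * (q + 1)) • koszulBracket hS π Q P) := by
  rw [koszulBracket_apply, koszulBracket_apply, hP.invol_eq, hQ.invol_eq, pair_skew π hQ hP,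
    pair_skew π hQ (hP.diff hS), map_neg, diff_neg_one_pow_smul, map_smul, map_smul,
    LinearMap.smul_apply, LinearMap.smul_apply, pair_skew π (hQ.diff hS) hP]
  rcases Nat.even_or_odd p with hp | hp <;> rcases Nat.even_or_odd q with hq | hq <;>
  simp [hp.neg_one_pow, hq.neg_one_pow, pow_succ, pow_mul, pow_add, mul_add, add_mul] <;> abel

theorem IsHom.koszulBracket {p q n : ℕ} {P Q : VForms R L R} (hP : IsHom p P) (hQ : IsHom q Q)
    (hn : p + q = n + 1) : IsHom n (koszulBracket hS π P Q) := by
  rw [koszulBracket_apply]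
  rcases Nat.eq_zero_or_pos p with rfl | hp
  · obtain rfl : q = n + 1 := by omega
    have h1 := (hP.diff hS).pair π hQ
    rw [pair_zero_left π hP, pair_zero_left π hP.invol]
    simpa using h1
  rcases Nat.eq_zero_or_pos q with rfl | hq
  · obtain rfl : p = n + 1 := by omega
    have h1 := hP.invol.pair π (hQ.diff hS)
    rw [pair_zero_right π _ hQ, pair_zero_right π _ hQ]
    simpa using h1.neg
  have h1 := (hP.pair π hQ).diff hS
  have h2 := (hP.diff hS).pair π hQ
  have h3 := hP.invol.pair π (hQ.diff hS)
  rw [show p - 1 + (q - 1) + 1 = n by omega] at h1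
  rw [show p + 1 - 1 + (q - 1) = n by omega] at h2
  rw [show p - 1 + (q + 1 - 1) = n by omega] at h3
  exact (h1.add h2).sub h3

theorem koszulBracket_cov_fn (α : Module.Dual R L) (f : R) :
    koszulBracket hS π (cov α) (fn f) = fn (S.anchor (π.sharp α) f) := by
  rw [koszulBracket_apply, pair_zero_right π _ (isHom_of _), pair_zero_right π _ (isHom_of _),
    diff_fn, invol_of, map_smul, LinearMap.smul_apply, pair_cov_cov]
  simp [AnchoredBracket.dFun]

theorem koszulBracket_fn_fn (f g : R) : koszulBracket hS π (fn f) (fn g) = 0 := by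
  rw [koszulBracket_apply, pair_zero_right π _ (isHom_of _), pair_zero_right π _ (isHom_of _),
    invol_of, map_smul, LinearMap.smul_apply, pair_zero_left π (isHom_of _)]
  simp

theorem koszulBracket_fn_cov (f : R) (α : Module.Dual R L) :
    koszulBracket hS π (fn f) (cov α) = -fn (S.anchor (π.sharp α) f) := by
  rw [koszulBracket_skew hS π (isHom_of _) (isHom_of _), koszulBracket_cov_fn]
  simp

theorem pair_cov (α : Module.Dual R L) (ξ : VForms R L R) :
    pair π (cov α) ξ = interior (π.sharp α) ξ := by
  induction ξ using VForms.induction with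
  | zero => simp
  | add a b ha hb => simp only [map_add, ha, hb]
  | of p P =>
    cases p with
    | zero => rw [pair_zero_right π _ (isHom_of P), interior_of_zero]
    | succ p =>
      rw [pair_apply, dualize_of_succ, dualize_of_succ, wedge_of_cast _ (Nat.zero_add p),
        interior_of_succ]
      congr 1
      ext v
      rw [wedgeCast_zero_left]
      have h : dualizeForm (Forms.oneForm α) 0 = α := LinearMap.ext fun Y => rfl
      rw [h]
      rfl

/-- The derivative of a section of `A` along a section of `A*`, dual to the Koszul bracket. -/
def dualLie (α : Module.Dual R L) (X : L) : L :=
  S.bracket (π.sharp α) X + π.sharp (S.lieDer X α - S.dFun (α X))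

/-- On 1-forms the bracket is `[α, ·] = L_{π♯α} + ⟨dα, ·⟩`, and both terms have known commutators
with `i_X`. The section `dualLie π α X` is also the A-component of the deformed bracket of `α` and
`X`, which is how identities between forms become components of the Courant axioms. -/
theorem interior_koszulBracket_cov (α : Module.Dual R L) (X : L) (ξ : VForms R L R) :
    interior X (koszulBracket hS π (cov α) ξ) = koszulBracket hS π (cov α) (interior X ξ) -
      interior (dualLie (S := S) π α X) ξ := by
  have h1 : ∀ ξ, koszulBracket hS π (cov α) ξ =
      lie S (π.sharp α) ξ + pair π (diff hS (cov α)) ξ := fun ξ => by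
    rw [koszulBracket_apply, pair_cov, invol_of, map_smul, LinearMap.smul_apply, pair_cov,
      interior_diff]
    simp
    abel
  have h2 : interior X (diff hS (cov α)) = cov (S.lieDer X α - S.dFun (α X)) := by
    rw [interior_diff, interior_cov, diff_fn, lie_of, sub_eq_add_neg, ← of_neg, ← of_add]
    congr 1
    ext v
    simp [lieForm_apply, AnchoredBracket.lieDer, AnchoredBracket.dFun, sub_eq_add_neg]
  rw [h1, h1, map_add, interior_lie, interior_pair, h2, pair_cov,
    ((isHom_of (Forms.oneForm α)).diff hS).invol_eq, dualLie, interior_add_left]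
  simp
  abel

theorem koszulBracket_cov_cov (hS : ∀ X, S.bracket X X = 0) (α β : Module.Dual R L) :
    koszulBracket hS π (cov α) (cov β) = cov (S.koszul π α β) := by
  refine ext_interior ?_ fun X => ?_
  · have h1 := (isHom_of (Forms.oneForm α)).koszulBracket hS π (isHom_of (Forms.oneForm β))
      (n := 1) rfl
    rw [h1.apply_ne (by omega), of_apply_ne (by omega)]
  · rw [interior_koszulBracket_cov, interior_cov, interior_cov, interior_cov, koszulBracket_cov_fn,
      sub_eq_add_neg, ← of_neg, ← of_add]
    congr 1
    ext v
    simp only [AlternatingMap.add_apply, AlternatingMap.neg_apply,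
      AlternatingMap.constOfIsEmpty_apply, Function.const_apply, dualLie, map_add,
      π.skew (S.lieDer X α - S.dFun (α X)) β, LinearMap.sub_apply, AnchoredBracket.lieDer_apply,
      AnchoredBracket.dFun_apply, AnchoredBracket.koszul_apply, π.skew β α, map_neg,
      AnchoredBracket.bracket_skew hS X (π.sharp β)]
    ring

end Koszul

end VForms

namespace VForms

section GeneratorsArithmetic

variable {R : Type*} [CommRing R] {L : Type*} [AddCommGroup L] [Module R L]

theorem fn_add (f g : R) : fn (f + g) = (fn f + fn g : VForms R L R) := by
  rw [← of_add]; rfl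

theorem fn_neg (f : R) : fn (-f) = (-fn f : VForms R L R) := by
  rw [← of_neg]; rfl

theorem fn_sub (f g : R) : fn (f - g) = (fn f - fn g : VForms R L R) := by
  rw [sub_eq_add_neg, sub_eq_add_neg, fn_add, fn_neg]

theorem cov_add (α β : Module.Dual R L) : cov (α + β) = cov α + cov β := by
  rw [← of_add]; rfl

theorem IsDer.sq {D : VForms R L R → VForms R L R} (h : IsDer 1 D) : IsDer 2 fun P => D (D P) where
  add P Q := by rw [h.add, h.add]
  mul P Q := by
    simp only [h.mul, h.add, pow_one, h.invol, pow_two, Module.End.mul_apply, invol_invol]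
    simp
  invol P := by
    rw [h.invol, map_neg_one_pow_smul h.add, h.invol]
    simp

end GeneratorsArithmetic

/-! ### The graded Jacobi identity, reduced to functions and 1-forms. -/

section Jacobi

variable {R : Type*} [CommRing R] [Algebra ℝ R] {L : Type*} [AddCommGroup L] [Module R L]
  {S : AnchoredBracket R L} (hS : ∀ X, S.bracket X X = 0) (π : Bivector R L)

theorem exists_isHom_koszulBracket {p q : ℕ} {P Q : VForms R L R} (hP : IsHom p P)
    (hQ : IsHom q Q) : ∃ n, IsHom n (koszulBracket hS π P Q) ∧ Even (n + 1 + (p + q)) := by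
  rcases Nat.eq_zero_or_pos (p + q) with h | h
  · obtain ⟨rfl, rfl⟩ : p = 0 ∧ q = 0 := by omega
    obtain ⟨f, rfl⟩ := exists_fn hP
    obtain ⟨g, rfl⟩ := exists_fn hQ
    -- The bracket of two functions is zero, of nominal degree `-1`; the label `1` has the same
    -- parity.
    exact ⟨1, by rw [koszulBracket_fn_fn]; exact isHom_zero 1, ⟨1, rfl⟩⟩
  · exact ⟨p + q - 1, hP.koszulBracket hS π hQ (by omega), ⟨p + q, by omega⟩⟩

theorem neg_one_pow_mul_congr {a b : ℕ} (h : Even (a + b)) (c : ℕ) :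
    (-1 : R) ^ (a * c) = (-1 : R) ^ (b * c) := by
  rw [pow_mul, pow_mul]
  congr 1
  rcases Nat.even_or_odd a with ha | ha
  · rw [ha.neg_one_pow, ((Nat.even_add.mp h).mp ha).neg_one_pow]
  · have hb : Odd b := by
      rw [← Nat.not_even_iff_odd] at ha ⊢
      exact fun hb => ha ((Nat.even_add.mp h).mpr hb)
    rw [ha.neg_one_pow, hb.neg_one_pow]

theorem koszulBracket_koszulBracket_skew {p q t : ℕ} {P Q T : VForms R L R} (hP : IsHom p P)
    (hQ : IsHom q Q) (hT : IsHom t T) : koszulBracket hS π (koszulBracket hS π P Q) T =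
      -((-1 : R) ^ ((p + q) * (t + 1)) • koszulBracket hS π T (koszulBracket hS π P Q)) := by
  obtain ⟨n, hn, he⟩ := exists_isHom_koszulBracket hS π hP hQ
  rw [koszulBracket_skew hS π hn hT, neg_one_pow_mul_congr he]

/-- The Jacobiator of the Koszul bracket, on forms of degrees `p`, `q` and of any degree. -/
def jacobiator (p q : ℕ) (P Q T : VForms R L R) : VForms R L R :=
  koszulBracket hS π P (koszulBracket hS π Q T) - koszulBracket hS π (koszulBracket hS π P Q) T -
    (-1 : R) ^ ((p + 1) * (q + 1)) • koszulBracket hS π Q (koszulBracket hS π P T)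

/-- It is the graded commutator of `[P, ·]` and `[Q, ·]` minus `[[P, Q], ·]`. -/
theorem isDer_jacobiator {p q : ℕ} {P Q : VForms R L R} (hP : IsHom p P) (hQ : IsHom q Q) :
    IsDer (p + q) (jacobiator hS π p q P Q) := by
  obtain ⟨n, hn, he⟩ := exists_isHom_koszulBracket hS π hP hQ
  have h1 := (isDer_koszulBracket hS π hP).commutator (isDer_koszulBracket hS π hQ)
  have h2 := (isDer_koszulBracket hS π hn).congr_parity he
  have h3 := (h1.congr_parity (l := p + q) ⟨p + q + 1, by omega⟩).sub h2
  refine (congrArg (IsDer (p + q)) (funext fun T => ?_)).mp h3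
  rw [jacobiator]
  abel

theorem jacobiator_swap_left {p q : ℕ} {P Q : VForms R L R} (hP : IsHom p P) (hQ : IsHom q Q)
    (T : VForms R L R) : jacobiator hS π q p Q P T =
      -((-1 : R) ^ ((p + 1) * (q + 1)) • jacobiator hS π p q P Q T) := by
  rw [jacobiator, jacobiator, koszulBracket_skew hS π hQ hP, map_neg, LinearMap.neg_apply,
    koszulBracket_neg_one_pow_smul_left]
  rcases Nat.even_or_odd p with hp | hp <;> rcases Nat.even_or_odd q with hq | hq <;>
  simp [hp.neg_one_pow, hq.neg_one_pow, pow_succ, pow_mul, pow_add, mul_add, add_mul] <;> abel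

theorem jacobiator_swap_right {p q t : ℕ} {P Q T : VForms R L R} (hP : IsHom p P)
    (hQ : IsHom q Q) (hT : IsHom t T) : jacobiator hS π p t P T Q =
      -((-1 : R) ^ ((q + 1) * (t + 1)) • jacobiator hS π p q P Q T) := by
  rw [jacobiator, jacobiator, koszulBracket_skew hS π hT hQ, map_neg,
    koszulBracket_neg_one_pow_smul, koszulBracket_koszulBracket_skew hS π hP hT hQ,
    koszulBracket_koszulBracket_skew hS π hP hQ hT]
  rcases Nat.even_or_odd p with hp | hp <;> rcases Nat.even_or_odd q with hq | hq <;>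
  rcases Nat.even_or_odd t with ht | ht <;>
  simp [hp.neg_one_pow, hq.neg_one_pow, ht.neg_one_pow, pow_succ, pow_mul, pow_add, mul_add,
    add_mul] <;> abel

theorem isHom_le_one {p : ℕ} (hp : p ≤ 1) {P : VForms R L R} (hP : IsHom p P) :
    (p = 0 ∧ ∃ f, P = fn f) ∨ (p = 1 ∧ ∃ α, P = cov α) := by
  rcases Nat.le_one_iff_eq_zero_or_eq_one.mp hp with rfl | rfl
  · exact Or.inl ⟨rfl, exists_fn hP⟩
  · exact Or.inr ⟨rfl, exists_cov hP⟩

variable {hS π} in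
theorem jacobiator_generators
    (hanchor : ∀ α β f, S.anchor (π.sharp (S.koszul π α β)) f =
      S.anchor (π.sharp α) (S.anchor (π.sharp β) f) - S.anchor (π.sharp β) (S.anchor (π.sharp α) f))
    (hjacobi : ∀ α β γ, S.koszul π α (S.koszul π β γ) =
      S.koszul π (S.koszul π α β) γ + S.koszul π β (S.koszul π α γ))
    {p q t : ℕ} (hp : p ≤ 1) (hq : q ≤ 1) (ht : t ≤ 1) {P Q T : VForms R L R} (hP : IsHom p P)
    (hQ : IsHom q Q) (hT : IsHom t T) : jacobiator hS π p q P Q T = 0 := by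
  rcases isHom_le_one hp hP with ⟨rfl, f, rfl⟩ | ⟨rfl, α, rfl⟩ <;>
  rcases isHom_le_one hq hQ with ⟨rfl, g, rfl⟩ | ⟨rfl, β, rfl⟩ <;>
  rcases isHom_le_one ht hT with ⟨rfl, h, rfl⟩ | ⟨rfl, γ, rfl⟩ <;>
  simp only [jacobiator, koszulBracket_fn_fn, koszulBracket_cov_fn, koszulBracket_fn_cov,
    koszulBracket_cov_cov, map_neg, LinearMap.neg_apply, map_zero, LinearMap.zero_apply, hanchor,
    fn_sub]
  case inr.inr.inr => rw [hjacobi α β γ, cov_add]; simp [show (-1 : R) ^ 4 = 1 by norm_num]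
  case inr.inl.inr => simp; abel
  all_goals simp [show (-1 : R) ^ 4 = 1 by norm_num]

variable {hS π} in
-- Being a derivation in the last argument, the Jacobiator extends by zero from generators in that
-- argument. Graded skew-symmetry brings each of the other arguments to the last place, so three
-- extensions suffice.
theorem jacobiator_eq_zero (hL : LocallyFramed R L)
    (hanchor : ∀ α β f, S.anchor (π.sharp (S.koszul π α β)) f =
      S.anchor (π.sharp α) (S.anchor (π.sharp β) f) - S.anchor (π.sharp β) (S.anchor (π.sharp α) f))
    (hjacobi : ∀ α β γ, S.koszul π α (S.koszul π β γ) =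
      S.koszul π (S.koszul π α β) γ + S.koszul π β (S.koszul π α γ))
    {p q : ℕ} {P Q : VForms R L R} (hP : IsHom p P) (hQ : IsHom q Q) (T : VForms R L R) :
    jacobiator hS π p q P Q T = 0 := by
  have extend : ∀ {p q : ℕ} {P Q : VForms R L R}, IsHom p P → IsHom q Q →
      (∀ t T, t ≤ 1 → IsHom t T → jacobiator hS π p q P Q T = 0) →
      ∀ T, jacobiator hS π p q P Q T = 0 := fun hP hQ h T =>
    (isDer_jacobiator hS π hP hQ).eq_zero hL (fun f => h 0 _ zero_le_one (isHom_of _))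
      (fun α => h 1 _ le_rfl (isHom_of _)) T
  have h1 : ∀ {p q : ℕ} {P Q : VForms R L R}, p ≤ 1 → q ≤ 1 → IsHom p P → IsHom q Q →
      ∀ T, jacobiator hS π p q P Q T = 0 := fun hp hq hP hQ =>
    extend hP hQ fun t T ht hT => jacobiator_generators hanchor hjacobi hp hq ht hP hQ hT
  have h2 : ∀ {p q : ℕ} {P Q : VForms R L R}, p ≤ 1 → IsHom p P → IsHom q Q →
      ∀ T, jacobiator hS π p q P Q T = 0 := fun hp hP hQ =>
    extend hP hQ fun t T ht hT => by
      rw [jacobiator_swap_right hS π hP hT hQ, h1 hp ht hP hT, smul_zero, neg_zero]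
  refine extend hP hQ (fun t T ht hT => ?_) T
  rw [jacobiator_swap_right hS π hP hT hQ, jacobiator_swap_left hS π hT hP, h2 ht hT hP]
  simp

end Jacobi

/-! ### Derivations of the Koszul bracket and their squares. -/

section DerivationOfBracket

variable {R : Type*} [CommRing R] [Algebra ℝ R] {L : Type*} [AddCommGroup L] [Module R L]
  {S : AnchoredBracket R L} {hS : ∀ X, S.bracket X X = 0} {π : Bivector R L}

/-- The defect `G` is a derivation in `T` and graded skew in `P` and `T`, so it is determined by
generators. For two functions the bracket itself vanishes, which leaves the condition `h00`. -/
theorem derivation_koszulBracket (hL : LocallyFramed R L) {δ : VForms R L R → VForms R L R}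
    (hδ : IsDer 1 δ) (hhom : ∀ p P, IsHom p P → IsHom (p + 1) (δ P))
    (h00 : ∀ f g, koszulBracket hS π (δ (fn f)) (fn g) = koszulBracket hS π (fn f) (δ (fn g)))
    (h10 : ∀ α f, δ (koszulBracket hS π (cov α) (fn f)) =
      koszulBracket hS π (δ (cov α)) (fn f) + koszulBracket hS π (cov α) (δ (fn f)))
    (h11 : ∀ α β, δ (koszulBracket hS π (cov α) (cov β)) =
      koszulBracket hS π (δ (cov α)) (cov β) + koszulBracket hS π (cov α) (δ (cov β)))
    {p : ℕ} {P : VForms R L R} (hP : IsHom p P) (T : VForms R L R) :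
    δ (koszulBracket hS π P T) =
      koszulBracket hS π (δ P) T + (-1 : R) ^ (p + 1) • koszulBracket hS π P (δ T) := by
  let G : ℕ → VForms R L R → VForms R L R → VForms R L R := fun p P T =>
    δ (koszulBracket hS π P T) - koszulBracket hS π (δ P) T -
      (-1 : R) ^ (p + 1) • koszulBracket hS π P (δ T)
  have hG : ∀ {p : ℕ} {P : VForms R L R}, IsHom p P → IsDer (p + 1 + 1) (G p P) := by
    intro p P hP
    have h1 := hδ.commutator (isDer_koszulBracket hS π hP)
    have h2 := isDer_koszulBracket hS π (hhom p P hP)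
    rw [add_comm 1] at h1
    refine (congrArg (IsDer (p + 1 + 1)) (funext fun T => ?_)).mp (h1.sub h2)
    simp only [G, one_mul]
    abel
  have swap : ∀ {p q : ℕ} {P Q : VForms R L R}, IsHom p P → IsHom q Q →
      G q Q P = -((-1 : R) ^ ((p + 1) * (q + 1)) • G p P Q) := by
    intro p q P Q hP hQ
    simp only [G]
    rw [koszulBracket_skew hS π hQ hP, koszulBracket_skew hS π (hhom q Q hQ) hP,
      koszulBracket_skew hS π hQ (hhom p P hP), hδ.map_neg, map_neg_one_pow_smul hδ.add]
    rcases Nat.even_or_odd p with hp | hp <;> rcases Nat.even_or_odd q with hq | hq <;>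
    simp [hp.neg_one_pow, hq.neg_one_pow, pow_succ, pow_mul, pow_add, mul_add, add_mul] <;> abel
  have extend : ∀ {p : ℕ} {P : VForms R L R}, IsHom p P →
      (∀ t T, t ≤ 1 → IsHom t T → G p P T = 0) → ∀ T, G p P T = 0 := fun hP h T =>
    (hG hP).eq_zero hL (fun f => h 0 _ zero_le_one (isHom_of _))
      (fun α => h 1 _ le_rfl (isHom_of _)) T
  have gen10 : ∀ α f, G 1 (cov α) (fn f) = 0 := fun α f => by simp [G, h10]
  have gen : ∀ {p t : ℕ} {P T : VForms R L R}, p ≤ 1 → t ≤ 1 → IsHom p P → IsHom t T →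
      G p P T = 0 := by
    intro p t P T hp ht hP hT
    rcases isHom_le_one hp hP with ⟨rfl, f, rfl⟩ | ⟨rfl, α, rfl⟩ <;>
    rcases isHom_le_one ht hT with ⟨rfl, g, rfl⟩ | ⟨rfl, β, rfl⟩
    · simp [G, koszulBracket_fn_fn, hδ.map_zero, h00]
    · rw [swap (isHom_of _) (isHom_of _), gen10]; simp
    · exact gen10 α g
    · simp [G, h11]
  have h1 : ∀ {p : ℕ} {P : VForms R L R}, p ≤ 1 → IsHom p P → ∀ T, G p P T = 0 :=
    fun hp hP => extend hP fun t T ht hT => gen hp ht hP hT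
  have h2 : G p P T = 0 := extend hP (fun t T ht hT => by
    rw [swap hT hP, h1 ht hT, smul_zero, neg_zero]) T
  have h3 : δ (koszulBracket hS π P T) - (koszulBracket hS π (δ P) T +
      (-1 : R) ^ (p + 1) • koszulBracket hS π P (δ T)) = 0 := by
    rw [← h2]; simp only [G]; abel
  exact sub_eq_zero.mp h3

/-- The square of an odd derivation is an even derivation, and `[φ, ·]` is even because `φ` has
degree 3; it is enough to compare them on generators. -/
theorem derivation_sq (hL : LocallyFramed R L) {δ : VForms R L R → VForms R L R}
    (hδ : IsDer 1 δ) {φ : VForms R L R} (hφ : IsHom 3 φ)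
    (h0 : ∀ f, δ (δ (fn f)) = koszulBracket hS π φ (fn f))
    (h1 : ∀ α, δ (δ (cov α)) = koszulBracket hS π φ (cov α)) (T : VForms R L R) :
    δ (δ T) = koszulBracket hS π φ T := by
  have h := hδ.sq.sub ((isDer_koszulBracket hS π hφ).congr_parity (l := 2) ⟨3, rfl⟩)
  exact sub_eq_zero.mp (h.eq_zero hL (fun f => sub_eq_zero.mpr (h0 f))
    (fun α => sub_eq_zero.mpr (h1 α)) T)

end DerivationOfBracket

end VForms

namespace AnchoredBracket

/-! ### The big bracket of two structures and its behaviour under deformation. -/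

section Commute

variable {R : Type*} [CommRing R] [Algebra ℝ R] {P : Type*} [AddCommGroup P] [Module R P]

theorem add_anchor (S T : AnchoredBracket R P) (x : P) :
    (S + T).anchor x = S.anchor x + T.anchor x := rfl

theorem add_bracket (S T : AnchoredBracket R P) (x y : P) :
    (S + T).bracket x y = S.bracket x y + T.bracket x y := rfl

/-- The polarization of the Jacobiator of a bracket. -/
def mixedJacobiator (U V : AnchoredBracket R P) (x y z : P) : P :=
  U.bracket x (V.bracket y z) + V.bracket x (U.bracket y z) -
    U.bracket (V.bracket x y) z - V.bracket (U.bracket x y) z -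
    U.bracket y (V.bracket x z) - V.bracket y (U.bracket x z)

/-- The polarization of the failure of the anchor to preserve brackets. -/
def anchorDefect (U V : AnchoredBracket R P) (x y : P) : Derivation ℝ R R :=
  U.anchor (V.bracket x y) + V.anchor (U.bracket x y) - ⁅U.anchor x, V.anchor y⁆ -
    ⁅V.anchor x, U.anchor y⁆

/-- The big bracket `{U, V}` vanishes. -/
structure Commutes (U V : AnchoredBracket R P) : Prop where
  jacobiator : ∀ x y z, mixedJacobiator U V x y z = 0
  anchor : ∀ x y, anchorDefect U V x y = 0

theorem mixedJacobiator_comm (U V : AnchoredBracket R P) (x y z : P) :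
    mixedJacobiator U V x y z = mixedJacobiator V U x y z := by
  simp only [mixedJacobiator]; abel

theorem anchorDefect_comm (U V : AnchoredBracket R P) (x y : P) :
    anchorDefect U V x y = anchorDefect V U x y := by
  simp only [anchorDefect]; abel

theorem Commutes.symm {U V : AnchoredBracket R P} (h : Commutes U V) : Commutes V U :=
  ⟨fun x y z => by rw [mixedJacobiator_comm, h.jacobiator],
    fun x y => by rw [anchorDefect_comm, h.anchor]⟩

theorem mixedJacobiator_add_left (U U' V : AnchoredBracket R P) (x y z : P) :
    mixedJacobiator (U + U') V x y z = mixedJacobiator U V x y z + mixedJacobiator U' V x y z := by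
  simp only [mixedJacobiator, add_bracket, map_add, AddMonoidHom.add_apply]; abel

theorem anchorDefect_add_left (U U' V : AnchoredBracket R P) (x y : P) :
    anchorDefect (U + U') V x y = anchorDefect U V x y + anchorDefect U' V x y := by
  simp only [anchorDefect, add_bracket, add_anchor, map_add, add_lie, lie_add]; abel

theorem Commutes.add_left {U U' V : AnchoredBracket R P} (h : Commutes U V) (h' : Commutes U' V) :
    Commutes (U + U') V :=
  ⟨fun x y z => by rw [mixedJacobiator_add_left, h.jacobiator, h'.jacobiator, add_zero],
    fun x y => by rw [anchorDefect_add_left, h.anchor, h'.anchor, add_zero]⟩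

theorem Commutes.add_right {U V V' : AnchoredBracket R P} (h : Commutes U V)
    (h' : Commutes U V') : Commutes U (V + V') :=
  (h.symm.add_left h'.symm).symm

/-- This is the rule `{J, {U, V}} = {{J, U}, V} + {U, {J, V}}`: the right-hand side is the action of
`J` on the three arguments and on the value. -/
theorem mixedJacobiator_deform (U V : AnchoredBracket R P) (J : Module.End R P) (x y z : P) :
    mixedJacobiator (U.deform J) V x y z + mixedJacobiator U (V.deform J) x y z =
      mixedJacobiator U V (J x) y z + mixedJacobiator U V x (J y) z +
        mixedJacobiator U V x y (J z) - J (mixedJacobiator U V x y z) := by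
  simp only [mixedJacobiator, deform_bracket, map_add, map_sub, AddMonoidHom.add_apply,
    AddMonoidHom.sub_apply]
  abel

theorem anchorDefect_deform (U V : AnchoredBracket R P) (J : Module.End R P) (x y : P) :
    anchorDefect (U.deform J) V x y + anchorDefect U (V.deform J) x y =
      anchorDefect U V (J x) y + anchorDefect U V x (J y) := by
  simp only [anchorDefect, deform_bracket, deform_anchor, map_add, map_sub]
  abel

theorem eq_zero_of_add_self (R : Type*) [CommRing R] [Algebra ℝ R] {P : Type*} [AddCommGroup P]
    [Module R P] {x : P} (h : x + x = 0) : x = 0 := by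
  have h2 : (algebraMap ℝ R 2⁻¹) * 2 = 1 := by
    rw [← map_ofNat (algebraMap ℝ R) 2, ← map_mul]; norm_num
  rw [← one_smul R x, ← h2, mul_smul, two_smul, h, smul_zero]

/-- `2 {S_J, S} = {J, {S, S}} = 0`. -/
theorem Commutes.deform_self {S : AnchoredBracket R P} (h : Commutes S S) (J : Module.End R P) :
    Commutes (S.deform J) S := by
  constructor
  · intro x y z
    have h1 := mixedJacobiator_deform S S J x y z
    rw [mixedJacobiator_comm S (S.deform J)] at h1
    simp only [h.jacobiator, map_zero, add_zero, sub_zero] at h1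
    exact eq_zero_of_add_self R h1
  · intro x y
    have h1 := anchorDefect_deform S S J x y
    rw [anchorDefect_comm S (S.deform J)] at h1
    simp only [h.anchor, add_zero] at h1
    exact eq_zero_of_add_self R h1

/-- Applying `{J, ·}` to `{S_J, S} = 0` gives `{S_JJ, S} + {S_J, S_J} = 0`. -/
theorem Commutes.deform_deform {S : AnchoredBracket R P} {J : Module.End R P} (h : Commutes S S)
    (h' : Commutes ((S.deform J).deform J) S) : Commutes (S.deform J) (S.deform J) := by
  have h0 := h.deform_self J
  constructor
  · intro x y z
    have h1 := mixedJacobiator_deform (S.deform J) S J x y z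
    simpa only [h0.jacobiator, h'.jacobiator, map_zero, add_zero, zero_add, sub_zero] using h1
  · intro x y
    have h1 := anchorDefect_deform (S.deform J) S J x y
    simpa only [h0.anchor, h'.anchor, add_zero, zero_add] using h1

theorem Commutes.jacobi {S : AnchoredBracket R P} (h : Commutes S S) (x y z : P) :
    S.bracket x (S.bracket y z) = S.bracket (S.bracket x y) z + S.bracket y (S.bracket x z) := by
  refine sub_eq_zero.mp (eq_zero_of_add_self R ?_)
  rw [← h.jacobiator x y z, mixedJacobiator]
  abel

theorem Commutes.anchor_bracket {S : AnchoredBracket R P} (h : Commutes S S) (x y : P) :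
    S.anchor (S.bracket x y) = ⁅S.anchor x, S.anchor y⁆ := by
  refine sub_eq_zero.mp (eq_zero_of_add_self R ?_)
  rw [← h.anchor x y, anchorDefect]
  abel

end Commute

/-! ### Brackets compatible with the canonical pairing. -/

section Pairing

variable {R : Type*} [CommRing R] {L : Type*} [AddCommGroup L] [Module R L]

theorem pairing_comm (x y : L × Module.Dual R L) : pairing x y = pairing y x := by
  simp only [pairing]; ring

theorem pairing_add_left (x y z : L × Module.Dual R L) :
    pairing (x + y) z = pairing x z + pairing y z := by
  simp [pairing]; ring

theorem pairing_sub_left (x y z : L × Module.Dual R L) :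
    pairing (x - y) z = pairing x z - pairing y z := by
  simp [pairing]; ring

theorem pairing_add_right (x y z : L × Module.Dual R L) :
    pairing x (y + z) = pairing x y + pairing x z := by
  simp [pairing]; ring

theorem pairing_sub_right (x y z : L × Module.Dual R L) :
    pairing x (y - z) = pairing x y - pairing x z := by
  simp [pairing]; ring

end Pairing

section PairingCompatible

variable {R : Type*} [CommRing R] [Algebra ℝ R] {L : Type*} [AddCommGroup L] [Module R L]

/-- The compatibility of an anchored bracket on `A ⊕ A*` with the canonical pairing. -/
structure IsPairingCompatible (S : AnchoredBracket R (L × Module.Dual R L)) : Prop where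
  pairing_invariant : ∀ x y z,
    S.anchor x (pairing y z) = pairing (S.bracket x y) z + pairing y (S.bracket x z)
  bracket_symm : ∀ x y z,
    pairing (S.bracket x y + S.bracket y x) z = S.anchor z (pairing x y)

variable {S T : AnchoredBracket R (L × Module.Dual R L)}

theorem IsPairingCompatible.add (hS : S.IsPairingCompatible) (hT : T.IsPairingCompatible) :
    (S + T).IsPairingCompatible where
  pairing_invariant x y z := by
    simp only [add_anchor, add_bracket, Derivation.add_apply, hS.pairing_invariant,
      hT.pairing_invariant, pairing_add_left, pairing_add_right]
    ring
  bracket_symm x y z := by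
    simp only [add_anchor, add_bracket, Derivation.add_apply, ← hS.bracket_symm,
      ← hT.bracket_symm, pairing_add_left]
    ring

theorem IsPairingCompatible.deform (hS : S.IsPairingCompatible)
    {J : Module.End R (L × Module.Dual R L)} (hJ : ∀ x y, pairing (J x) y = -pairing x (J y)) :
    (S.deform J).IsPairingCompatible where
  pairing_invariant x y z := by
    have h1 := hS.pairing_invariant x (J y) z
    have h2 := hS.pairing_invariant x y (J z)
    rw [hJ, map_neg] at h1
    simp only [deform_anchor, deform_bracket, hS.pairing_invariant, pairing_add_left,
      pairing_add_right, pairing_sub_left, pairing_sub_right, hJ (S.bracket x y)]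
    rw [pairing_comm y (J _), hJ, pairing_comm _ (J y)]
    linear_combination h1 + h2
  bracket_symm x y z := by
    have h1 := hS.bracket_symm (J x) y z
    have h2 := hS.bracket_symm x (J y) z
    have h3 := hS.bracket_symm x y (J z)
    rw [hJ, map_neg] at h1
    simp only [pairing_add_left] at h1 h2 h3
    simp only [deform_anchor, deform_bracket, pairing_add_left, pairing_sub_left, hJ (S.bracket _ _)]
    linear_combination h1 + h2 + h3

/-- Compatible brackets with equal anchors agree if they agree on `A` and on `A*`. -/
theorem IsPairingCompatible.ext (hsep : ∀ X : L, (∀ α : Module.Dual R L, α X = 0) → X = 0)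
    (hS : S.IsPairingCompatible) (hT : T.IsPairingCompatible) (hanchor : S.anchor = T.anchor)
    (h₁ : ∀ X Y : L, S.bracket (X, 0) (Y, 0) = T.bracket (X, 0) (Y, 0))
    (h₂ : ∀ α β : Module.Dual R L, S.bracket (0, α) (0, β) = T.bracket (0, α) (0, β)) :
    S = T := by
  have nondeg : ∀ x y : L × Module.Dual R L, (∀ X, pairing x (X, 0) = pairing y (X, 0)) →
      (∀ α, pairing x (0, α) = pairing y (0, α)) → x = y := by
    intro x y hX hα
    refine Prod.ext (sub_eq_zero.mp (hsep _ fun α => ?_)) (LinearMap.ext fun X => ?_)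
    · have := hα α
      simp only [pairing, map_zero, add_zero] at this
      rw [map_sub, this, sub_self]
    · simpa [pairing] using hX X
  have e : ∀ x : L × Module.Dual R L, x = (x.1, 0) + (0, x.2) := fun x => by simp
  have h₃ : ∀ (X : L) (β : Module.Dual R L),
      S.bracket (X, 0) (0, β) = T.bracket (X, 0) (0, β) := by
    intro X β
    -- Invariance of the pairing expresses the A*-component of a mixed bracket through the bracket
    -- on `A`; symmetry followed by invariance expresses its A-component through the bracket on
    -- `A*`.
    refine nondeg _ _ (fun Z => ?_) (fun γ => ?_)
    · have a := hS.pairing_invariant (X, 0) (0, β) (Z, 0)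
      have b := hT.pairing_invariant (X, 0) (0, β) (Z, 0)
      rw [hanchor, b, h₁] at a
      linear_combination -a
    · have a := hS.pairing_invariant (0, β) (X, 0) (0, γ)
      have b := hT.pairing_invariant (0, β) (X, 0) (0, γ)
      have c := hS.bracket_symm (X, 0) (0, β) (0, γ)
      have d := hT.bracket_symm (X, 0) (0, β) (0, γ)
      rw [hanchor, b, h₂] at a
      rw [hanchor, ← d, pairing_add_left, pairing_add_left] at c
      linear_combination c + a
  have h₄ : ∀ (X : L) (β : Module.Dual R L),
      S.bracket (0, β) (X, 0) = T.bracket (0, β) (X, 0) := by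
    intro X β
    have key : ∀ z, pairing (S.bracket (0, β) (X, 0)) z = pairing (T.bracket (0, β) (X, 0)) z := by
      intro z
      have c := hS.bracket_symm (X, 0) (0, β) z
      have d := hT.bracket_symm (X, 0) (0, β) z
      rw [hanchor, ← d, pairing_add_left, pairing_add_left, h₃] at c
      linear_combination c
    exact nondeg _ _ (fun _ => key _) (fun _ => key _)
  refine AnchoredBracket.ext hanchor (AddMonoidHom.ext fun x => AddMonoidHom.ext fun y => ?_)
  rw [e x, e y]
  simp only [map_add, AddMonoidHom.add_apply, h₁, h₂, h₃, h₄]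

end PairingCompatible

end AnchoredBracket

namespace AnchoredBracket

/-! ### The differential in low degrees, and the Hamiltonians `μ` and `H`. -/

section Differentials

variable {R : Type*} [CommRing R] [Algebra ℝ R] {L : Type*} [AddCommGroup L] [Module R L]

theorem d_two_form (S : AnchoredBracket R L) (w : (Fin 2 → L) → R) (X Y Z : L) :
    S.d w ![X, Y, Z] = S.anchor X (w ![Y, Z]) - w ![S.bracket X Y, Z] - w ![Y, S.bracket X Z] -
      (S.anchor Y (w ![X, Z]) - w ![X, S.bracket Y Z]) + S.anchor Z (w ![X, Y]) := by
  have h1 : Finset.Ioi (0 : Fin 3) = {1, 2} := by decide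
  have h2 : Finset.Ioi (1 : Fin 3) = {2} := by decide
  have h3 : Finset.Ioi (2 : Fin 3) = ∅ := by decide
  rw [d, Fin.sum_univ_three, h1, h2, h3, Finset.sum_pair (by decide), Finset.sum_singleton,
    Finset.sum_empty]
  have a0 : ∀ u : Fin 3 → L, (fun k => u (Fin.succAbove 0 k)) = ![u 1, u 2] := fun u => by
    ext i; fin_cases i <;> rfl
  have a1 : ∀ u : Fin 3 → L, (fun k => u (Fin.succAbove 1 k)) = ![u 0, u 2] := fun u => by
    ext i; fin_cases i <;> rfl
  have a2 : ∀ u : Fin 3 → L, (fun k => u (Fin.succAbove 2 k)) = ![u 0, u 1] := fun u => by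
    ext i; fin_cases i <;> rfl
  simp only [a0, a1, a2]
  simp [Function.update]
  ring

theorem d_three_form (S : AnchoredBracket R L) (w : (Fin 3 → L) → R) (X Y Z W : L) :
    S.d w ![X, Y, Z, W] =
      S.anchor X (w ![Y, Z, W]) - w ![S.bracket X Y, Z, W] - w ![Y, S.bracket X Z, W] -
        w ![Y, Z, S.bracket X W] -
      (S.anchor Y (w ![X, Z, W]) - w ![X, S.bracket Y Z, W] - w ![X, Z, S.bracket Y W]) +
      (S.anchor Z (w ![X, Y, W]) - w ![X, Y, S.bracket Z W]) - S.anchor W (w ![X, Y, Z]) := by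
  have h1 : Finset.Ioi (0 : Fin 4) = {1, 2, 3} := by decide
  have h2 : Finset.Ioi (1 : Fin 4) = {2, 3} := by decide
  have h3 : Finset.Ioi (2 : Fin 4) = {3} := by decide
  have h4 : Finset.Ioi (3 : Fin 4) = ∅ := by decide
  rw [d, Fin.sum_univ_four, h1, h2, h3, h4, Finset.sum_pair (by decide), Finset.sum_singleton,
    Finset.sum_empty, Finset.sum_insert (by decide), Finset.sum_pair (by decide)]
  have a0 : ∀ u : Fin 4 → L, (fun k => u (Fin.succAbove 0 k)) = ![u 1, u 2, u 3] := fun u => by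
    ext i; fin_cases i <;> rfl
  have a1 : ∀ u : Fin 4 → L, (fun k => u (Fin.succAbove 1 k)) = ![u 0, u 2, u 3] := fun u => by
    ext i; fin_cases i <;> rfl
  have a2 : ∀ u : Fin 4 → L, (fun k => u (Fin.succAbove 2 k)) = ![u 0, u 1, u 3] := fun u => by
    ext i; fin_cases i <;> rfl
  have a3 : ∀ u : Fin 4 → L, (fun k => u (Fin.succAbove 3 k)) = ![u 0, u 1, u 2] := fun u => by
    ext i; fin_cases i <;> rfl
  simp only [a0, a1, a2, a3]
  simp [Function.update]
  ring

end Differentials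

section Swap

variable {R : Type*} [CommRing R] {L : Type*} [AddCommGroup L] [Module R L]

theorem contract₂_swap_left (H : L [⋀^Fin 3]→ₗ[R] R) (X Y Z : L) :
    contract₂ H Y X Z = -contract₂ H X Y Z := by
  have h := H.map_swap ![X, Y, Z] (i := 0) (j := 1) (by decide)
  rw [contract₂_apply, contract₂_apply, ← h]
  congr 1; ext i; fin_cases i <;> rfl

theorem contract₂_swap_right (H : L [⋀^Fin 3]→ₗ[R] R) (X Y Z : L) :
    contract₂ H X Z Y = -contract₂ H X Y Z := by
  have h := H.map_swap ![X, Y, Z] (i := 1) (j := 2) (by decide)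
  rw [contract₂_apply, contract₂_apply, ← h]
  congr 1; ext i; fin_cases i <;> rfl

theorem flat_swap (σ : L [⋀^Fin 2]→ₗ[R] R) (X Y : L) : flat σ Y X = -flat σ X Y := by
  have h := σ.map_swap ![X, Y] (i := 0) (j := 1) (by decide)
  rw [flat_apply, flat_apply, ← h]
  congr 1; ext i; fin_cases i <;> rfl

end Swap

section Hamiltonians

variable {R : Type*} [CommRing R] [Algebra ℝ R] {L : Type*} [AddCommGroup L] [Module R L]

/-- The bracket `(X + α, Y + β) ↦ -t(X, Y)` with zero anchor. -/
def background (t : L →ₗ[R] L →ₗ[R] Module.Dual R L) :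
    AnchoredBracket R (L × Module.Dual R L) where
  anchor := 0
  bracket := AddMonoidHom.mk' (fun x => AddMonoidHom.mk' (fun y => (0, -t x.1 y.1))
      (fun y z => by
        ext Z
        · simp
        · simp only [Prod.fst_add, map_add, Prod.snd_add, LinearMap.add_apply, LinearMap.neg_apply]
          ring))
    (fun x y => by
      ext z Z
      · simp
      · simp only [Prod.fst_add, map_add, Prod.snd_add, LinearMap.add_apply, LinearMap.neg_apply,
          AddMonoidHom.mk'_apply, AddMonoidHom.add_apply]
        ring)
  leibniz x y f := by ext Z <;> simp

theorem background_bracket (t : L →ₗ[R] L →ₗ[R] Module.Dual R L) (x y : L × Module.Dual R L) :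
    (background t).bracket x y = (0, -t x.1 y.1) := rfl

theorem background_anchor (t : L →ₗ[R] L →ₗ[R] Module.Dual R L) (x : L × Module.Dual R L) :
    (background t).anchor x = 0 := rfl

theorem backgroundHamiltonian_eq (H : L [⋀^Fin 3]→ₗ[R] R) :
    backgroundHamiltonian H = background (contract₂ H) := rfl

theorem isPairingCompatible_background {t : L →ₗ[R] L →ₗ[R] Module.Dual R L}
    (hl : ∀ X Y Z, t Y X Z = -t X Y Z) (hr : ∀ X Y Z, t X Z Y = -t X Y Z) :
    (background t).IsPairingCompatible where
  pairing_invariant x y z := by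
    simp [background_bracket, background_anchor, pairing, hr x.1 y.1 z.1]
  bracket_symm x y z := by
    simp [background_bracket, background_anchor, pairing, hl x.1 y.1]

theorem hamiltonian_bracket (A : LieAlgebroid R L) (x y : L × Module.Dual R L) :
    A.hamiltonian.bracket x y = (A.bracket x.1 y.1,
        A.lieDer x.1 y.2 - A.lieDer y.1 x.2 + A.dFun (x.2 y.1)) := rfl

theorem hamiltonian_anchor (A : LieAlgebroid R L) (x : L × Module.Dual R L) :
    A.hamiltonian.anchor x = A.anchor x.1 := rfl

theorem isPairingCompatible_hamiltonian (A : LieAlgebroid R L) :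
    A.hamiltonian.IsPairingCompatible where
  pairing_invariant x y z := by
    simp only [hamiltonian_bracket, hamiltonian_anchor, pairing, LinearMap.add_apply,
      LinearMap.sub_apply, lieDer_apply, dFun_apply, map_add, A.bracket_swap y.1 x.1,
      A.bracket_swap z.1 x.1, A.bracket_swap z.1 y.1, map_neg]
    ring
  bracket_symm x y z := by
    simp only [hamiltonian_bracket, hamiltonian_anchor, pairing, LinearMap.add_apply,
      LinearMap.sub_apply, lieDer_apply, dFun_apply, map_add, A.bracket_swap y.1 x.1,
      Prod.fst_add, Prod.snd_add, map_neg]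
    ring

/-- The A-component is the Jacobi identity of the Lie algebroid; the A*-component, evaluated on `W`,
combines the Jacobi identities of `W` with each pair among the A-components of `x`, `y`, `z`. -/
theorem commutes_hamiltonian (A : LieAlgebroid R L) : Commutes A.hamiltonian A.hamiltonian where
  jacobiator x y z := by
    have key : A.hamiltonian.bracket x (A.hamiltonian.bracket y z) =
        A.hamiltonian.bracket (A.hamiltonian.bracket x y) z +
          A.hamiltonian.bracket y (A.hamiltonian.bracket x z) := by
      ext W
      · exact A.jacobi _ _ _
      · simp only [hamiltonian_bracket, LinearMap.add_apply, Prod.snd_add,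
          LinearMap.sub_apply, lieDer_apply, dFun_apply, map_add, map_sub, A.anchor_bracket,
          Derivation.commutator_apply]
        have h1 := congrArg z.2 (A.jacobi x.1 y.1 W)
        have h2 := congrArg y.2 (A.jacobi x.1 z.1 W)
        have h3 := congrArg x.2 (A.jacobi y.1 z.1 W)
        simp only [map_add] at h1 h2 h3
        linear_combination -h1 + h2 - h3
    simp only [mixedJacobiator, key]
    abel
  anchor x y := by
    simp only [anchorDefect, hamiltonian_anchor, hamiltonian_bracket, A.anchor_bracket]
    abel

theorem commutes_background (t t' : L →ₗ[R] L →ₗ[R] Module.Dual R L) :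
    Commutes (background t) (background t') where
  jacobiator x y z := by
    simp [mixedJacobiator, background_bracket, Prod.ext_iff]
  anchor x y := by
    simp [anchorDefect, background_anchor]

/-- Up to sign the mixed Jacobiator is `dt` evaluated on the A-components and `W`: bracketing with
`μ` is the differential. -/
theorem commutes_background_hamiltonian (A : LieAlgebroid R L)
    {t : L →ₗ[R] L →ₗ[R] Module.Dual R L}
    (hd : ∀ v, A.d (fun u : Fin 3 → L => t (u 0) (u 1) (u 2)) v = 0) :
    Commutes (background t) A.hamiltonian where
  jacobiator x y z := by
    ext W
    · simp [mixedJacobiator, background_bracket, hamiltonian_bracket]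
    · have h := hd ![x.1, y.1, z.1, W]
      rw [d_three_form] at h
      simp only [mixedJacobiator, background_bracket, hamiltonian_bracket, LinearMap.add_apply,
        Prod.snd_add, Prod.snd_sub, LinearMap.sub_apply, lieDer_apply, dFun_apply, map_zero,
        LinearMap.zero_apply, AddMonoidHom.zero_apply, Prod.snd_zero, LinearMap.neg_apply, map_neg, Derivation.coe_zero,
        Pi.zero_apply]
      simp only [Matrix.cons_val] at h
      linear_combination -h
  anchor x y := by
    simp [anchorDefect, background_anchor, background_bracket, hamiltonian_anchor]

end Hamiltonians

end AnchoredBracket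

namespace AnchoredBracket

/-! ### The deformed structure `S_J` and its blocks. -/

section Deformed

variable {R : Type*} [CommRing R] [Algebra ℝ R] {L : Type*} [AddCommGroup L] [Module R L]
  (A : LieAlgebroid R L) (π : Bivector R L) (N : Module.End R L)
  (σ : L [⋀^Fin 2]→ₗ[R] R) (H : L [⋀^Fin 3]→ₗ[R] R)

theorem lieDer_zero_right (S : AnchoredBracket R L) (X : L) : S.lieDer X 0 = 0 := by
  ext Z; simp [lieDer_apply]

theorem lieDer_zero_left (S : AnchoredBracket R L) (α : Module.Dual R L) : S.lieDer 0 α = 0 := by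
  ext Z; simp [lieDer_apply]

theorem dFun_zero (S : AnchoredBracket R L) : S.dFun 0 = 0 := by
  ext Z; simp [dFun_apply]

/-- The Courant structure `μ + H`. -/
def twisted : AnchoredBracket R (L × Module.Dual R L) :=
  A.hamiltonian + backgroundHamiltonian H

/-- The endomorphism `J = π + N + σ`. -/
def quasiEnd : Module.End R (L × Module.Dual R L) :=
  π.toEnd + tensorToEnd N + twoFormToEnd σ

/-- The deformed structure `S_J`. -/
abbrev deformedTwisted : AnchoredBracket R (L × Module.Dual R L) :=
  (twisted A H).deform (quasiEnd π N σ)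

theorem quasiEnd_apply (x : L × Module.Dual R L) :
    quasiEnd π N σ x = (N x.1 + π.sharp x.2, flat σ x.1 - N.dualMap x.2) := by
  ext Z
  · simp [quasiEnd, Bivector.toEnd, tensorToEnd, twoFormToEnd, add_comm]
  · simp [quasiEnd, Bivector.toEnd, tensorToEnd, twoFormToEnd]; ring

theorem twisted_anchor (x : L × Module.Dual R L) : (twisted A H).anchor x = A.anchor x.1 := by
  simp [twisted, add_anchor, hamiltonian_anchor, backgroundHamiltonian_eq, background_anchor]

theorem twisted_bracket (x y : L × Module.Dual R L) :
    (twisted A H).bracket x y = (A.bracket x.1 y.1,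
        A.lieDer x.1 y.2 - A.lieDer y.1 x.2 + A.dFun (x.2 y.1) - contract₂ H x.1 y.1) := by
  simp [twisted, add_bracket, hamiltonian_bracket, backgroundHamiltonian_eq, background_bracket,
    sub_eq_add_neg]

theorem deformedTwisted_anchor (x : L × Module.Dual R L) :
    (deformedTwisted A π N σ H).anchor x = A.anchor (N x.1 + π.sharp x.2) := by
  rw [deform_anchor, twisted_anchor, quasiEnd_apply]

theorem deformedTwisted_fst (x y : L × Module.Dual R L) :
    ((deformedTwisted A π N σ H).bracket x y).1 =
      A.bracket (N x.1 + π.sharp x.2) y.1 + A.bracket x.1 (N y.1 + π.sharp y.2) -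
        N (A.bracket x.1 y.1) - π.sharp
          (A.lieDer x.1 y.2 - A.lieDer y.1 x.2 + A.dFun (x.2 y.1) - contract₂ H x.1 y.1) := by
  simp only [deform_bracket, twisted_bracket, quasiEnd_apply, Prod.fst_add, Prod.fst_sub]
  abel

theorem deformedTwisted_snd (x y : L × Module.Dual R L) (Z : L) :
    ((deformedTwisted A π N σ H).bracket x y).2 Z =
      (A.lieDer (N x.1 + π.sharp x.2) y.2 Z - A.lieDer y.1 (flat σ x.1 - N.dualMap x.2) Z +
        A.anchor Z (flat σ x.1 y.1 - x.2 (N y.1)) -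
        contract₂ H (N x.1 + π.sharp x.2) y.1 Z) +
      (A.lieDer x.1 (flat σ y.1 - N.dualMap y.2) Z - A.lieDer (N y.1 + π.sharp y.2) x.2 Z +
        A.anchor Z (x.2 (N y.1 + π.sharp y.2)) - contract₂ H x.1 (N y.1 + π.sharp y.2) Z) -
      flat σ (A.bracket x.1 y.1) Z + (A.lieDer x.1 y.2 (N Z) - A.lieDer y.1 x.2 (N Z) +
        A.anchor (N Z) (x.2 y.1) - contract₂ H x.1 y.1 (N Z)) := by
  simp only [deform_bracket, twisted_bracket, quasiEnd_apply, Prod.snd_add, Prod.snd_sub,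
    LinearMap.add_apply, LinearMap.sub_apply, LinearMap.dualMap_apply, dFun_apply]
  ring

theorem pairing_quasiEnd (x y : L × Module.Dual R L) :
    pairing (quasiEnd π N σ x) y = -pairing x (quasiEnd π N σ y) := by
  simp only [pairing, quasiEnd_apply, map_add, LinearMap.sub_apply, LinearMap.dualMap_apply,
    π.skew x.2 y.2, flat_swap σ x.1 y.1]
  ring

theorem isPairingCompatible_twisted : (twisted A H).IsPairingCompatible :=
  (isPairingCompatible_hamiltonian A).add
    (isPairingCompatible_background (contract₂_swap_left H) (contract₂_swap_right H))

theorem isPairingCompatible_deformedTwisted : (deformedTwisted A π N σ H).IsPairingCompatible :=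
  (isPairingCompatible_twisted A H).deform (pairing_quasiEnd π N σ)

variable {H} in
theorem commutes_twisted (hH : ∀ v, A.d H v = 0) : Commutes (twisted A H) (twisted A H) := by
  have h1 : Commutes (backgroundHamiltonian H) A.hamiltonian :=
    commutes_background_hamiltonian A fun v => by
      refine Eq.trans ?_ (hH v)
      congr 1
      funext u
      rw [contract₂_apply]
      congr 1
      ext i; fin_cases i <;> rfl
  have h2 : Commutes (backgroundHamiltonian H) (backgroundHamiltonian H) :=
    commutes_background _ _
  exact ((commutes_hamiltonian A).add_left h1).add_right (h1.symm.add_left h2)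

/-- The brackets of `μ + H` vanish on pairs of covectors, so only the part `π♯` of `J`, which leaves
`A*`, contributes. -/
theorem deformedTwisted_dual (α β : Module.Dual R L) :
    (deformedTwisted A π N σ H).bracket (0, α) (0, β) = (0, A.koszul π α β) := by
  ext Z
  · rw [deformedTwisted_fst]; simp [lieDer_zero_left, dFun_zero]
  · rw [deformedTwisted_snd, koszul_apply, π.skew α β]; simp [lieDer_apply]; ring

/-- The 3-form `H(NX, Y, Z) + H(X, NY, Z) + H(X, Y, NZ)`, as a bilinear map with values in
1-forms. -/
def insertion (t : L →ₗ[R] L →ₗ[R] Module.Dual R L) : L →ₗ[R] L →ₗ[R] Module.Dual R L :=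
  t ∘ₗ N + t.compl₂ N + t.compr₂ N.dualMap

theorem insertion_apply (t : L →ₗ[R] L →ₗ[R] Module.Dual R L) (X Y Z : L) :
    insertion N t X Y Z = t (N X) Y Z + t X (N Y) Z + t X Y (N Z) := rfl

variable {A π N σ H} {ψ : L [⋀^Fin 3]→ₗ[R] R}

theorem dFlat (hψ : ∀ v, ψ v = -A.d σ v) (X Y Z : L) :
    -contract₂ ψ X Y Z = A.anchor X (flat σ Y Z) - flat σ (A.bracket X Y) Z -
      flat σ Y (A.bracket X Z) - (A.anchor Y (flat σ X Z) - flat σ X (A.bracket Y Z)) +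
      A.anchor Z (flat σ X Y) := by
  rw [contract₂_apply, hψ, d_two_form, neg_neg]
  rfl

theorem deformedTwisted_vec_fst (X Y : L) :
    ((deformedTwisted A π N σ H).bracket (X, 0) (Y, 0)).1 =
      (A.deform N).bracket X Y + π.sharp (contract₂ H X Y) := by
  rw [deformedTwisted_fst, deform_bracket]
  simp [lieDer_zero_right, dFun_zero]

theorem deformedTwisted_vec_snd (hψ : ∀ v, ψ v = -A.d σ v) (X Y Z : L) :
    ((deformedTwisted A π N σ H).bracket (X, 0) (Y, 0)).2 Z =
      -contract₂ ψ X Y Z - insertion N (contract₂ H) X Y Z := by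
  rw [deformedTwisted_snd, dFlat hψ, insertion_apply]
  simp [lieDer_apply]
  ring

end Deformed

end AnchoredBracket

namespace AnchoredBracket

/-! ### The candidate for the double deformation and the closedness of its background. -/

section DoublyDeformed

variable {R : Type*} [CommRing R] [Algebra ℝ R] {L : Type*} [AddCommGroup L] [Module R L]

/-- Paired with a covector `γ`, the claim is the vanishing of half of `[π, π]_SN(α, β, γ)`;
covectors separate sections. -/
theorem sharp_koszul (hsep : ∀ X : L, (∀ α : Module.Dual R L, α X = 0) → X = 0)
    {A : LieAlgebroid R L} {π : Bivector R L} (hπ : ∀ α β γ, A.schoutenSq π α β γ = 0)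
    (α β : Module.Dual R L) :
    π.sharp (A.koszul π α β) = A.bracket (π.sharp α) (π.sharp β) := by
  refine sub_eq_zero.mp (hsep _ fun γ => ?_)
  have h := hπ α β γ
  rw [schoutenSq, two_mul] at h
  replace h := eq_zero_of_add_self R h
  rw [map_sub, π.skew, koszul_apply]
  simp only [Bivector.eval] at h
  rw [A.bracket_swap (π.sharp α) (π.sharp γ), map_neg, π.skew β γ, map_neg] at h
  linear_combination -h

variable (π : Bivector R L) (N : Module.End R L) (σ : L [⋀^Fin 2]→ₗ[R] R)

/-- The endomorphism `N² + π♯ σ♭`. -/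
def squareEnd : Module.End R L := N ∘ₗ N + π.sharp ∘ₗ flat σ

/-- The skew endomorphism given by `N² + π♯ σ♭` and the 2-form `-(σ(NX, Y) + σ(X, NY))`. -/
def quasiSquare : Module.End R (L × Module.Dual R L) :=
  (squareEnd π N σ ∘ₗ LinearMap.fst R L (Module.Dual R L)).prod
    (-((squareEnd π N σ).dualMap ∘ₗ LinearMap.snd R L (Module.Dual R L)) -
      (flat σ ∘ₗ N + N.dualMap ∘ₗ flat σ) ∘ₗ LinearMap.fst R L (Module.Dual R L))

theorem quasiSquare_apply (x : L × Module.Dual R L) : quasiSquare π N σ x =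
    (squareEnd π N σ x.1, -(squareEnd π N σ).dualMap x.2 -
      (flat σ (N x.1) + N.dualMap (flat σ x.1))) := rfl

theorem squareEnd_apply (X : L) : squareEnd π N σ X = N (N X) + π.sharp (flat σ X) := rfl

theorem pairing_quasiSquare (x y : L × Module.Dual R L) :
    pairing (quasiSquare π N σ x) y = -pairing x (quasiSquare π N σ y) := by
  simp only [pairing, quasiSquare_apply, LinearMap.sub_apply, LinearMap.dualMap_apply,
    LinearMap.neg_apply, LinearMap.add_apply, flat_swap σ x.1 (N y.1), flat_swap σ (N x.1) y.1]
  ring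

/-- The 3-form `H(NX, NY, Z) + H(X, NY, NZ) + H(NX, Y, NZ)`, as a bilinear map with values in
1-forms. -/
def doubleInsertion (t : L →ₗ[R] L →ₗ[R] Module.Dual R L) : L →ₗ[R] L →ₗ[R] Module.Dual R L :=
  t.compl₁₂ N N + (t.compl₂ N).compr₂ N.dualMap + (t ∘ₗ N).compr₂ N.dualMap

theorem doubleInsertion_apply (t : L →ₗ[R] L →ₗ[R] Module.Dual R L) (X Y Z : L) :
    doubleInsertion N t X Y Z = t (N X) (N Y) Z + t X (N Y) (N Z) + t (N X) Y (N Z) := rfl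

variable (ψ H : L [⋀^Fin 3]→ₗ[R] R)

/-- The background of the doubly deformed structure. -/
def doubleBackground : L →ₗ[R] L →ₗ[R] Module.Dual R L :=
  (doubleInsertion N (contract₂ H) + insertion N (contract₂ ψ)) +
    (doubleInsertion N (contract₂ H) + insertion N (contract₂ ψ))

theorem doubleBackground_apply (X Y Z : L) : doubleBackground N ψ H X Y Z =
    (doubleInsertion N (contract₂ H) X Y Z + insertion N (contract₂ ψ) X Y Z) +
      (doubleInsertion N (contract₂ H) X Y Z + insertion N (contract₂ ψ) X Y Z) := rfl

theorem calH_eq : calH N H = fun u => doubleInsertion N (contract₂ H) (u 0) (u 1) (u 2) := by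
  funext u
  rw [calH, doubleInsertion_apply, ← contract₂_apply, ← contract₂_apply, ← contract₂_apply,
    contract₂_swap_right H (N (u 1)) (u 0) (N (u 2)), contract₂_swap_left H (u 0) (N (u 1)),
    contract₂_swap_left H (N (u 0)) (N (u 2)), contract₂_swap_right H (N (u 0)) (u 1)]
  ring

theorem doubleBackground_swap_left (X Y Z : L) :
    doubleBackground N ψ H Y X Z = -doubleBackground N ψ H X Y Z := by
  simp only [doubleBackground_apply, doubleInsertion_apply, insertion_apply,
    contract₂_swap_left _ X Y, contract₂_swap_left _ (N X) Y, contract₂_swap_left _ X (N Y),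
    contract₂_swap_left _ (N X) (N Y)]
  ring

theorem doubleBackground_swap_right (X Y Z : L) :
    doubleBackground N ψ H X Z Y = -doubleBackground N ψ H X Y Z := by
  simp only [doubleBackground_apply, doubleInsertion_apply, insertion_apply,
    contract₂_swap_right _ _ Y Z, contract₂_swap_right _ _ (N Y) Z,
    contract₂_swap_right _ _ Y (N Z), contract₂_swap_right _ _ (N Y) (N Z)]
  ring

variable {A : LieAlgebroid R L} {π N σ ψ H}

/-- `d_N = i_N d - d i_N`: the four instances of `dψ = 0` with `N` in one slot add up to the term
`i_N dψ`. -/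
theorem d_insertion (hψ : ∀ v, A.d ψ v = 0) (v : Fin 4 → L) :
    A.d (fun u : Fin 3 → L => insertion N (contract₂ ψ) (u 0) (u 1) (u 2)) v =
      -(A.deform N).d ψ v := by
  have e : v = ![v 0, v 1, v 2, v 3] := by ext i; fin_cases i <;> rfl
  generalize v 0 = X, v 1 = Y, v 2 = Z, v 3 = W at e
  subst e
  have a := hψ ![N X, Y, Z, W]
  have b := hψ ![X, N Y, Z, W]
  have c := hψ ![X, Y, N Z, W]
  have d := hψ ![X, Y, Z, N W]
  rw [d_three_form] at a b c d ⊢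
  rw [d_three_form]
  simp only [deform_anchor, deform_bracket, Matrix.cons_val, ← contract₂_apply, insertion_apply,
    map_add, map_sub, LinearMap.add_apply, LinearMap.sub_apply] at a b c d ⊢
  obtain ⟨f, hf⟩ : ∃ f : L → L → L → R, ∀ X Y Z, contract₂ ψ X Y Z = f X Y Z := ⟨_, fun _ _ _ => rfl⟩
  simp only [hf] at a b c d ⊢
  linear_combination a + b + c + d

/-- The contributions `d𝓗 = d_N ψ` and `d(i_N ψ) = -d_N ψ` cancel. -/
theorem d_doubleBackground (h : IsPoissonQuasiNijenhuis A π N ψ H) (v : Fin 4 → L) :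
    A.d (fun u : Fin 3 → L => doubleBackground N ψ H (u 0) (u 1) (u 2)) v = 0 := by
  have h1 := h.d_psi v
  have h2 := d_insertion (N := N) h.closed_psi v
  rw [calH_eq] at h1
  have h3 : A.d (fun u : Fin 3 → L => doubleBackground N ψ H (u 0) (u 1) (u 2)) v =
      2 * (A.d (fun u : Fin 3 → L => doubleInsertion N (contract₂ H) (u 0) (u 1) (u 2)) v +
        A.d (fun u : Fin 3 → L => insertion N (contract₂ ψ) (u 0) (u 1) (u 2)) v) := by
    simp only [d, doubleBackground_apply, map_add, two_mul,
      ← Finset.sum_add_distrib, ← mul_add]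
    refine Finset.sum_congr rfl fun i _ => ?_
    simp only [Finset.sum_add_distrib]
    ring
  rw [h3, h2, ← h1]
  ring

end DoublyDeformed

end AnchoredBracket

namespace AnchoredBracket

/-! ### The identity `S_JJ = {K, S} + T`, block by block, and the Courant axioms for `S_J`. -/

section Courant

variable {R : Type*} [CommRing R] [Algebra ℝ R] {L : Type*} [AddCommGroup L] [Module R L]
  {A : LieAlgebroid R L} {π : Bivector R L} {N : Module.End R L} {σ : L [⋀^Fin 2]→ₗ[R] R}
  {ψ H : L [⋀^Fin 3]→ₗ[R] R}

theorem lieDer_neg_right (S : AnchoredBracket R L) (X : L) (α : Module.Dual R L) :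
    S.lieDer X (-α) = -S.lieDer X α := by
  ext Z; simp [lieDer_apply]; ring

theorem dFun_neg (S : AnchoredBracket R L) (f : R) : S.dFun (-f) = -S.dFun f := by
  ext Z; simp [dFun_apply]

theorem dFlat_form (hψ : ∀ v, ψ v = -A.d σ v) (X Y : L) :
    contract₂ ψ X Y = A.lieDer Y (flat σ X) - A.lieDer X (flat σ Y) - A.dFun (flat σ X Y) +
      flat σ (A.bracket X Y) := by
  ext Z
  have h := dFlat hψ X Y Z
  simp only [LinearMap.add_apply, LinearMap.sub_apply, lieDer_apply, dFun_apply]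
  linear_combination -h

/-- The difference of the two sides is twice the torsion identity. Of the two terms `π♯ψ`, one comes
from the Lie derivatives of `σ♭`, the other from applying `π♯` to the A*-component of the
`S_J`-bracket. -/
theorem doublyDeformed_vec_fst (h : IsPoissonQuasiNijenhuis A π N ψ H)
    (hψ : ∀ v, ψ v = -A.d σ v) (X Y : L) :
    (((deformedTwisted A π N σ H).deform (quasiEnd π N σ)).bracket (X, 0) (Y, 0)).1 =
      (((twisted A H).deform (quasiSquare π N σ)).bracket (X, 0) (Y, 0)).1 := by
  have hc : ∀ α, N (π.sharp α) = π.sharp (N.dualMap α) := fun α => LinearMap.congr_fun h.comm α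
  have h1 := h.torsion X Y
  have h2 := congrArg π.sharp (dFlat_form hψ X Y)
  have h3 : ((deformedTwisted A π N σ H).bracket (X, 0) (Y, 0)).2 =
      -contract₂ ψ X Y - insertion N (contract₂ H) X Y := by
    ext Z; exact deformedTwisted_vec_snd hψ X Y Z
  have h4 : insertion N (contract₂ H) X Y = contract₂ H (N X) Y + contract₂ H X (N Y) +
    N.dualMap (contract₂ H X Y) := rfl
  have h5 : contract₂ H (N Y) X = -contract₂ H X (N Y) := by
    ext Z; exact contract₂_swap_left H _ _ _
  rw [deform_bracket (deformedTwisted A π N σ H), deform_bracket (twisted A H) (quasiSquare π N σ)]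
  simp only [Prod.fst_add, Prod.fst_sub]
  rw [quasiEnd_apply _ _ _ ((deformedTwisted A π N σ H).bracket (X, 0) (Y, 0)), h3, h4]
  simp only [deformedTwisted_fst, twisted_bracket, quasiEnd_apply, quasiSquare_apply,
    squareEnd_apply, map_zero, sub_zero, add_zero, neg_zero, lieDer_zero_right,
    LinearMap.zero_apply, dFun_zero, map_add, map_sub, map_neg, AddMonoidHom.add_apply, hc]
  rw [torsion, deform_bracket, h5] at h1
  simp only [map_add, map_sub, map_neg] at h1 h2
  linear_combination (norm := module) (2 : R) • h1 - h2

/-- Apart from `ψ = -dσ`, used with `N` inserted in each slot, no condition intervenes: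
`doubleBackground` is precisely what `{K, S}` leaves over. -/
theorem doublyDeformed_vec_snd (hψ : ∀ v, ψ v = -A.d σ v) (X Y Z : L) :
    (((deformedTwisted A π N σ H).deform (quasiEnd π N σ)).bracket (X, 0) (Y, 0)).2 Z =
      (((twisted A H).deform (quasiSquare π N σ)).bracket (X, 0) (Y, 0)).2 Z -
        doubleBackground N ψ H X Y Z := by
  have h1 := dFlat hψ (N X) Y Z
  have h2 := dFlat hψ X (N Y) Z
  have h3 := dFlat hψ X Y (N Z)
  rw [deform_bracket (deformedTwisted A π N σ H), deform_bracket (twisted A H) (quasiSquare π N σ)]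
  simp only [Prod.snd_add, Prod.snd_sub, LinearMap.add_apply, LinearMap.sub_apply]
  rw [quasiEnd_apply _ _ _ ((deformedTwisted A π N σ H).bracket (X, 0) (Y, 0)),
    deformedTwisted_vec_fst]
  simp only [LinearMap.sub_apply, LinearMap.dualMap_apply, deformedTwisted_vec_snd hψ]
  simp only [deformedTwisted_snd]
  simp only [twisted_bracket, quasiEnd_apply, quasiSquare_apply, squareEnd_apply, map_zero, sub_zero, add_zero, neg_zero, lieDer_apply, zero_sub,
    LinearMap.zero_apply, map_add, map_sub, map_neg, AddMonoidHom.add_apply, LinearMap.add_apply,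
    LinearMap.sub_apply, LinearMap.neg_apply, LinearMap.dualMap_apply, dFun_apply, deform_bracket,
    doubleBackground_apply, doubleInsertion_apply, insertion_apply]
  rw [flat_swap σ Z (π.sharp (contract₂ H X Y)), π.skew]
  linear_combination -2 * h1 - 2 * h2 - h3

/-- The component is the defect of `π♯` as a morphism from the Koszul bracket to the bracket of `A`.
-/
theorem doublyDeformed_dual_fst (hsep : ∀ X : L, (∀ α : Module.Dual R L, α X = 0) → X = 0)
    (h : IsPoissonQuasiNijenhuis A π N ψ H) (α β : Module.Dual R L) :
    (((deformedTwisted A π N σ H).deform (quasiEnd π N σ)).bracket (0, α) (0, β)).1 = 0 := by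
  have h1 := sharp_koszul hsep h.poisson α β
  have h2 : A.dFun (α (π.sharp β)) = -A.dFun (β (π.sharp α)) := by rw [π.skew β α, dFun_neg]
  rw [deform_bracket (deformedTwisted A π N σ H)]
  simp only [Prod.fst_add, Prod.fst_sub]
  rw [deformedTwisted_dual, quasiEnd_apply _ _ _ (0, A.koszul π α β)]
  simp only [deformedTwisted_fst, quasiEnd_apply, map_zero, sub_zero, add_zero, zero_add, zero_sub,
    AddMonoidHom.zero_apply, lieDer_zero_left, LinearMap.zero_apply, dFun_zero, map_add, map_neg,
    h2]
  rw [h1]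
  rw [koszul] at h1
  simp only [Bivector.eval, map_sub] at h1
  linear_combination (norm := module) -h1

/-- This is the concomitant condition. Its factor 2 matches the two terms `H(π♯α, π♯β, ·)` produced
by `[Jα, β]_J` and `[α, Jβ]_J`. -/
theorem doublyDeformed_dual_snd (h : IsPoissonQuasiNijenhuis A π N ψ H) (α β : Module.Dual R L)
    (Z : L) :
    (((deformedTwisted A π N σ H).deform (quasiEnd π N σ)).bracket (0, α) (0, β)).2 Z = 0 := by
  have hc : ∀ α, N (π.sharp α) = π.sharp (N.dualMap α) := fun α => LinearMap.congr_fun h.comm α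
  have h1 := LinearMap.congr_fun (h.concomitant α β) Z
  rw [deform_bracket (deformedTwisted A π N σ H)]
  simp only [Prod.snd_add, Prod.snd_sub, LinearMap.add_apply, LinearMap.sub_apply]
  rw [deformedTwisted_dual, quasiEnd_apply _ _ _ (0, A.koszul π α β)]
  rw [concomitant] at h1
  simp only [deformedTwisted_snd]
  simp only [quasiEnd_apply, map_zero, sub_zero, add_zero, zero_add, zero_sub,
    AddMonoidHom.zero_apply, lieDer_apply, LinearMap.zero_apply, map_add, map_sub, koszul_apply,
    LinearMap.dualMap_apply, map_neg, hc, deform_bracket, deform_anchor, LinearMap.sub_apply,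
    LinearMap.add_apply, LinearMap.neg_apply, LinearMap.smul_apply, add_neg_cancel,
    Derivation.coe_zero, Pi.zero_apply] at h1 ⊢
  rw [π.skew β α, π.skew (N.dualMap β) α, LinearMap.dualMap_apply, hc, map_neg, map_neg]
  linear_combination h1

theorem deform_deformedTwisted (hsep : ∀ X : L, (∀ α : Module.Dual R L, α X = 0) → X = 0)
    (h : IsPoissonQuasiNijenhuis A π N ψ H) (hψ : ∀ v, ψ v = -A.d σ v) :
    (deformedTwisted A π N σ H).deform (quasiEnd π N σ) =
      (twisted A H).deform (quasiSquare π N σ) + background (doubleBackground N ψ H) := by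
  have hc : ∀ α, N (π.sharp α) = π.sharp (N.dualMap α) := fun α => LinearMap.congr_fun h.comm α
  refine ((isPairingCompatible_deformedTwisted A π N σ H).deform (pairing_quasiEnd π N σ)).ext hsep
    (((isPairingCompatible_twisted A H).deform (pairing_quasiSquare π N σ)).add
      (isPairingCompatible_background (doubleBackground_swap_left N ψ H)
        (doubleBackground_swap_right N ψ H))) (LinearMap.ext fun x => ?_) (fun X Y => ?_)
    (fun α β => ?_)
  -- Equality of the anchors: the covector terms `Nπ♯ - π♯ ᵗN` cancel.
  · rw [deform_anchor, deformedTwisted_anchor, add_anchor, deform_anchor, twisted_anchor,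
      background_anchor, quasiEnd_apply, quasiSquare_apply, squareEnd_apply, add_zero]
    congr 1
    simp only [map_add, map_sub, hc]
    abel
  · rw [add_bracket, background_bracket]
    refine Prod.ext ?_ (LinearMap.ext fun Z => ?_)
    · rw [doublyDeformed_vec_fst h hψ, Prod.fst_add, add_zero]
    · rw [doublyDeformed_vec_snd hψ, Prod.snd_add, LinearMap.add_apply, LinearMap.neg_apply,
        sub_eq_add_neg]
  · rw [add_bracket, background_bracket, deform_bracket (twisted A H)]
    refine Prod.ext ?_ (LinearMap.ext fun Z => ?_)
    · rw [doublyDeformed_dual_fst hsep h]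
      simp [twisted_bracket, quasiSquare_apply, lieDer_zero_left, dFun_zero]
    · rw [doublyDeformed_dual_snd h]
      simp [twisted_bracket, quasiSquare_apply, lieDer_zero_left, dFun_zero]

theorem isCourant_deformedTwisted (hsep : ∀ X : L, (∀ α : Module.Dual R L, α X = 0) → X = 0)
    (h : IsPoissonQuasiNijenhuis A π N ψ H) (hψ : ∀ v, ψ v = -A.d σ v) :
    IsCourant (deformedTwisted A π N σ H) := by
  have h1 := commutes_twisted A h.closed_H
  have h2 : Commutes (background (doubleBackground N ψ H)) (twisted A H) :=
    (commutes_background_hamiltonian A (d_doubleBackground h)).add_right (commutes_background _ _)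
  have h3 : Commutes ((deformedTwisted A π N σ H).deform (quasiEnd π N σ)) (twisted A H) := by
    rw [deform_deformedTwisted hsep h hψ]
    exact (h1.deform_self _).add_left h2
  have h4 := h1.deform_deform h3
  have h5 := isPairingCompatible_deformedTwisted A π N σ H
  exact ⟨h5.pairing_invariant, h5.bracket_symm, h4.jacobi, h4.anchor_bracket⟩

end Courant

end AnchoredBracket

/-! ### The data of the quasi-bialgebroid: 3-forms from contractions, the quasi-bracket on `A`, the
dual bracket. -/

section OfContraction

variable {R : Type*} [CommRing R] [Algebra ℝ R] {L : Type*} [AddCommGroup L] [Module R L]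

/-- The 3-form with given totally skew contractions. -/
def AlternatingMap.ofContraction (t : L →ₗ[R] L →ₗ[R] Module.Dual R L)
    (hl : ∀ X Y Z, t Y X Z = -t X Y Z) (hr : ∀ X Y Z, t X Z Y = -t X Y Z) :
    L [⋀^Fin 3]→ₗ[R] R :=
  { MultilinearMap.mk' (fun v : Fin 3 → L => t (v 0) (v 1) (v 2))
      (fun v i X Y => by fin_cases i <;> simp [Function.update])
      (fun v i f X => by fin_cases i <;> simp [Function.update]) with
    map_eq_zero_of_eq' := fun v i j hv hij => by
      have h01 : ∀ X Z, t X X Z = 0 := fun X Z =>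
        AnchoredBracket.eq_zero_of_add_self R (add_eq_zero_iff_eq_neg.mpr (hl X X Z))
      have h12 : ∀ X Z, t X Z Z = 0 := fun X Z =>
        AnchoredBracket.eq_zero_of_add_self R (add_eq_zero_iff_eq_neg.mpr (hr X Z Z))
      have h02 : ∀ X Z, t X Z X = 0 := fun X Z => by rw [hr X X Z, h01, neg_zero]
      change t (v 0) (v 1) (v 2) = 0
      have h : v 0 = v 1 ∨ v 0 = v 2 ∨ v 1 = v 2 := by
        fin_cases i <;> fin_cases j <;>
        first
        | exact absurd rfl hij
        | exact Or.inl hv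
        | exact Or.inl hv.symm
        | exact Or.inr (Or.inl hv)
        | exact Or.inr (Or.inl hv.symm)
        | exact Or.inr (Or.inr hv)
        | exact Or.inr (Or.inr hv.symm)
      rcases h with h | h | h
      · rw [h, h01]
      · rw [h, h02]
      · rw [h, h12] }

end OfContraction

namespace VForms

variable {R : Type*} [CommRing R] [Algebra ℝ R] {L : Type*} [AddCommGroup L] [Module R L]
  {S : AnchoredBracket R L} {hS : ∀ X, S.bracket X X = 0} {π : Bivector R L}

theorem IsHom.ext_interior {p : ℕ} {ξ η : VForms R L R} (hξ : IsHom (p + 1) ξ)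
    (hη : IsHom (p + 1) η) (h : ∀ X, VForms.interior X ξ = VForms.interior X η) : ξ = η :=
  VForms.ext_interior ((hξ.apply_ne p.succ_ne_zero.symm).trans (hη.apply_ne p.succ_ne_zero.symm).symm) h

theorem cov_neg (α : Module.Dual R L) : (cov (-α) : VForms R L R) = -cov α := by
  rw [cov, cov, ← of_neg]
  congr 1

theorem cov_sub (α β : Module.Dual R L) : (cov (α - β) : VForms R L R) = cov α - cov β := by
  rw [sub_eq_add_neg, cov_add, cov_neg, sub_eq_add_neg]

theorem lie_cov (X : L) (α : Module.Dual R L) : lie S X (cov α) = cov (S.lieDer X α) := by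
  rw [lie_of]
  congr 1
  ext v
  simp [lieForm_apply, AnchoredBracket.lieDer_apply]

theorem interior_diff_cov (X : L) (α : Module.Dual R L) :
    interior X (diff hS (cov α)) = cov (S.lieDer X α - S.dFun (α X)) := by
  rw [interior_diff, interior_cov, diff_fn, lie_cov, cov_sub]

theorem interior_interior_three (φ : L [⋀^Fin 3]→ₗ[R] R) (X Y : L) :
    interior Y (interior X (of φ)) = cov (contract₂ φ X Y) := by
  rw [interior_of_succ, interior_of_succ]
  congr 1
  ext v
  rw [AlternatingMap.ofSubsingleton_apply_apply, contract₂_apply]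
  simp only [AlternatingMap.curryLeft_apply_apply]
  congr 1
  ext i; fin_cases i <;> rfl

theorem koszulBracket_fn (f : R) (ξ : VForms R L R) :
    koszulBracket hS π (fn f) ξ = interior (π.sharp (S.dFun f)) ξ := by
  rw [koszulBracket_apply, pair_zero_left π (isHom_of _), diff_fn, pair_cov,
    pair_zero_left π (isHom_of (Forms.zeroForm f)).invol]
  simp

end VForms

namespace AnchoredBracket

open VForms

variable {R : Type*} [CommRing R] [Algebra ℝ R] {L : Type*} [AddCommGroup L] [Module R L]

section Structure

variable (A : LieAlgebroid R L) (π : Bivector R L) (N : Module.End R L)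
  (H ψ : L [⋀^Fin 3]→ₗ[R] R)

/-- The bracket `[X, Y]_N + π♯ H(X, Y, ·)` on `A`, with anchor `ρ ∘ N`. -/
def quasiBracket : AnchoredBracket R L where
  anchor := A.anchor ∘ₗ N
  bracket := AddMonoidHom.mk' (fun X => AddMonoidHom.mk'
      (fun Y => (A.deform N).bracket X Y + π.sharp (contract₂ H X Y))
      (fun Y Z => by simp only [map_add]; abel))
    (fun X Y => by
      ext Z
      simp only [map_add, AddMonoidHom.add_apply, LinearMap.add_apply, AddMonoidHom.mk'_apply]
      abel)
  leibniz X Y f := by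
    simp only [AddMonoidHom.mk'_apply, (A.deform N).leibniz, map_smul, smul_add]
    rw [deform_anchor, LinearMap.comp_apply]
    abel

theorem quasiBracket_bracket (X Y : L) : (quasiBracket A π N H).bracket X Y =
    (A.deform N).bracket X Y + π.sharp (contract₂ H X Y) := rfl

theorem quasiBracket_anchor (X : L) : (quasiBracket A π N H).anchor X = A.anchor (N X) := rfl

theorem quasiBracket_self (X : L) : (quasiBracket A π N H).bracket X X = 0 := by
  have h : contract₂ H X X = 0 := by
    ext Z
    exact H.map_eq_zero_of_eq ![X, X, Z] (i := 0) (j := 1) rfl (by decide)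
  rw [quasiBracket_bracket, deform_bracket, h, map_zero, A.bracket_self, A.bracket_swap X (N X)]
  simp

/-- The 3-form `-ψ(X, Y, Z) - H(NX, Y, Z) - H(X, NY, Z) - H(X, Y, NZ)`. -/
def quasiForm : L [⋀^Fin 3]→ₗ[R] R :=
  -ψ - AlternatingMap.ofContraction (insertion N (contract₂ H))
    (fun X Y Z => by
      simp only [insertion_apply, contract₂_swap_left _ X Y, contract₂_swap_left _ (N X) Y,
        contract₂_swap_left _ X (N Y)]
      ring)
    (fun X Y Z => by
      simp only [insertion_apply, contract₂_swap_right _ _ Y Z, contract₂_swap_right _ _ (N Y) Z,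
        contract₂_swap_right _ _ Y (N Z)]
      ring)

/-- The Koszul bracket on `A*`, with anchor `ρ ∘ π♯`. -/
def dualBracket : AnchoredBracket R (Module.Dual R L) where
  anchor := A.anchor ∘ₗ π.sharp
  bracket := AddMonoidHom.mk' (fun α => AddMonoidHom.mk' (fun β => A.koszul π α β)
      (fun β γ => by
        ext Z
        simp only [koszul_apply, map_add, LinearMap.add_apply, AddMonoidHom.add_apply,
          Derivation.add_apply]
        ring))
    (fun α β => by
      ext γ Z
      simp only [koszul_apply, map_add, LinearMap.add_apply, AddMonoidHom.add_apply,
        AddMonoidHom.mk'_apply, Derivation.add_apply]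
      ring)
  leibniz α β f := by
    ext Z
    have h : A.bracket (f • π.sharp β) Z = f • A.bracket (π.sharp β) Z -
        A.anchor Z f • π.sharp β := by
      rw [A.bracket_swap Z, A.leibniz, A.bracket_swap (π.sharp β) Z]; module
    simp only [AddMonoidHom.mk'_apply, koszul_apply, map_smul, LinearMap.smul_apply,
      LinearMap.add_apply, smul_eq_mul, Derivation.leibniz, Derivation.smul_apply, h, map_sub,
      LinearMap.comp_apply, π.skew α β]
    ring

theorem dualBracket_bracket (α β : Module.Dual R L) :
    (dualBracket A π).bracket α β = A.koszul π α β := rfl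

end Structure

section Components

variable {A : LieAlgebroid R L} {π : Bivector R L} {N : Module.End R L}
  {σ : L [⋀^Fin 2]→ₗ[R] R} {H ψ : L [⋀^Fin 3]→ₗ[R] R}

theorem deformedTwisted_vec (hψ : ∀ v, ψ v = -A.d σ v) (X Y : L) :
    (deformedTwisted A π N σ H).bracket (X, 0) (Y, 0) =
      ((quasiBracket A π N H).bracket X Y, contract₂ (quasiForm N H ψ) X Y) :=
  Prod.ext (deformedTwisted_vec_fst X Y)
    (LinearMap.ext fun Z => deformedTwisted_vec_snd hψ X Y Z)

/-- The mixed bracket contains both structures: its A-part is dual to the Koszul operator `[α, ·]`,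
its A*-part is `-i_X δα`. Mixed components of the Courant axioms are therefore relations between
`[α, ·]` and `δ`. -/
theorem deformedTwisted_dual_vec (α : Module.Dual R L) (X : L) :
    (deformedTwisted A π N σ H).bracket (0, α) (X, 0) = (dualLie (S := A.toAnchoredBracket) π α X,
      (quasiBracket A π N H).dFun (α X) - (quasiBracket A π N H).lieDer X α) := by
  refine Prod.ext ?_ (LinearMap.ext fun Z => ?_)
  · rw [deformedTwisted_fst, dualLie]
    simp only [map_zero, zero_add, AddMonoidHom.zero_apply, add_zero, lieDer_zero_right, zero_sub,
      LinearMap.zero_apply, sub_zero, map_add, map_sub, map_neg]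
    abel
  · rw [deformedTwisted_snd]
    simp only [map_zero, zero_add, AddMonoidHom.zero_apply, add_zero, lieDer_apply, zero_sub,
      LinearMap.zero_apply, sub_zero, map_add, map_sub, map_neg, LinearMap.sub_apply,
      quasiBracket_anchor, dFun_apply, quasiBracket_bracket, deform_bracket, LinearMap.neg_apply,
      LinearMap.dualMap_apply, Derivation.coe_zero, Pi.zero_apply, π.skew (contract₂ H X Z) α]
    have h := contract₂_swap_left H X (π.sharp α) Z
    have h' := contract₂_swap_right H X (π.sharp α) Z
    linear_combination -h + h'

theorem deformedTwisted_vec_dual (X : L) (α : Module.Dual R L) :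
    ((deformedTwisted A π N σ H).bracket (X, 0) (0, α)).2 =
      (quasiBracket A π N H).lieDer X α := by
  refine LinearMap.ext fun Z => ?_
  rw [deformedTwisted_snd]
  simp only [map_zero, zero_add, AddMonoidHom.zero_apply, add_zero, lieDer_apply, zero_sub,
    LinearMap.zero_apply, sub_zero, map_add, map_sub, map_neg, quasiBracket_anchor, quasiBracket_bracket, deform_bracket, LinearMap.neg_apply,
    LinearMap.dualMap_apply, Derivation.coe_zero, Pi.zero_apply,
    π.skew (contract₂ H X Z) α]
  linear_combination -contract₂_swap_right H X (π.sharp α) Z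

end Components

end AnchoredBracket

namespace AnchoredBracket

open VForms

/-! ### The quasi-bialgebroid identities on functions and 1-forms, from the Courant axioms. -/

section QuasiBialgebroid

variable {R : Type*} [CommRing R] [Algebra ℝ R] {L : Type*} [AddCommGroup L] [Module R L]
  {A : LieAlgebroid R L} {π : Bivector R L} {N : Module.End R L}
  {σ : L [⋀^Fin 2]→ₗ[R] R} {H ψ : L [⋀^Fin 3]→ₗ[R] R}

local notation "δ_" => diff (quasiBracket_self A π N H)
local notation "B_" => koszulBracket A.bracket_self π
local notation "S_" => quasiBracket A π N H
local notation "φ_" => quasiForm N H ψ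

theorem koszulBracket_two (ξ : VForms R L R) (hξ : IsHom 2 ξ) (f : R) :
    B_ ξ (fn f) = interior (π.sharp (A.dFun f)) ξ := by
  rw [koszulBracket_skew A.bracket_self π hξ (isHom_of _), koszulBracket_fn]
  simp [pow_succ]

theorem koszulBracket_three_fn (ξ : VForms R L R) (hξ : IsHom 3 ξ) (f : R) :
    B_ ξ (fn f) = -interior (π.sharp (A.dFun f)) ξ := by
  rw [koszulBracket_skew A.bracket_self π hξ (isHom_of _), koszulBracket_fn]
  simp [pow_succ]

theorem deformedTwisted_dual_left (α γ : Module.Dual R L) (X : L) :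
    ((deformedTwisted A π N σ H).bracket (0, α) (X, γ)).2 =
      (S_).dFun (α X) - (S_).lieDer X α + A.koszul π α γ := by
  rw [show (X, γ) = (X, (0 : Module.Dual R L)) + (0, γ) by simp, map_add, deformedTwisted_dual_vec,
    deformedTwisted_dual]
  rfl

theorem deformedTwisted_vec_left (hψ : ∀ v, ψ v = -A.d σ v) (X Y : L) (γ : Module.Dual R L) :
    ((deformedTwisted A π N σ H).bracket (X, 0) (Y, γ)).2 =
      contract₂ (φ_) X Y + (S_).lieDer X γ := by
  rw [show (Y, γ) = (Y, (0 : Module.Dual R L)) + (0, γ) by simp, map_add, Prod.snd_add,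
    deformedTwisted_vec hψ, deformedTwisted_vec_dual]

theorem deformedTwisted_vec_right (hψ : ∀ v, ψ v = -A.d σ v) (X Y : L) (γ : Module.Dual R L) :
    ((deformedTwisted A π N σ H).bracket (X, γ) (Y, 0)).2 =
      contract₂ (φ_) X Y + ((S_).dFun (γ Y) - (S_).lieDer Y γ) := by
  rw [show (X, γ) = (X, (0 : Module.Dual R L)) + (0, γ) by simp, map_add, AddMonoidHom.add_apply,
    Prod.snd_add, deformedTwisted_vec hψ, deformedTwisted_dual_vec]

/-- Both sides are `ρ(Nπ♯df) g`, once `π♯ ᵗN` is replaced by `Nπ♯`. -/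
theorem quasiDiff_fn_fn (hc : ∀ α, N (π.sharp α) = π.sharp (N.dualMap α)) (f g : R) :
    B_ (δ_ (fn f)) (fn g) = B_ (fn f) (δ_ (fn g)) := by
  have h0 : (S_).dFun f = N.dualMap (A.dFun f) := rfl
  have h : π.sharp ((S_).dFun f) = N (π.sharp (A.dFun f)) := by rw [h0, hc]
  rw [diff_fn, diff_fn, koszulBracket_cov_fn, koszulBracket_fn, interior_cov, h]
  rfl

theorem anchor_dualLie (hC : IsCourant (deformedTwisted A π N σ H)) (α : Module.Dual R L) (X : L)
    (f : R) : A.anchor (N (dualLie (S := A.toAnchoredBracket) π α X) +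
        π.sharp ((S_).dFun (α X) - (S_).lieDer X α)) f =
      A.anchor (π.sharp α) (A.anchor (N X) f) - A.anchor (N X) (A.anchor (π.sharp α) f) := by
  have h := DFunLike.congr_fun (hC.anchor_bracket (0, α) (X, 0)) f
  rw [deformedTwisted_dual_vec, deformedTwisted_anchor, Derivation.commutator_apply,
    deformedTwisted_anchor, deformedTwisted_anchor] at h
  simpa using h

/-- Contracted with `X`, this is the compatibility of the anchor with the bracket of `α` and `X`. -/
theorem quasiDiff_cov_fn (hC : IsCourant (deformedTwisted A π N σ H)) (α : Module.Dual R L)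
    (f : R) : δ_ (B_ (cov α) (fn f)) = B_ (δ_ (cov α)) (fn f) + B_ (cov α) (δ_ (fn f)) := by
  have hα : IsHom 1 (cov α) := isHom_of _
  have hf : IsHom 0 (fn f : VForms R L R) := isHom_of _
  refine IsHom.ext_interior (p := 0) ?_ ?_ fun X => ?_
  · exact (hα.koszulBracket A.bracket_self π hf (n := 0) rfl).diff _
  · exact ((hα.diff _).koszulBracket A.bracket_self π hf (n := 1) rfl).add
      (hα.koszulBracket A.bracket_self π (hf.diff _) (n := 1) rfl)
  have h := anchor_dualLie hC α X f
  have h1 := π.skew ((S_).dFun (α X) - (S_).lieDer X α) (A.dFun f)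
  rw [koszulBracket_cov_fn, diff_fn, koszulBracket_two _ (hα.diff _), interior_diff_cov, diff_fn,
    map_add, interior_koszulBracket_cov, interior_cov, interior_cov, interior_cov,
    koszulBracket_cov_fn, interior_cov, sub_eq_add_neg (fn _), ← fn_neg, ← fn_add, ← fn_add]
  congr 1
  simp only [dFun_apply, lieDer_apply, LinearMap.sub_apply, quasiBracket_anchor, map_add, map_sub,
    Derivation.add_apply, Derivation.sub_apply] at h h1 ⊢
  rw [bracket_skew (quasiBracket_self A π N H) X (π.sharp (A.dFun f)), map_neg]
  linear_combination h - h1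

/-- Contracted with `X`, this is the A*-component of the Jacobi identity for `α`, `β`, `X`. -/
theorem quasiDiff_cov_cov (hC : IsCourant (deformedTwisted A π N σ H)) (α β : Module.Dual R L) :
    δ_ (B_ (cov α) (cov β)) = B_ (δ_ (cov α)) (cov β) + B_ (cov α) (δ_ (cov β)) := by
  have hα : IsHom 1 (cov α) := isHom_of _
  have hβ : IsHom 1 (cov β) := isHom_of _
  refine IsHom.ext_interior (p := 1) ?_ ?_ fun X => ?_
  · exact (hα.koszulBracket A.bracket_self π hβ (n := 1) rfl).diff _
  · exact ((hα.diff _).koszulBracket A.bracket_self π hβ (n := 2) rfl).add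
      (hα.koszulBracket A.bracket_self π (hβ.diff _) (n := 2) rfl)
  have h := congrArg Prod.snd (hC.jacobi (0, α) (0, β) (X, 0))
  have neg : ∀ α β γ, A.koszul π α (β - γ) = -A.koszul π α (γ - β) := fun α β γ => by
    rw [← neg_sub, ← dualBracket_bracket, map_neg, dualBracket_bracket]
  rw [koszulBracket_skew A.bracket_self π (hα.diff _) hβ, koszulBracket_cov_cov, map_add, map_neg,
    map_smul, interior_diff_cov, interior_koszulBracket_cov, interior_koszulBracket_cov,
    interior_diff_cov, interior_diff_cov, interior_diff_cov, interior_diff_cov,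
    koszulBracket_cov_cov, koszulBracket_cov_cov]
  rw [Prod.snd_add, deformedTwisted_dual_vec, deformedTwisted_dual_vec, deformedTwisted_dual,
    deformedTwisted_dual_vec, deformedTwisted_dual_left, deformedTwisted_dual_left, neg, neg β] at h
  rw [show (-1 : R) ^ ((1 + 1 + 1) * (1 + 1)) = 1 by norm_num, one_smul, ← cov_sub, ← cov_neg,
    ← cov_sub, ← cov_add]
  congr 1
  linear_combination (norm := module) h

/-- Contracted with `X` and `Y`, this is the compatibility of the anchor with the bracket of `X` and
`Y`: the A*-component `φ(X, Y, ·)` of that bracket accounts for the failure of `δ² = 0`. -/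
theorem quasiDiff_sq_fn (hC : IsCourant (deformedTwisted A π N σ H))
    (hψ : ∀ v, ψ v = -A.d σ v) (f : R) : δ_ (δ_ (fn f)) = B_ (of (φ_)) (fn f) := by
  have hf : IsHom 0 (fn f : VForms R L R) := isHom_of _
  have hφ : IsHom 3 (of (φ_)) := isHom_of _
  refine IsHom.ext_interior (p := 1) ((hf.diff _).diff _)
    (hφ.koszulBracket A.bracket_self π hf (n := 2) rfl) fun X =>
    IsHom.ext_interior (p := 0) (((hf.diff _).diff _).interior X)
      ((hφ.koszulBracket A.bracket_self π hf (n := 2) rfl).interior X) fun Y => ?_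
  have h := DFunLike.congr_fun (hC.anchor_bracket (X, 0) (Y, 0)) f
  rw [deformedTwisted_vec hψ, deformedTwisted_anchor, Derivation.commutator_apply,
    deformedTwisted_anchor, deformedTwisted_anchor] at h
  rw [koszulBracket_three_fn _ hφ, map_neg, map_neg, VForms.interior_interior X
    (π.sharp (A.dFun f)), map_neg, neg_neg,
    VForms.interior_interior Y (π.sharp (A.dFun f)), interior_interior_three, interior_cov, diff_fn, interior_diff_cov,
    interior_cov, ← fn_neg]
  congr 1
  rw [← π.skew (contract₂ (φ_) X Y) (A.dFun f)]
  simp only [dFun_apply, lieDer_apply, LinearMap.sub_apply, quasiBracket_anchor, map_add, map_zero,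
    add_zero, Derivation.add_apply] at h ⊢
  linear_combination -h

/-- Contracted with `X` and `Y`, this is the A*-component of the Jacobi identity for `α`, `X`, `Y`.
-/
theorem quasiDiff_sq_cov (hC : IsCourant (deformedTwisted A π N σ H))
    (hψ : ∀ v, ψ v = -A.d σ v) (α : Module.Dual R L) :
    δ_ (δ_ (cov α)) = B_ (of (φ_)) (cov α) := by
  have hα : IsHom 1 (cov α) := isHom_of _
  have hφ : IsHom 3 (of (φ_)) := isHom_of _
  refine IsHom.ext_interior (p := 2) ((hα.diff _).diff _)
    (hφ.koszulBracket A.bracket_self π hα (n := 3) rfl) fun X =>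
    IsHom.ext_interior (p := 1) (((hα.diff _).diff _).interior X)
      ((hφ.koszulBracket A.bracket_self π hα (n := 3) rfl).interior X) fun Y => ?_
  have h := congrArg Prod.snd (hC.jacobi (0, α) (X, 0) (Y, 0))
  rw [Prod.snd_add, deformedTwisted_dual_vec, deformedTwisted_dual_vec, deformedTwisted_vec hψ,
    deformedTwisted_dual_left, deformedTwisted_vec_left hψ, deformedTwisted_vec_right hψ] at h
  rw [koszulBracket_skew A.bracket_self π hφ hα, map_neg, map_smul, map_neg, map_smul,
    interior_koszulBracket_cov, map_sub, interior_koszulBracket_cov, interior_interior_three,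
    interior_interior_three, interior_interior_three, koszulBracket_cov_cov,
    interior_diff, map_sub, interior_lie, interior_diff_cov, interior_diff_cov, interior_diff_cov,
    lie_cov, interior_diff_cov]
  rw [show (-1 : R) ^ ((3 + 1) * (1 + 1)) = 1 by norm_num, one_smul, ← cov_sub, ← cov_sub,
    ← cov_sub, ← cov_sub, ← cov_neg]
  congr 1
  have n : ∀ X, (S_).dFun (α X) - (S_).lieDer X α = -((S_).lieDer X α - (S_).dFun (α X)) :=
    fun X => (neg_sub _ _).symm
  simp only [n, lieDer_neg_right, LinearMap.neg_apply, dFun_neg] at h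
  linear_combination (norm := module) h

/-- Contracted three times, this is the A*-component of the Jacobi identity for `X`, `Y`, `Z`. -/
theorem quasiDiff_quasiForm (hC : IsCourant (deformedTwisted A π N σ H))
    (hψ : ∀ v, ψ v = -A.d σ v) : δ_ (of (φ_)) = 0 := by
  have hφ : IsHom 3 (of (φ_)) := isHom_of _
  refine IsHom.ext_interior (p := 3) (hφ.diff _) (isHom_zero 4) fun X =>
    IsHom.ext_interior (p := 2) ((hφ.diff _).interior X) ((isHom_zero 4).interior X) fun Y =>
    IsHom.ext_interior (p := 1) (((hφ.diff _).interior X).interior Y)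
      (((isHom_zero 4).interior X).interior Y) fun Z => ?_
  have h := congrArg Prod.snd (hC.jacobi (X, 0) (Y, 0) (Z, 0))
  rw [Prod.snd_add, deformedTwisted_vec hψ, deformedTwisted_vec hψ, deformedTwisted_vec hψ,
    deformedTwisted_vec_left hψ, deformedTwisted_vec_left hψ, deformedTwisted_vec_right hψ] at h
  rw [interior_diff, map_sub, map_sub, interior_lie, interior_diff, map_sub, map_sub, interior_lie,
    interior_lie, interior_interior_three, interior_interior_three, interior_interior_three,
    interior_interior_three, interior_interior_three, interior_interior_three, interior_diff_cov, lie_cov, lie_cov, map_zero,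
    map_zero, map_zero, ← cov_sub, ← cov_sub, ← cov_sub, ← cov_sub, ← cov_sub]
  rw [show (0 : VForms R L R) = cov 0 from
    (sub_self (cov 0)).symm.trans (by rw [← cov_sub, sub_self])]
  congr 1
  linear_combination (norm := module) h

end QuasiBialgebroid

end AnchoredBracket

namespace VForms

theorem IsHom.invol_pow_eq {R : Type*} [CommRing R] {L N : Type*} [AddCommGroup L] [Module R L]
    [AddCommGroup N] [Module R N] {p : ℕ} {ξ : VForms R L N} (h : IsHom p ξ) (k : ℕ) :
    (VForms.invol ^ k : Module.End R (VForms R L N)) ξ = (-1 : R) ^ (k * p) • ξ := by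
  induction k with
  | zero => simp
  | succ k ih =>
    rw [pow_succ, Module.End.mul_apply, h.invol_eq, map_smul, ih, smul_smul, ← pow_add]
    congr 2
    ring

end VForms

namespace AnchoredBracket

open VForms

/-! ### Assembly of the Lie quasi-bialgebroid. -/

section DefinesQuasiBialgebroid

variable {R : Type*} [CommRing R] [Algebra ℝ R] {L : Type*} [AddCommGroup L] [Module R L]
  {A : LieAlgebroid R L} {π : Bivector R L} {N : Module.End R L}
  {σ : L [⋀^Fin 2]→ₗ[R] R} {H ψ : L [⋀^Fin 3]→ₗ[R] R}

theorem koszul_jacobi (hC : IsCourant (deformedTwisted A π N σ H)) (α β γ : Module.Dual R L) :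
    A.koszul π α (A.koszul π β γ) =
      A.koszul π (A.koszul π α β) γ + A.koszul π β (A.koszul π α γ) := by
  have h := congrArg Prod.snd (hC.jacobi (0, α) (0, β) (0, γ))
  simpa only [deformedTwisted_dual, Prod.snd_add] using h

theorem anchor_koszul (hC : IsCourant (deformedTwisted A π N σ H)) (α β : Module.Dual R L) :
    A.anchor (π.sharp (A.koszul π α β)) = ⁅A.anchor (π.sharp α), A.anchor (π.sharp β)⁆ := by
  have h := hC.anchor_bracket (0, α) (0, β)
  simpa only [deformedTwisted_dual, deformedTwisted_anchor, map_zero, zero_add] using h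

/-- The Lie algebroid `A*` with the Koszul bracket. -/
def dualLieAlgebroid (hC : IsCourant (deformedTwisted A π N σ H)) :
    LieAlgebroid R (Module.Dual R L) where
  toAnchoredBracket := dualBracket A π
  bracket_self α := by
    ext Z
    rw [dualBracket_bracket, koszul_apply, π.alt]
    simp
  jacobi := koszul_jacobi hC
  anchor_bracket := anchor_koszul hC

theorem isGerstenhaber_koszulBracket (hL : LocallyFramed R L)
    (hC : IsCourant (deformedTwisted A π N σ H)) :
    IsGerstenhaber (koszulBracket A.bracket_self π) where
  degree_zero P Q := by
    obtain ⟨f, hf⟩ := exists_fn (isHom_of P)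
    obtain ⟨g, hg⟩ := exists_fn (isHom_of Q)
    exact (congrArg₂ (fun a b => koszulBracket A.bracket_self π a b) hf hg).trans
      (koszulBracket_fn_fn _ _ f g)
  degree p q n P Q hn := (isHom_of P).koszulBracket A.bracket_self π (isHom_of Q) hn
  skew p q P Q := by
    rw [real_neg_one_pow_smul]
    exact koszulBracket_skew A.bracket_self π (isHom_of P) (isHom_of Q)
  leibniz p q P Q T := by
    have h := (isDer_koszulBracket A.bracket_self π (isHom_of P)).mul (of Q) T
    rw [real_neg_one_pow_smul]
    rw [IsHom.invol_pow_eq (isHom_of Q), map_smul, LinearMap.smul_apply] at h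
    exact h
  jacobi p q P Q T := by
    rw [real_neg_one_pow_smul]
    have h := jacobiator_eq_zero (hS := A.bracket_self) (π := π) hL (fun α β f => by
      rw [anchor_koszul hC, Derivation.commutator_apply]) (koszul_jacobi hC) (isHom_of P)
      (isHom_of Q) T
    rw [jacobiator, sub_sub] at h
    exact sub_eq_zero.mp h

/-- The Lie quasi-bialgebroid structure on `(A*, A)` encoded by the deformed structure. -/
def lieQuasiBialgebroid (hL : LocallyFramed R L) (hc : ∀ α, N (π.sharp α) = π.sharp (N.dualMap α))
    (hψ : ∀ v, ψ v = -A.d σ v) (hC : IsCourant (deformedTwisted A π N σ H)) :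
    LieQuasiBialgebroid R L where
  lie := dualLieAlgebroid hC
  gerst := koszulBracket A.bracket_self π
  δ := diff (quasiBracket_self A π N H)
  φ := quasiForm N H ψ
  isGerstenhaber := isGerstenhaber_koszulBracket hL hC
  gerst_fun := koszulBracket_cov_fn A.bracket_self π
  gerst_one := koszulBracket_cov_cov π A.bracket_self
  δ_degree p P := (isHom_of P).diff _
  δ_wedge p P T := by
    rw [real_neg_one_pow_smul]
    -- `VForms.mul` and `Forms.wedge` agree by unfolding, since `LinearMap.mul'` is the lift of the
    -- multiplication.
    refine (diff_mul _ _ _).trans ?_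
    rw [(isHom_of P).invol_eq, map_smul]
    rfl
  δ_gerst p P T := by
    rw [real_neg_one_pow_smul]
    exact derivation_koszulBracket hL (isDer_diff _) (fun p P hP => hP.diff _)
      (quasiDiff_fn_fn hc) (quasiDiff_cov_fn hC) (quasiDiff_cov_cov hC) (isHom_of P) T
  δ_sq T := derivation_sq hL (isDer_diff _) (isHom_of _) (quasiDiff_sq_fn hC hψ)
    (quasiDiff_sq_cov hC hψ) T
  δ_φ := quasiDiff_quasiForm hC hψ

theorem definesLieQuasiBialgebroid (hL : LocallyFramed R L)
    (hc : ∀ α, N (π.sharp α) = π.sharp (N.dualMap α))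
    (hψ : ∀ v, ψ v = -A.d σ v) (hC : IsCourant (deformedTwisted A π N σ H)) :
    DefinesLieQuasiBialgebroid (deformedTwisted A π N σ H) := by
  refine ⟨lieQuasiBialgebroid hL hc hψ hC, fun α => ?_, fun α β => deformedTwisted_dual ..,
    fun f => ⟨_, diff_fn _ f, fun X => ?_⟩, fun α => ⟨_, diff_of _ _, fun X Y => ?_⟩,
    fun X Y Z => ?_⟩
  · rw [deformedTwisted_anchor, map_zero, zero_add]; rfl
  · rw [deformedTwisted_anchor, map_zero, add_zero]; rfl
  · have h := interior_diff_cov (hS := quasiBracket_self A π N H) X α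
    rw [diff_of, interior_of_succ] at h
    have h1 := DFunLike.congr_fun (of_injective h) ![Y]
    rw [AlternatingMap.curryLeft_apply_apply, AlternatingMap.ofSubsingleton_apply_apply,
      LinearMap.sub_apply, lieDer_apply, dFun_apply] at h1
    rw [deformedTwisted_anchor, deformedTwisted_anchor, deformedTwisted_vec hψ]
    refine h1.trans ?_
    simp only [quasiBracket_anchor, map_zero, add_zero, Matrix.cons_val]
    ring
  · rw [deformedTwisted_vec hψ]; rfl

end DefinesQuasiBialgebroid

end AnchoredBracket

/-! ### Smooth sections are locally framed. -/

section SmoothSections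

open Bundle

variable {E : Type*} [NormedAddCommGroup E] [NormedSpace ℝ E] [FiniteDimensional ℝ E]
    {HM : Type*} [TopologicalSpace HM] {I : ModelWithCorners ℝ E HM}
    {M : Type*} [TopologicalSpace M] [ChartedSpace HM M] [IsManifold I ∞ M] [T2Space M]
    {F : Type*} [NormedAddCommGroup F] [NormedSpace ℝ F] [FiniteDimensional ℝ F]
    {V : M → Type*} [TopologicalSpace (Bundle.TotalSpace F V)]
    [∀ x, AddCommGroup (V x)] [∀ x, Module ℝ (V x)] [∀ x, TopologicalSpace (V x)]
    [FiberBundle F V] [VectorBundle ℝ F V] [ContMDiffVectorBundle ∞ F V I]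

/-- With `f` a bump function supported in the domain of a trivialization, `χ = f²` works: one factor
`f` makes the local frame global, the other makes the coefficient functionals global. -/
theorem exists_isFraming (x : M) :
    ∃ χ : C^∞⟮I, M; ℝ⟯, IsFraming Cₛ^∞⟮I; F, V⟯ χ ∧ χ x = 1 := by
  have : ContMDiffVectorBundle 1 F V I := ContMDiffVectorBundle.of_le (n := ∞) (by simp)
  let e := trivializationAt F V x
  let b := Module.finBasis ℝ F
  obtain ⟨f, -, hf⟩ := (SmoothBumpFunction.nhds_basis_tsupport (I := I) x).mem_iff.mp
    (e.open_baseSet.mem_nhds (FiberBundle.mem_baseSet_trivializationAt F V x))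
  have hzero : ∀ y, y ∉ e.baseSet → f y = 0 := fun y hy =>
    image_eq_zero_of_notMem_tsupport fun h => hy (hf h)
  let fs : C^∞⟮I, M; ℝ⟯ := ⟨f, f.contMDiff⟩
  let s : Fin (Module.finrank ℝ F) → Cₛ^∞⟮I; F, V⟯ := fun i =>
    ⟨(f : M → ℝ) • e.localFrame b i, ContMDiffOn.smul_section_of_tsupport f.contMDiff.contMDiffOn
      e.open_baseSet hf (e.contMDiffOn_localFrame_baseSet ∞ b i)⟩
  have hcoeff : ∀ i (X : Cₛ^∞⟮I; F, V⟯), ContMDiff I 𝓘(ℝ, ℝ) ∞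
      fun y => f y • e.localFrameCoeff I b i y (X y) := fun i X =>
    contMDiff_of_tsupport fun y hy => by
      have hy' : y ∈ e.baseSet := hf (tsupport_smul_subset_left _ _ hy)
      exact f.contMDiffAt.smul (contMDiffAt_localFrameCoeff b hy'
        X.contMDiff.contMDiffAt i)
  let ε : Fin (Module.finrank ℝ F) → Module.Dual C^∞⟮I, M; ℝ⟯ Cₛ^∞⟮I; F, V⟯ := fun i =>
    { toFun := fun X => ⟨_, hcoeff i X⟩
      map_add' := fun X Y => by
        ext y
        change f y • e.localFrameCoeff I b i y (X y + Y y) = f y • e.localFrameCoeff I b i y (X y) +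
          f y • e.localFrameCoeff I b i y (Y y)
        rw [map_add, smul_add]
      map_smul' := fun g X => by
        ext y
        change f y • e.localFrameCoeff I b i y (g y • X y) =
          g y * (f y • e.localFrameCoeff I b i y (X y))
        rw [map_smul, smul_eq_mul, smul_eq_mul, smul_eq_mul, mul_left_comm] }
  refine ⟨fs * fs, ⟨_, s, ε, fun X => ?_⟩, ?_⟩
  · ext y
    have hsum : (∑ i, ε i X • s i) y = ∑ i, (f y * e.localFrameCoeff I b i y (X y)) •
        (f y • e.localFrame b i y) := by
      let ev : Cₛ^∞⟮I; F, V⟯ →+ V y := ⟨⟨fun s => s y, rfl⟩, fun _ _ => rfl⟩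
      exact map_sum ev _ _
    rw [hsum, smoothSection_smul_apply]
    change (f y * f y) • X y = _
    by_cases hy : y ∈ e.baseSet
    · conv_lhs => rw [Bundle.Trivialization.eq_sum_localFrameCoeff_smul (I := I) (b := b) (s := X) hy]
      rw [Finset.smul_sum]
      refine Finset.sum_congr rfl fun i _ => ?_
      rw [smul_smul, smul_smul]
      congr 1
      ring
    · simp [hzero y hy]
  · change f x * f x = 1
    rw [f.eq_one, one_mul]

theorem locallyFramed_smoothSection : LocallyFramed C^∞⟮I, M; ℝ⟯ Cₛ^∞⟮I; F, V⟯ where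
  eq_zero a h := by
    ext x
    obtain ⟨χ, hχ, h1⟩ := exists_isFraming (I := I) (F := F) (V := V) x
    have h2 : χ x * a x = 0 := DFunLike.congr_fun (h χ hχ) x
    rwa [h1, one_mul] at h2
  section_eq_zero X h := by
    ext x
    obtain ⟨χ, hχ, h1⟩ := exists_isFraming (I := I) (F := F) (V := V) x
    have h2 : χ x • X x = 0 := DFunLike.congr_fun (h χ hχ) x
    rwa [h1, one_smul] at h2

end SmoothSections

end

theorem mainTheorem5
    {E : Type*} [NormedAddCommGroup E] [NormedSpace ℝ E] [FiniteDimensional ℝ E]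
    {HM : Type*} [TopologicalSpace HM] (I : ModelWithCorners ℝ E HM)
    {M : Type*} [TopologicalSpace M] [ChartedSpace HM M] [IsManifold I ∞ M]
    [BoundarylessManifold I M] [T2Space M] [SecondCountableTopology M]
    (F : Type*) [NormedAddCommGroup F] [NormedSpace ℝ F] [FiniteDimensional ℝ F]
    (V : M → Type*) [TopologicalSpace (Bundle.TotalSpace F V)]
    [∀ x, AddCommGroup (V x)] [∀ x, Module ℝ (V x)] [∀ x, TopologicalSpace (V x)]
    [FiberBundle F V] [VectorBundle ℝ F V] [ContMDiffVectorBundle ∞ F V I]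
    (A : LieAlgebroid C^∞⟮I, M; ℝ⟯ Cₛ^∞⟮I; F, V⟯)
    (π : Bivector C^∞⟮I, M; ℝ⟯ Cₛ^∞⟮I; F, V⟯)
    (N : Module.End C^∞⟮I, M; ℝ⟯ Cₛ^∞⟮I; F, V⟯)
    (σ : Cₛ^∞⟮I; F, V⟯ [⋀^Fin 2]→ₗ[C^∞⟮I, M; ℝ⟯] C^∞⟮I, M; ℝ⟯)
    (ψ H : Cₛ^∞⟮I; F, V⟯ [⋀^Fin 3]→ₗ[C^∞⟮I, M; ℝ⟯] C^∞⟮I, M; ℝ⟯)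
    (hψ : ∀ v, ψ v = -A.d σ v)
    (h : IsPoissonQuasiNijenhuis A π N ψ H) :
    DefinesLieQuasiBialgebroid
        (bigBracket (π.toEnd + tensorToEnd N + twoFormToEnd σ)
          (A.hamiltonian + backgroundHamiltonian H)) ∧
      IsCourant
        (bigBracket (π.toEnd + tensorToEnd N + twoFormToEnd σ)
          (A.hamiltonian + backgroundHamiltonian H)) := by
  have hL : LocallyFramed C^∞⟮I, M; ℝ⟯ Cₛ^∞⟮I; F, V⟯ := locallyFramed_smoothSection
  -- `deformedTwisted` unfolds to the Hamiltonian of the statement.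
  have hC := AnchoredBracket.isCourant_deformedTwisted hL.separating h hψ
  exact ⟨AnchoredBracket.definesLieQuasiBialgebroid hL (LinearMap.congr_fun h.comm) hψ hC, hC⟩
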